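/- \textbf{Setting.} Let $r>0$, $b\in\mathbb R$, $\sigma\neq0$, $K\in\mathbb R$, let $W$ be a standard Brownian motion and let $X_t=x\exp\bigl((b-\sigma^2)t+\sqrt2\,\sigma W_t\bigr)$ be the geometric Brownian motion $dX_t=bX_t\,dt+\sqrt2\,\sigma X_t\,dW_t$, $X_0=x>0$. Let $h:\,]0,\infty[\,\to\mathbb R$ be right-continuous and increasing (not necessarily strictly), with $\lim_{x\to\infty}h(x)=\infty$ and $\mathbb E\int_0^\infty e^{-rt}|h(X_t)|\,dt<\infty$ for every $x>0$; put $h(0)=\lim_{x\downarrow0}h(x)\in[-\infty,\infty[$. Let $m<0<n$ be the roots of $\sigma^2k^2+(b-\sigma^2)k-r=0$ and $$R_h(x)=\frac1{\sigma^2(n-m)}\Bigl[x^m\!\int_0^x\! s^{-m-1}h(s)\,ds+x^n\!\int_x^\infty\! s^{-n-1}h(s)\,ds\Bigr].$$ For switching costs $K_1,K_0>0$, the HJB equation is the system $$\max\bigl\{\sigma^2x^2w_1''+bxw_1'-rw_1+h,\ w_0-w_1-K_0,\ -w_1-K\bigr\}=0,$$ $$\max\bigl\{\sigma^2x^2w_0''+bxw_0'-rw_0,\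 w_1-w_0-K_1,\ -w_0-K\bigr\}=0 ;$$ that $(w_1,w_0)$ satisfies it means that $w_1,w_0$ are $C^1$ on $]0,\infty[$ and that, apart from finitely many $x>0$, they are twice differentiable and satisfy both equations at every point $x>0$ at which $h$ is continuous. Consider the system of equations in $(\delta_\dagger,\zeta,\alpha)$ $$\int_{\delta_\dagger}^\infty s^{-n-1}[h(s)+rK]\,ds=0,\tag{1}$$ $$m\int_{\delta_\dagger}^\alpha s^{-m-1}[h(s)-rK_1]\,ds+r(K_1+K)\delta_\dagger^{-m}-rK\zeta^{-m}=0,\tag{2}$$ $$-n\int_{\delta_\dagger}^\alpha s^{-n-1}[h(s)-rK_1]\,ds-r(K_1+K)\delta_\dagger^{-n}+rK\zeta^{-n}=0,\tag{3}$$ subject to $$0<\delta_\dagger\wedge\zeta\le\delta_\dagger\vee\zeta<\alpha .\tag{4}$$ For a solution put $$A=-\frac1{\sigma^2(n-m)}\int_0^{\delta_\dagger}s^{-m-1}[h(s)+rK]\,ds,\quad \Delta_1=A+\frac1{\sigma^2(n-m)}\int_0^\alpha s^{-m-1}[h(s)-rK_1]\,ds,\quad \Delta_2=\frac1{\sigma^2(n-m)}\int_\alpha^\infty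 s^{-n-1}[h(s)-rK_1]\,ds,$$ $$w_1(x)=\begin{cases}-K,&x\le\delta_\dagger,\\Ax^m+R_h(x),&x>\delta_\dagger,\end{cases}\qquad w_0(x)=\begin{cases}-K,&x\le\zeta,\\\Delta_1x^m+\Delta_2x^n,&\zeta<x\le\alpha,\\Ax^m+R_h(x)-K_1,&x>\alpha.\end{cases}$$ \textbf{Statement.} (a) If $h(0)<-rK$, then (1) has a unique solution $\delta_\dagger>0$. If $K<0$ and $h(0)<-rK$, then for every $K_1>0$ the system (1)--(3) has a unique solution $(\delta_\dagger,\zeta,\alpha)$ satisfying (4) (it does not involve $K_0$), and $A>0$, $\Delta_1=\frac{rK\zeta^{-m}}{\sigma^2m(n-m)}>0$, $\Delta_2=-\frac{rK\zeta^{-n}}{\sigma^2n(n-m)}>0$. (b) Suppose $K<0$, $h(0)<-rK$ and $h(\delta_\dagger)<0$. There is a unique $K_1^\dagger>0$, depending on neither $K_1$ nor $K_0$, such that $\zeta<\delta_\dagger$ for all $K_1\in\,]0,K_1^\dagger[$ and $\delta_\dagger<\zeta$ for all $K_1>K_1^\dagger$. For $K_1\in\,]0,K_1^\dagger[$ there is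 a unique $\hat x\in\,]\delta_\dagger,\alpha[$ such that $(w_0-w_1)'>0$ on $]\zeta,\hat x[$ and $(w_0-w_1)'<0$ on $]\hat x,\alpha[$, and $$K_0^\dagger=K_0^\dagger(K_1):=-K_1-\frac{n\hat x^n}{r}\int_{\hat x}^\alpha s^{-n-1}[h(s)-rK_1]\,ds,$$ which does not depend on $K_0$, is strictly positive. Furthermore, $\lim_{K_1\uparrow K_1^\dagger}K_0^\dagger(K_1)=0$. (c) For all $K_1,K_0>0$, the following are equivalent: (i) the system (1)--(3) has a unique solution satisfying (4), and the associated functions $w_1,w_0$ are increasing on $]0,\infty[$ and satisfy the HJB equation; (ii) $K<0$, $h(0)<-rK$ and one of the following holds: $-rK_0\le h(0)$; or $h(0)<-rK_0$ and $h(\delta_\dagger)\ge0$; or $h(0)<-rK_0$, $h(\delta_\dagger)<0$ and $K_1\ge K_1^\dagger$; or $h(0)<-rK_0$, $h(\delta_\dagger)<0$, $K_1<K_1^\dagger$ and $K_0\ge K_0^\dagger(K_1)$. (d) If $K<0$, $h(0)<-rK$ and $K_1>0$, then: $0<\zeta<\delta_\dagger$ if $h(\delta_\dagger)<0$ and $K_1<K_1^\dagger$;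 $0<\zeta=\delta_\dagger$ if $h(\delta_\dagger)<0$ and $K_1=K_1^\dagger$; $0<\delta_\dagger<\zeta$ if $h(\delta_\dagger)\ge0$, or if $h(\delta_\dagger)<0$ and $K_1>K_1^\dagger$. -/

import Mathlib

open MeasureTheory ProbabilityTheory Filter Topology Set
open scoped NNReal ENNReal

noncomputable section

/-- The problem data other than the switching costs: the discount rate `r`, the drift `b` and the
volatility parameter `σ` of the state process `dX = b X dt + √2 σ X dW`, the abandonment cost `K`
and the running payoff `h`. Only the values of `h` on `]0, ∞[` matter. -/
structure SwitchData where
  r : ℝ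
  b : ℝ
  σ : ℝ
  K : ℝ
  h : ℝ → ℝ

namespace SwitchData

variable (D : SwitchData)

/-- The geometric Brownian motion `dX = b X dt + √2 σ X dW`, `X₀ = x`, driven by `W`. -/
def gbm {Ω : Type*} (W : ℝ≥0 → Ω → ℝ) (x : ℝ) (t : ℝ≥0) (ω : Ω) : ℝ :=
  x * Real.exp ((D.b - D.σ ^ 2) * t + √2 * D.σ * W t ω)

/-- The standing assumption on the running payoff: `h` is right-continuous and increasing on
`]0, ∞[`, tends to `∞` at `∞`, and `𝔼 ∫₀^∞ e^{-rt} |h(X_t)| dt < ∞` for all `X₀ = x > 0`. -/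
structure PayoffAssumption {Ω : Type*} [MeasurableSpace Ω] (P : Measure Ω)
    (W : ℝ≥0 → Ω → ℝ) : Prop where
  rightCont : ∀ x, 0 < x → ContinuousWithinAt D.h (Ici x) x
  increasing : MonotoneOn D.h (Ioi 0)
  tendsto_atTop : Tendsto D.h atTop atTop
  integrability : ∀ x, 0 < x →
    ∫⁻ ω, (∫⁻ t in Ioi (0 : ℝ),
      ENNReal.ofReal (Real.exp (-D.r * t) * |D.h (D.gbm W x t.toNNReal ω)|)) ∂P < ∞

/-- `h(0) := lim_{x ↓ 0} h(x)`, a number in `[-∞, ∞[`. -/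
def h0 : EReal := limUnder (𝓝[>] (0 : ℝ)) (fun x : ℝ => (D.h x : EReal))

/-- The root `m < 0` of `σ² k² + (b - σ²) k - r = 0`. -/
def m : ℝ := (D.σ ^ 2 - D.b - √((D.b - D.σ ^ 2) ^ 2 + 4 * D.σ ^ 2 * D.r)) / (2 * D.σ ^ 2)

/-- The root `n > 0` of `σ² k² + (b - σ²) k - r = 0`. -/
def n : ℝ := (D.σ ^ 2 - D.b + √((D.b - D.σ ^ 2) ^ 2 + 4 * D.σ ^ 2 * D.r)) / (2 * D.σ ^ 2)

/-- The particular solution `R_h` of `σ² x² w'' + b x w' - r w + h = 0`. -/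
def R (x : ℝ) : ℝ :=
  1 / (D.σ ^ 2 * (D.n - D.m)) *
    (x ^ D.m * (∫ s in Ioc 0 x, s ^ (-D.m - 1) * D.h s) +
      x ^ D.n * (∫ s in Ioi x, s ^ (-D.n - 1) * D.h s))

/-- The equation that determines `δ_†`. -/
def DeltaEq (δ : ℝ) : Prop := ∫ s in Ioi δ, s ^ (-D.n - 1) * (D.h s + D.r * D.K) = 0

def G₁ (K₁ δ ζ α : ℝ) : ℝ :=
  D.m * (∫ s in δ..α, s ^ (-D.m - 1) * (D.h s - D.r * K₁)) +
    D.r * (K₁ + D.K) * δ ^ (-D.m) - D.r * D.K * ζ ^ (-D.m)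

def G₂ (K₁ δ ζ α : ℝ) : ℝ :=
  -D.n * (∫ s in δ..α, s ^ (-D.n - 1) * (D.h s - D.r * K₁)) -
    D.r * (K₁ + D.K) * δ ^ (-D.n) + D.r * D.K * ζ ^ (-D.n)

/-- `(δ, ζ, α)` solves the system of equations for the free-boundary points, with
`0 < δ ∧ ζ ≤ δ ∨ ζ < α`. -/
structure FreeBoundary (K₁ δ ζ α : ℝ) : Prop where
  pos : 0 < min δ ζ
  lt : max δ ζ < α
  eq_delta : D.DeltaEq δ
  eq₁ : D.G₁ K₁ δ ζ α = 0
  eq₂ : D.G₂ K₁ δ ζ α = 0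

def A (δ : ℝ) : ℝ :=
  -(1 / (D.σ ^ 2 * (D.n - D.m))) * ∫ s in Ioc 0 δ, s ^ (-D.m - 1) * (D.h s + D.r * D.K)

def Δ₁ (K₁ δ α : ℝ) : ℝ :=
  D.A δ + 1 / (D.σ ^ 2 * (D.n - D.m)) *
    ∫ s in Ioc 0 α, s ^ (-D.m - 1) * (D.h s - D.r * K₁)

def Δ₂ (K₁ α : ℝ) : ℝ :=
  1 / (D.σ ^ 2 * (D.n - D.m)) * ∫ s in Ioi α, s ^ (-D.n - 1) * (D.h s - D.r * K₁)

/-- The candidate for the value function in the "open" mode. -/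
def w₁ (δ x : ℝ) : ℝ :=
  if x ≤ δ then -D.K else D.A δ * x ^ D.m + D.R x

/-- The candidate for the value function in the "closed" mode. -/
def w₀ (K₁ δ ζ α x : ℝ) : ℝ :=
  if x ≤ ζ then -D.K
  else if x ≤ α then D.Δ₁ K₁ δ α * x ^ D.m + D.Δ₂ K₁ α * x ^ D.n
  else D.A δ * x ^ D.m + D.R x - K₁

/-- `(u₁, u₀)` satisfies the HJB equation, that is, the coupled quasi-variational inequalities:
the functions are `C¹` on `]0, ∞[` and, outside a finite set of points, they are twice
differentiable and satisfy both equations at every point of continuity of `h`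
(second derivatives fail to exist at the jumps of `h`, because `σ² x² w'' + … + h = 0` in the
production region). -/
def SatisfiesHJB (K₁ K₀ : ℝ) (u₁ u₀ : ℝ → ℝ) : Prop :=
  ContDiffOn ℝ 1 u₁ (Ioi 0) ∧ ContDiffOn ℝ 1 u₀ (Ioi 0) ∧
  ∃ F : Finset ℝ, ∀ x, 0 < x → x ∉ F → ContinuousAt D.h x →
    DifferentiableAt ℝ (deriv u₁) x ∧ DifferentiableAt ℝ (deriv u₀) x ∧
    max (D.σ ^ 2 * x ^ 2 * deriv (deriv u₁) x + D.b * x * deriv u₁ x - D.r * u₁ x + D.h x)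
      (max (u₀ x - u₁ x - K₀) (-u₁ x - D.K)) = 0 ∧
    max (D.σ ^ 2 * x ^ 2 * deriv (deriv u₀) x + D.b * x * deriv u₀ x - D.r * u₀ x)
      (max (u₁ x - u₀ x - K₁) (-u₀ x - D.K)) = 0

/-- The property that characterises the threshold `K₁^†`: `ζ < δ` for the switching-in costs in
`]0, k[` and `δ < ζ` for those in `]k, ∞[`. -/
def IsK₁Dagger (δ k : ℝ) : Prop :=
  0 < k ∧ ∀ K₁ ζ α, 0 < K₁ → D.FreeBoundary K₁ δ ζ α → (K₁ < k → ζ < δ) ∧ (k < K₁ → δ < ζ)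

/-- `y ∈ ]δ, α[` is the point where `w₀ - w₁` turns from increasing to decreasing. -/
def IsXHat (K₁ δ ζ α y : ℝ) : Prop :=
  y ∈ Ioo δ α ∧
  (∀ x ∈ Ioo ζ y, 0 < deriv (fun x => D.w₀ K₁ δ ζ α x - D.w₁ δ x) x) ∧
  (∀ x ∈ Ioo y α, deriv (fun x => D.w₀ K₁ δ ζ α x - D.w₁ δ x) x < 0)

/-- The explicit expression for the threshold `K₀^†` in terms of `α` and `x̂`. -/
def K₀Expr (K₁ α y : ℝ) : ℝ :=
  -K₁ - D.n * y ^ D.n / D.r * ∫ s in y..α, s ^ (-D.n - 1) * (D.h s - D.r * K₁)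

end SwitchData

end

noncomputable section

/-! ### Right derivatives -/

/-! Write k = -rK and c = rK₁. Equation (1) says that a weighted average of h - k over ]δ, ∞[
vanishes, which fixes δ and forces h(δ) < k. Equations (2) and (3) express k ζ^{-m} and k ζ^{-n}
through α, and eliminating ζ leaves the scalar equation `fbF` = 0. Where the eliminated ζ would
equal α, `fbF` is negative, because w₁ has positive slope there (`FBSetup.solZ_pos`,
`FBSetup.fbF_neg`). Beyond that point its right derivative is a positive factor times h - c, so it
falls while h < c and then rises above zero: there is exactly one admissible zero. Raising c moves
both ζ and α to the right (`FBSetup.sol_mono`). If h(δ) < 0, some level has ζ = δ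
(`FBSetup.exists_sol_eq`), and by monotonicity this level is the threshold K₁†; if h(δ) ≥ 0, always
δ < ζ.

With A, Δ₁, Δ₂ inserted, both candidates are constants plus multiples of the particular solution
`solY` with vanishing value and slope at a base point: base δ and payoff h in the open mode, base ζ
and payoff 0 in the closed mode. On [δ ∨ ζ, α] the difference w₀ - w₁ is -K₁ - C `solY` with base α
and level c (`Solved.sub_of_mem`), so its slope is governed by `solZ`, which changes sign at most
once to the left of α, from - to + (`IncRC.solZ_pos_of_nonneg`). This yields w₀ - w₁ ≥ -K₁ in every
case; all other parts of the HJB equation hold automatically, except the bound w₀ - w₁ ≤ K₀. If δ ≤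
ζ, then w₀ ≤ w₁ and this bound is free. If ζ < δ, the difference has a positive maximum at x̂, and
this maximum is K₀†. Comparison with the solution at the critical level bounds it by a multiple of
ζ^{-n} - δ^{-n}, which tends to 0 as K₁ ↑ K₁† (`Solved.turning_le`, `FBSetup.tendsto_sol`). If h ≥
-rK₀ throughout, the explicit expression gives K₀† ≤ K₀ at once.

Conversely, the HJB equation and uniqueness force K < 0: for K = 0 the point ζ drops out of the
system, and for K > 0 the constant -K violates the closed-mode inequality on ]0, ζ[.

The stochastic assumption enters only through integrability. Discounted Gaussian densities, tilted
by a root κ of the characteristic equation, bound the resolvent kernel of log X from below by a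
multiple of e^{-κy}. Finiteness of the expectation then makes s^{-n-1} h integrable at ∞ and
s^{-m-1} h integrable at 0.

As h may jump, primitives of h have only right derivatives; monotonicity arguments are therefore run
with one-sided derivatives. -/

theorem le_of_rightDeriv_nonneg {f f' : ℝ → ℝ} {a b : ℝ} (hab : a ≤ b)
    (hf : ContinuousOn f (Icc a b)) (hf' : ∀ x ∈ Ico a b, HasDerivWithinAt f (f' x) (Ici x) x)
    (h0 : ∀ x ∈ Ico a b, 0 ≤ f' x) : f a ≤ f b :=
  image_le_of_deriv_right_le_deriv_boundary (f := fun _ => f a) (f' := fun _ => 0)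
    continuousOn_const (fun x _ => hasDerivWithinAt_const x _ _) le_rfl hf hf' h0
    (right_mem_Icc.2 hab)

/-- Without strict growth the monotone function would be constant, and its right derivative at the
left end would be 0. -/
theorem lt_of_rightDeriv_pos {f f' : ℝ → ℝ} {a b : ℝ} (hab : a < b)
    (hf : ContinuousOn f (Icc a b)) (hf' : ∀ x ∈ Ico a b, HasDerivWithinAt f (f' x) (Ici x) x)
    (h0 : ∀ x ∈ Ico a b, 0 < f' x) : f a < f b := by
  have mono : ∀ x ∈ Icc a b, ∀ y ∈ Icc a b, x ≤ y → f x ≤ f y := fun x hx y hy hxy =>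
    le_of_rightDeriv_nonneg hxy (hf.mono (Icc_subset_Icc hx.1 hy.2))
      (fun z hz => hf' z ⟨hx.1.trans hz.1, hz.2.trans_le hy.2⟩)
      (fun z hz => (h0 z ⟨hx.1.trans hz.1, hz.2.trans_le hy.2⟩).le)
  by_contra! hle
  have hconst : ∀ x ∈ Icc a b, f x = f a := fun x hx =>
    le_antisymm ((mono x hx b (right_mem_Icc.2 hab.le) hx.2).trans hle)
      (mono a (left_mem_Icc.2 hab.le) x hx hx.1)
  have h1 : HasDerivWithinAt f 0 (Ici a) a := by
    refine (hasDerivWithinAt_const a (Ici a) (f a)).congr_of_eventuallyEq ?_ rfl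
    filter_upwards [Icc_mem_nhdsGE hab] with x hx using hconst x hx
  have h2 := (uniqueDiffWithinAt_Ici a).eq_deriv _ h1 (hf' a ⟨le_rfl, hab⟩)
  exact (h0 a ⟨le_rfl, hab⟩).ne h2

/-- A continuous function with a continuous right derivative is differentiable. -/
theorem hasDerivAt_of_continuousOn_rightDeriv {f f' : ℝ → ℝ}
    (hf : ContinuousOn f (Ioi 0)) (hf' : ∀ x, 0 < x → HasDerivWithinAt f (f' x) (Ici x) x)
    (hc : ContinuousOn f' (Ioi 0)) {x : ℝ} (hx : 0 < x) : HasDerivAt f (f' x) x := by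
  have sub : ∀ y, 0 < y → uIcc x y ⊆ Ioi 0 := fun y hy z hz =>
    (lt_min hx hy).trans_le hz.1
  -- The function is the integral of its right derivative, and the integrand is continuous, so the
  -- primitive is differentiable from both sides.
  have key : ∀ y, 0 < y → f y = f x + ∫ s in x..y, f' s := by
    intro y hy
    rw [intervalIntegral.integral_eq_sub_of_hasDeriv_right (hf.mono (sub y hy))
      (fun z hz => (hf' z ((lt_min hx hy).trans hz.1)).mono Ioi_subset_Ici_self)
      (hc.mono (sub y hy)).intervalIntegrable]
    ring
  have h1 : HasDerivAt (fun y => f x + ∫ s in x..y, f' s) (f' x) x := by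
    refine (intervalIntegral.integral_hasDerivAt_right (by simp) ?_
      (hc.continuousAt (Ioi_mem_nhds hx))).const_add _
    exact hc.stronglyMeasurableAtFilter isOpen_Ioi x hx
  refine h1.congr_of_eventuallyEq ?_
  filter_upwards [Ioi_mem_nhds hx] with y hy using key y hy

/-! ### Weighted integrals of an increasing right-continuous function -/

/-- `h` is increasing and right-continuous on `]0, ∞[`. -/
structure IncRC (h : ℝ → ℝ) : Prop where
  mono : MonotoneOn h (Ioi 0)
  rc : ∀ x, 0 < x → ContinuousWithinAt h (Ici x) x

/-- `∫ₐˣ s^{-p-1} (h(s) - c) ds`. -/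
def wint (h : ℝ → ℝ) (p c a x : ℝ) : ℝ := ∫ s in a..x, s ^ (-p - 1) * (h s - c)

/-- `∫ₐˣ s^{-p-1} ds`. -/
def kp (p a x : ℝ) : ℝ := (x ^ (-p) - a ^ (-p)) / (-p)

theorem kp_eq {p a x : ℝ} (hp : p ≠ 0) (ha : 0 < a) (hx : 0 < x) :
    ∫ s in a..x, s ^ (-p - 1) = kp p a x := by
  rw [integral_rpow, kp]
  · ring_nf
  · right
    refine ⟨fun h => hp (by linarith), fun h => ?_⟩
    exact absurd h.1 (not_le.2 (lt_min ha hx))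

theorem kp_self (p a : ℝ) : kp p a a = 0 := by simp [kp]

theorem kp_pos {p a x : ℝ} (hp : p ≠ 0) (ha : 0 < a) (hax : a < x) : 0 < kp p a x := by
  rw [← kp_eq hp ha (ha.trans hax)]
  refine intervalIntegral.intervalIntegral_pos_of_pos_on ?_ (fun s hs => ?_) hax
  · refine ContinuousOn.intervalIntegrable fun s hs => ?_
    rw [uIcc_of_le hax.le] at hs
    exact (Real.continuousAt_rpow_const _ _
      (Or.inl (ha.trans_le hs.1).ne')).continuousWithinAt
  · exact Real.rpow_pos_of_pos (ha.trans hs.1) _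

theorem kp_nonneg {p a x : ℝ} (hp : p ≠ 0) (ha : 0 < a) (hax : a ≤ x) : 0 ≤ kp p a x := by
  rcases hax.eq_or_lt with rfl | h
  · simp [kp_self]
  · exact (kp_pos hp ha h).le

namespace IncRC

theorem intervalIntegrable {h : ℝ → ℝ} (H : IncRC h) (q c : ℝ) {a x : ℝ} (ha : 0 < a) (hx : 0 < x) :
    IntervalIntegrable (fun s => s ^ q * (h s - c)) volume a x := by
  have sub : uIcc a x ⊆ Ioi 0 := fun z hz => (lt_min ha hx).trans_le hz.1
  refine IntervalIntegrable.continuousOn_mul ?_ fun s hs => ?_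
  · exact ((H.mono.mono sub).intervalIntegrable).sub (by simp)
  · exact (Real.continuousAt_rpow_const _ _ (Or.inl (sub hs).ne')).continuousWithinAt

theorem wint_add {h : ℝ → ℝ} (H : IncRC h) (p c : ℝ) {a x y : ℝ} (ha : 0 < a) (hx : 0 < x)
    (hy : 0 < y) :
    wint h p c a y = wint h p c a x + wint h p c x y :=
  (intervalIntegral.integral_add_adjacent_intervals (H.intervalIntegrable _ c ha hx)
    (H.intervalIntegrable _ c hx hy)).symm

theorem wint_self (h : ℝ → ℝ) (p c a : ℝ) : wint h p c a a = 0 := by simp [wint]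

theorem wint_symm (h : ℝ → ℝ) (p c a x : ℝ) : wint h p c x a = - wint h p c a x :=
  intervalIntegral.integral_symm _ _

/-- Changing the level costs an explicit power term, so formulas at the levels 0, k and rK₁ can be
compared. -/
theorem wint_const {h : ℝ → ℝ} (H : IncRC h) {p : ℝ} (hp : p ≠ 0) (c c' : ℝ)
    {a x : ℝ} (ha : 0 < a) (hx : 0 < x) :
    wint h p c a x = wint h p c' a x + (c' - c) * kp p a x := by
  have i : IntervalIntegrable (fun s : ℝ => s ^ (-p - 1)) volume a x := by
    refine ContinuousOn.intervalIntegrable fun s hs => ?_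
    exact (Real.continuousAt_rpow_const _ _
      (Or.inl ((lt_min ha hx).trans_le hs.1).ne')).continuousWithinAt
  rw [← kp_eq hp ha hx, wint, wint, ← intervalIntegral.integral_const_mul,
    ← intervalIntegral.integral_add (H.intervalIntegrable _ _ ha hx) (i.const_mul _)]
  congr 1
  ext s
  ring

theorem wint_le {h : ℝ → ℝ} (H : IncRC h) {p : ℝ} (hp : p ≠ 0) (c e : ℝ)
    {a x : ℝ} (ha : 0 < a) (hax : a ≤ x)
    (hb : ∀ s ∈ Ioo a x, h s ≤ e) : wint h p c a x ≤ (e - c) * kp p a x := by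
  have hx := ha.trans_le hax
  have := H.wint_const hp c e ha hx
  have h2 : wint h p e a x ≤ 0 := by
    have : 0 ≤ ∫ s in a..x, -(s ^ (-p - 1) * (h s - e)) := by
      refine intervalIntegral.integral_nonneg_of_ae_restrict hax ?_
      rw [← restrict_Ioo_eq_restrict_Icc]
      refine (ae_restrict_mem measurableSet_Ioo).mono fun s hs => ?_
      have := mul_nonneg (Real.rpow_pos_of_pos (ha.trans hs.1) (-p - 1)).le
        (sub_nonneg.2 (hb s hs))
      simp only [Pi.zero_apply]
      linarith
    rw [intervalIntegral.integral_neg] at this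
    rw [wint]
    linarith
  linarith

theorem le_wint {h : ℝ → ℝ} (H : IncRC h) {p : ℝ} (hp : p ≠ 0) (c e : ℝ)
    {a x : ℝ} (ha : 0 < a) (hax : a ≤ x)
    (hb : ∀ s ∈ Ioo a x, e ≤ h s) : (e - c) * kp p a x ≤ wint h p c a x := by
  have hx := ha.trans_le hax
  have := H.wint_const hp c e ha hx
  have h2 : 0 ≤ wint h p e a x := by
    refine intervalIntegral.integral_nonneg_of_ae_restrict hax ?_
    rw [← restrict_Ioo_eq_restrict_Icc]
    refine (ae_restrict_mem measurableSet_Ioo).mono fun s hs => ?_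
    exact mul_nonneg (Real.rpow_pos_of_pos (ha.trans hs.1) (-p - 1)).le
      (sub_nonneg.2 (hb s hs))
  linarith

theorem wint_le_right {h : ℝ → ℝ} (H : IncRC h) {p : ℝ} (hp : p ≠ 0) (c : ℝ)
    {a x : ℝ} (ha : 0 < a) (hax : a ≤ x) :
    wint h p c a x ≤ (h x - c) * kp p a x :=
  H.wint_le hp c _ ha hax fun _ hs => H.mono (ha.trans hs.1) (ha.trans_le hax) hs.2.le

theorem left_le_wint {h : ℝ → ℝ} (H : IncRC h) {p : ℝ} (hp : p ≠ 0) (c : ℝ)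
    {a x : ℝ} (ha : 0 < a) (hax : a ≤ x) :
    (h a - c) * kp p a x ≤ wint h p c a x :=
  H.le_wint hp c _ ha hax fun _ hs => H.mono ha (ha.trans hs.1) hs.1.le

theorem wint_nonneg {h : ℝ → ℝ} (H : IncRC h) {p : ℝ} (hp : p ≠ 0) {c : ℝ}
    {a x : ℝ} (ha : 0 < a) (hax : a ≤ x)
    (hc : c ≤ h a) : 0 ≤ wint h p c a x :=
  (mul_nonneg (sub_nonneg.2 hc) (kp_nonneg hp ha hax)).trans (H.left_le_wint hp c ha hax)

/-- Since h may equal c on an initial stretch, strictness needs a point y where the level is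
exceeded. It may lie to the left of a; the integral is split at max a y. -/
theorem wint_pos {h : ℝ → ℝ} (H : IncRC h) {p : ℝ} (hp : p ≠ 0) {c : ℝ}
    {a x y : ℝ} (ha : 0 < a) (hax : a < x)
    (hc : c ≤ h a) (hy0 : 0 < y) (hyx : y < x) (hy : c < h y) : 0 < wint h p c a x := by
  have hz : max a y < x := max_lt hax hyx
  have hz0 : 0 < max a y := ha.trans_le (le_max_left _ _)
  rw [H.wint_add p c ha hz0 (ha.trans hax)]
  have h1 := H.wint_nonneg hp ha (le_max_left a y) hc
  have h2 := H.left_le_wint hp c hz0 hz.le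
  have h3 : h y ≤ h (max a y) := H.mono hy0 hz0 (le_max_right _ _)
  have h4 := mul_pos (sub_pos.2 (hy.trans_le h3)) (kp_pos hp hz0 hz)
  linarith

theorem stronglyMeasurableAtFilter {h : ℝ → ℝ} (H : IncRC h) (q c : ℝ) (l : Filter ℝ)
    (hl : Ioi 0 ∈ l) :
    StronglyMeasurableAtFilter (fun s => s ^ q * (h s - c)) l := by
  refine ⟨Ioi 0, hl, ?_⟩
  have h1 : AEMeasurable h (volume.restrict (Ioi 0)) :=
    aemeasurable_restrict_of_monotoneOn measurableSet_Ioi H.mono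
  have h2 : Measurable fun s : ℝ => s ^ q := by fun_prop
  exact (h2.aemeasurable.mul (h1.sub_const c)).aestronglyMeasurable

theorem hasDerivWithinAt_wint {h : ℝ → ℝ} (H : IncRC h) (p c : ℝ)
    {a x : ℝ} (ha : 0 < a) (hx : 0 < x) :
    HasDerivWithinAt (wint h p c a) (x ^ (-p - 1) * (h x - c)) (Ici x) x := by
  refine intervalIntegral.integral_hasDerivWithinAt_right (t := Ioi x)
    (H.intervalIntegrable _ c ha hx)
    (H.stronglyMeasurableAtFilter _ c _ ?_) ?_
  · exact mem_of_superset self_mem_nhdsWithin (Ioi_subset_Ioi hx.le)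
  · refine ContinuousWithinAt.mul
      (Real.continuousAt_rpow_const _ _ (Or.inl hx.ne')).continuousWithinAt ?_
    exact ((H.rc x hx).mono Ioi_subset_Ici_self).sub continuousWithinAt_const

theorem hasDerivAt_wint {h : ℝ → ℝ} (H : IncRC h) (p c : ℝ) {a x : ℝ} (ha : 0 < a) (hx : 0 < x)
    (hcx : ContinuousAt h x) :
    HasDerivAt (wint h p c a) (x ^ (-p - 1) * (h x - c)) x := by
  refine intervalIntegral.integral_hasDerivAt_right
    (H.intervalIntegrable _ c ha hx)
    (H.stronglyMeasurableAtFilter _ c _ (Ioi_mem_nhds hx)) ?_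
  exact (Real.continuousAt_rpow_const _ _ (Or.inl hx.ne')).mul (hcx.sub continuousAt_const)

theorem continuousOn_wint {h : ℝ → ℝ} (H : IncRC h) (p c : ℝ) {a : ℝ} (ha : 0 < a) :
    ContinuousOn (wint h p c a) (Ioi 0) := by
  intro x hx
  have hx : 0 < x := hx
  have hl : 0 < min a (x / 2) := lt_min ha (by linarith)
  have h1 : ContinuousOn (fun y => ∫ s in a..y, s ^ (-p - 1) * (h s - c))
      (uIcc (min a (x / 2)) (max a (x + 1))) := by
    refine intervalIntegral.continuousOn_primitive_interval' ?_ ?_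
    · exact H.intervalIntegrable _ c hl (ha.trans_le (le_max_left _ _))
    · exact mem_uIcc_of_le (min_le_left _ _) (le_max_left _ _)
  refine (h1.continuousAt ?_).continuousWithinAt
  rw [uIcc_of_le ((min_le_left _ _).trans (le_max_left _ _))]
  exact Icc_mem_nhds ((min_le_right _ _).trans_lt (by linarith))
    (lt_of_lt_of_le (by linarith) (le_max_right _ _))

end IncRC

/-! ### The particular solutions of the inhomogeneous Euler equation -/

/-- `xᵐ ∫ₐˣ s^{-m-1} (h - c) ds - xⁿ ∫ₐˣ s^{-n-1} (h - c) ds`: up to the factor `1 / (σ² (n - m))`,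
the solution of `σ² x² w'' + b x w' - r w + (h - c) = 0` with `w(a) = w'(a) = 0`. -/
def solY (h : ℝ → ℝ) (m n c a x : ℝ) : ℝ :=
  x ^ m * wint h m c a x - x ^ n * wint h n c a x

/-- The function `x ↦ x * (solY h m n c a)' x`. -/
def solZ (h : ℝ → ℝ) (m n c a x : ℝ) : ℝ :=
  m * x ^ m * wint h m c a x - n * x ^ n * wint h n c a x

theorem solY_self (h : ℝ → ℝ) (m n c a : ℝ) : solY h m n c a a = 0 := by
  simp [solY, IncRC.wint_self]

theorem solZ_self (h : ℝ → ℝ) (m n c a : ℝ) : solZ h m n c a a = 0 := by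
  simp [solZ, IncRC.wint_self]

theorem continuousOn_rpow_Ioi (p : ℝ) : ContinuousOn (fun x : ℝ => x ^ p) (Ioi 0) := fun _ hx =>
  (Real.continuousAt_rpow_const _ _ (Or.inl (ne_of_gt hx))).continuousWithinAt

theorem rpow_mul_rpow_neg_sub_one (p : ℝ) {x : ℝ} (hx : 0 < x) :
    x ^ p * x ^ (-p - 1) = x⁻¹ := by
  rw [← Real.rpow_add hx, ← Real.rpow_neg_one]
  ring_nf

theorem rpow_sub_one_eq (p : ℝ) {x : ℝ} (hx : 0 < x) : x ^ (p - 1) = x ^ p * x⁻¹ := by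
  rw [Real.rpow_sub_one hx.ne', div_eq_mul_inv]

namespace IncRC

theorem continuousOn_solY {h : ℝ → ℝ} (H : IncRC h) (m n c : ℝ) {a : ℝ} (ha : 0 < a) :
    ContinuousOn (solY h m n c a) (Ioi 0) :=
  ((continuousOn_rpow_Ioi m).mul (H.continuousOn_wint m c ha)).sub
    ((continuousOn_rpow_Ioi n).mul (H.continuousOn_wint n c ha))

theorem continuousOn_solZ {h : ℝ → ℝ} (H : IncRC h) (m n c : ℝ) {a : ℝ} (ha : 0 < a) :
    ContinuousOn (solZ h m n c a) (Ioi 0) :=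
  ((continuousOn_const.mul (continuousOn_rpow_Ioi m)).mul (H.continuousOn_wint m c ha)).sub
    ((continuousOn_const.mul (continuousOn_rpow_Ioi n)).mul (H.continuousOn_wint n c ha))

theorem continuousOn_solZ_div {h : ℝ → ℝ} (H : IncRC h) (m n c : ℝ) {a : ℝ} (ha : 0 < a) :
    ContinuousOn (fun x => solZ h m n c a x / x) (Ioi 0) :=
  (H.continuousOn_solZ m n c ha).div continuousOn_id fun _ hx => ne_of_gt hx

/-- A jump of h does no harm here: x^m x^{-m-1} = x^n x^{-n-1} = 1/x, so the two terms containing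
h(x) cancel and the right derivative is continuous. -/
theorem hasDerivAt_solY {h : ℝ → ℝ} (H : IncRC h) (m n c : ℝ) {a x : ℝ} (ha : 0 < a)
    (hx : 0 < x) : HasDerivAt (solY h m n c a) (solZ h m n c a x / x) x := by
  refine hasDerivAt_of_continuousOn_rightDeriv (f' := fun x => solZ h m n c a x / x)
    (H.continuousOn_solY m n c ha) (fun x hx => ?_) (H.continuousOn_solZ_div m n c ha) hx
  have hp : ∀ p : ℝ, HasDerivWithinAt (fun x : ℝ => x ^ p) (p * x ^ (p - 1)) (Ici x) x := fun p =>
    (Real.hasDerivAt_rpow_const (Or.inl hx.ne')).hasDerivWithinAt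
  have := ((hp m).mul (H.hasDerivWithinAt_wint m c ha hx)).sub
    ((hp n).mul (H.hasDerivWithinAt_wint n c ha hx))
  refine this.congr_deriv ?_
  rw [← mul_assoc, ← mul_assoc, rpow_mul_rpow_neg_sub_one m hx, rpow_mul_rpow_neg_sub_one n hx,
    rpow_sub_one_eq m hx, rpow_sub_one_eq n hx, solZ]
  field_simp
  ring

/-- One order higher the cancellation is incomplete and leaves (m - n)(h x - c), hence the
continuity of h at x. -/
theorem hasDerivAt_solZ_div {h : ℝ → ℝ} (H : IncRC h) (m n c : ℝ) {a x : ℝ} (ha : 0 < a)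
    (hx : 0 < x) (hcx : ContinuousAt h x) :
    HasDerivAt (fun x => solZ h m n c a x / x)
      ((m ^ 2 * x ^ m * wint h m c a x - n ^ 2 * x ^ n * wint h n c a x + (m - n) * (h x - c) -
        solZ h m n c a x) / x ^ 2) x := by
  have hp : ∀ p : ℝ, HasDerivAt (fun x : ℝ => p * x ^ p) (p * (p * x ^ (p - 1))) x := fun p =>
    (Real.hasDerivAt_rpow_const (Or.inl hx.ne')).const_mul p
  have := (((hp m).mul (H.hasDerivAt_wint m c ha hx hcx)).sub
    ((hp n).mul (H.hasDerivAt_wint n c ha hx hcx))).div (hasDerivAt_id x) hx.ne'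
  refine this.congr_deriv ?_
  have e1 : m * x ^ m * (x ^ (-m - 1) * (h x - c)) = m * x⁻¹ * (h x - c) := by
    rw [← rpow_mul_rpow_neg_sub_one m hx]; ring
  have e2 : n * x ^ n * (x ^ (-n - 1) * (h x - c)) = n * x⁻¹ * (h x - c) := by
    rw [← rpow_mul_rpow_neg_sub_one n hx]; ring
  simp only [Pi.sub_apply, Pi.mul_apply, id]
  rw [e1, e2, rpow_sub_one_eq m hx, rpow_sub_one_eq n hx, solZ]
  field_simp
  ring

theorem solZ_pos_of_lt {h : ℝ → ℝ} (H : IncRC h) {m n c a x : ℝ} (hm : m < 0) (hn : 0 < n)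
    (ha : 0 < a) (hax : a < x) (hc : h x < c) : 0 < solZ h m n c a x := by
  have hx := ha.trans hax
  have key : ∀ p : ℝ, p ≠ 0 → wint h p c a x < 0 := fun p hp =>
    (H.wint_le_right hp c ha hax.le).trans_lt
      (mul_neg_of_neg_of_pos (sub_neg.2 hc) (kp_pos hp ha hax))
  have h1 := mul_pos_of_neg_of_neg
    (mul_neg_of_neg_of_pos hm (Real.rpow_pos_of_pos hx m)) (key m hm.ne)
  have h2 := mul_neg_of_pos_of_neg (mul_pos hn (Real.rpow_pos_of_pos hx n)) (key n hn.ne')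
  rw [solZ]
  linarith

theorem solZ_pos_of_gt {h : ℝ → ℝ} (H : IncRC h) {m n c a x y : ℝ} (hm : m < 0) (hn : 0 < n)
    (hx : 0 < x) (hxa : x < a) (hc : c ≤ h x) (hy0 : 0 < y) (hya : y < a) (hy : c < h y) :
    0 < solZ h m n c a x := by
  have key : ∀ p : ℝ, p ≠ 0 → wint h p c a x < 0 := fun p hp => by
    rw [wint_symm]
    exact neg_neg_of_pos (H.wint_pos hp hx hxa hc hy0 hya hy)
  have h1 := mul_pos_of_neg_of_neg
    (mul_neg_of_neg_of_pos hm (Real.rpow_pos_of_pos hx m)) (key m hm.ne)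
  have h2 := mul_neg_of_pos_of_neg (mul_pos hn (Real.rpow_pos_of_pos hx n)) (key n hn.ne')
  rw [solZ]
  linarith

/-- Left of `a`, the function `solZ h m n c a` changes sign at most once, from `-` to `+`. -/
theorem solZ_pos_of_nonneg {h : ℝ → ℝ} (H : IncRC h) {m n c a x₀ x y : ℝ} (hm : m < 0)
    (hn : 0 < n) (hx₀ : 0 < x₀) (hx₀x : x₀ < x) (hxa : x < a) (hy0 : 0 < y) (hya : y < a)
    (hy : c < h y) (h0 : 0 ≤ solZ h m n c a x₀) : 0 < solZ h m n c a x := by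
  have hx := hx₀.trans hx₀x
  have ha := hx.trans hxa
  -- If h has reached c at x, both weighted integrals over [x, a] are positive and the sign is
  -- immediate. Otherwise h < c on all of [x₀, x], and there t^{-m} `solZ` is strictly increasing.
  rcases le_or_gt c (h x) with hc | hc
  · exact H.solZ_pos_of_gt hm hn hx hxa hc hy0 hya hy
  let f : ℝ → ℝ := fun t => m * wint h m c a t - n * (t ^ (n - m) * wint h n c a t)
  have hf : ∀ t, 0 < t → f t = t ^ (-m) * solZ h m n c a t := by
    intro t ht
    have e1 : t ^ (-m) * t ^ m = 1 := by rw [← Real.rpow_add ht]; simp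
    have e2 : t ^ (n - m) = t ^ (-m) * t ^ n := by rw [← Real.rpow_add ht]; ring_nf
    simp only [f, solZ]
    rw [e2]
    linear_combination (-m * wint h m c a t) * e1
  have hlt : f x₀ < f x := by
    refine lt_of_rightDeriv_pos
      (f' := fun t => -(n - m) * t ^ (-m - 1) * ((h t - c) + n * t ^ n * wint h n c a t))
      hx₀x ?_ (fun t ht => ?_) (fun t ht => ?_)
    · refine ContinuousOn.mono (s := Ioi 0) ?_ fun z hz => hx₀.trans_le hz.1
      exact (continuousOn_const.mul (H.continuousOn_wint m c ha)).sub
        (continuousOn_const.mul ((continuousOn_rpow_Ioi _).mul (H.continuousOn_wint n c ha)))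
    · have ht0 : 0 < t := hx₀.trans_le ht.1
      have hp : HasDerivWithinAt (fun x : ℝ => x ^ (n - m)) ((n - m) * t ^ (n - m - 1)) (Ici t) t :=
        (Real.hasDerivAt_rpow_const (Or.inl ht0.ne')).hasDerivWithinAt
      refine (((H.hasDerivWithinAt_wint m c ha ht0).const_mul m).sub
        ((hp.mul (H.hasDerivWithinAt_wint n c ha ht0)).const_mul n)).congr_deriv ?_
      have e2 : t ^ (n - m) * (t ^ (-n - 1) * (h t - c)) = t ^ (-m - 1) * (h t - c) := by
        rw [← mul_assoc, ← Real.rpow_add ht0]; ring_nf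
      have e3 : t ^ (n - m - 1) = t ^ (-m - 1) * t ^ n := by
        rw [← Real.rpow_add ht0]; ring_nf
      rw [e2, e3]
      ring
    · have ht0 : 0 < t := hx₀.trans_le ht.1
      have hta : t < a := ht.2.trans hxa
      have htc : h t < c := (H.mono ht0 hx ht.2.le).trans_lt hc
      have h1 := H.left_le_wint hn.ne' c ht0 hta.le
      rw [wint_symm h n c a t] at h1
      have e1 : n * t ^ n * kp n t a = 1 - t ^ n * a ^ (-n) := by
        have : t ^ n * t ^ (-n) = 1 := by rw [← Real.rpow_add ht0]; simp
        rw [kp]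
        field_simp
        linear_combination this
      have h2 := mul_le_mul_of_nonneg_left h1 (mul_pos hn (Real.rpow_pos_of_pos ht0 n)).le
      have h3 : 0 < t ^ n * a ^ (-n) :=
        mul_pos (Real.rpow_pos_of_pos ht0 _) (Real.rpow_pos_of_pos ha _)
      -- On [t, a] the payoff is at least h t; replacing it by this constant turns the bracket into
      -- a positive multiple of h t - c.
      have h4 : (h t - c) + n * t ^ n * wint h n c a t ≤ (h t - c) * (t ^ n * a ^ (-n)) := by
        have : n * t ^ n * ((h t - c) * kp n t a) = (h t - c) * (1 - t ^ n * a ^ (-n)) := by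
          rw [← e1]; ring
        linarith
      have h5 := mul_neg_of_neg_of_pos (sub_neg.2 htc) h3
      refine mul_pos_of_neg_of_neg ?_ (h4.trans_lt h5)
      have := mul_pos (show 0 < n - m by linarith) (Real.rpow_pos_of_pos ht0 (-m - 1))
      linarith
  rw [hf _ hx₀, hf _ hx] at hlt
  have h6 := mul_nonneg (Real.rpow_pos_of_pos hx₀ (-m)).le h0
  exact pos_of_mul_pos_right (h6.trans_lt hlt) (Real.rpow_pos_of_pos hx (-m)).le

end IncRC

/-! ### Gluing -/

theorem hasDerivAt_ite_le {f g f' g' : ℝ → ℝ} {a : ℝ}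
    (hf : ∀ x, 0 < x → HasDerivAt f (f' x) x) (hg : ∀ x, 0 < x → HasDerivAt g (g' x) x)
    (h0 : f a = g a) (h1 : f' a = g' a) {x : ℝ} (hx : 0 < x) :
    HasDerivAt (fun x => if x ≤ a then f x else g x) (if x ≤ a then f' x else g' x) x := by
  rcases lt_trichotomy x a with h | rfl | h
  · rw [if_pos h.le]
    refine (hf x hx).congr_of_eventuallyEq ?_
    filter_upwards [Iio_mem_nhds h] with y hy using if_pos (le_of_lt hy)
  · rw [if_pos le_rfl, ← hasDerivWithinAt_univ, ← Iic_union_Ici (a := x)]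
    refine HasDerivWithinAt.union ?_ ?_
    · refine (hf x hx).hasDerivWithinAt.congr (fun y hy => if_pos hy) (if_pos le_rfl)
    · rw [h1]
      refine (hg x hx).hasDerivWithinAt.congr (fun y hy => ?_) ((if_pos le_rfl).trans h0)
      rcases (show x ≤ y from hy).eq_or_lt with rfl | hxy
      · exact (if_pos le_rfl).trans h0
      · exact if_neg (not_le.2 hxy)
  · rw [if_neg (not_le.2 h)]
    refine (hg x hx).congr_of_eventuallyEq ?_
    filter_upwards [Ioi_mem_nhds h] with y hy using if_neg (not_le.2 hy)

theorem continuousOn_ite_le {f g : ℝ → ℝ} {a : ℝ}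
    (hf : ContinuousOn f (Ioi 0)) (hg : ContinuousOn g (Ioi 0)) (h0 : f a = g a) :
    ContinuousOn (fun x => if x ≤ a then f x else g x) (Ioi 0) := by
  refine ContinuousOn.if (fun x hx => ?_) (hf.mono inter_subset_left) (hg.mono inter_subset_left)
  have : x = a := by
    have := hx.2
    change x ∈ frontier (Iic a) at this
    rwa [frontier_Iic] at this
  rw [this, h0]

theorem contDiffOn_one_of_hasDerivAt {f f' : ℝ → ℝ} (hf : ∀ x, 0 < x → HasDerivAt f (f' x) x)
    (hc : ContinuousOn f' (Ioi 0)) : ContDiffOn ℝ 1 f (Ioi 0) := by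
  rw [show (1 : WithTop ℕ∞) = 0 + 1 from (zero_add 1).symm,
    contDiffOn_succ_iff_deriv_of_isOpen isOpen_Ioi]
  refine ⟨fun x hx => (hf x hx).differentiableAt.differentiableWithinAt, by simp, ?_⟩
  rw [contDiffOn_zero]
  exact hc.congr fun x hx => (hf x hx).deriv

/-! ### The system of equations for the free-boundary points -/

theorem rpow_mul_rpow_neg (p : ℝ) {x : ℝ} (hx : 0 < x) : x ^ p * x ^ (-p) = 1 := by
  rw [← Real.rpow_add hx]; simp

theorem rpow_neg_lt_rpow_neg {p x y : ℝ} (hp : 0 < p) (hx : 0 < x) (hxy : x < y) :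
    y ^ (-p) < x ^ (-p) := Real.rpow_lt_rpow_of_neg hx hxy (by linarith)

theorem rpow_neg_lt_rpow_neg_iff {p x y : ℝ} (hp : 0 < p) (hx : 0 < x) (hy : 0 < y) :
    y ^ (-p) < x ^ (-p) ↔ x < y :=
  Real.rpow_lt_rpow_iff_of_neg hy hx (by linarith)

/-- The data of the free-boundary problem: `k = -rK > 0` and `δ = δ_†`. -/
structure FBSetup (h : ℝ → ℝ) (m n k δ : ℝ) : Prop extends IncRC h where
  hm : m < 0
  hn : 0 < n
  hk : 0 < k
  hδ : 0 < δ
  top : Tendsto h atTop atTop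
  intI : ∀ x, 0 < x → IntegrableOn (fun s => s ^ (-n - 1) * h s) (Ioi x)
  eqδ : ∫ s in Ioi δ, s ^ (-n - 1) * (h s - k) = 0

/-- `n xⁿ ∫ₓ^∞ s^{-n-1} (h - k) ds`, when `∫_δ^∞ s^{-n-1} (h - k) ds = 0`. -/
def tailV (h : ℝ → ℝ) (n k δ x : ℝ) : ℝ := -n * (x ^ n * wint h n k δ x)

/-- The right-hand side of the equation `k ζ^{-m} = fbM h m k δ c α`. -/
def fbM (h : ℝ → ℝ) (m k δ c x : ℝ) : ℝ := -m * wint h m k δ x + (k - c) * x ^ (-m)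

/-- The right-hand side of the equation `k ζ^{-n} = fbE h n k δ c α`. -/
def fbE (h : ℝ → ℝ) (n k δ c x : ℝ) : ℝ := -n * wint h n k δ x + (k - c) * x ^ (-n)

/-- The function of `α` that remains after the elimination of `ζ`. -/
def fbF (h : ℝ → ℝ) (m n k δ c x : ℝ) : ℝ :=
  fbM h m k δ c x - k * (fbE h n k δ c x / k) ^ (m / n)

/-- `(ζ, α)` solves the free-boundary equations for the level `c = r K₁`. -/
structure FBSol (h : ℝ → ℝ) (m n k δ c ζ α : ℝ) : Prop where
  hζ : 0 < ζ
  hδα : δ < α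
  hζα : ζ < α
  eqM : fbM h m k δ c α = k * ζ ^ (-m)
  eqE : fbE h n k δ c α = k * ζ ^ (-n)

theorem integrableOn_Ioi_rpow_mul_sub {h : ℝ → ℝ} {n : ℝ} (hn : 0 < n) (c : ℝ) {x : ℝ}
    (hx : 0 < x) (hi : IntegrableOn (fun s => s ^ (-n - 1) * h s) (Ioi x)) :
    IntegrableOn (fun s => s ^ (-n - 1) * (h s - c)) (Ioi x) := by
  refine (hi.sub ((integrableOn_Ioi_rpow_of_lt (a := -n - 1) (by linarith) hx).mul_const
    c)).congr_fun (fun s _ => ?_) measurableSet_Ioi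
  simp only [Pi.sub_apply]
  ring

theorem integral_Ioi_rpow_neg_sub_one {n x : ℝ} (hn : 0 < n) (hx : 0 < x) :
    ∫ s in Ioi x, s ^ (-n - 1) = x ^ (-n) / n := by
  rw [integral_Ioi_rpow_of_lt (by linarith) hx]
  rw [show -n - 1 + 1 = -n by ring, neg_div_neg_eq]

/-- A lower bound for the tail integral of an increasing function. -/
theorem le_integral_Ioi_of_monotoneOn {h : ℝ → ℝ} (hmono : MonotoneOn h (Ioi 0)) {n : ℝ}
    (hn : 0 < n) (c : ℝ) {x : ℝ} (hx : 0 < x)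
    (hi : IntegrableOn (fun s => s ^ (-n - 1) * h s) (Ioi x)) :
    (h x - c) * (x ^ (-n) / n) ≤ ∫ s in Ioi x, s ^ (-n - 1) * (h s - c) := by
  rw [← integral_Ioi_rpow_neg_sub_one hn hx, ← integral_const_mul]
  refine setIntegral_mono_on
    ((integrableOn_Ioi_rpow_of_lt (a := -n - 1) (by linarith) hx).const_mul _)
    (integrableOn_Ioi_rpow_mul_sub hn c hx hi) measurableSet_Ioi fun s hs => ?_
  have h1 : h x ≤ h s := hmono hx (hx.trans hs) (le_of_lt hs)
  have h2 : 0 < s ^ (-n - 1) := Real.rpow_pos_of_pos (hx.trans hs) _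
  nlinarith

theorem integral_Ioi_eq_wint_add {h : ℝ → ℝ} {n : ℝ} (hn : 0 < n) (c : ℝ) {x y : ℝ}
    (hx : 0 < x) (hy : 0 < y)
    (hi : ∀ x, 0 < x → IntegrableOn (fun s => s ^ (-n - 1) * h s) (Ioi x)) :
    ∫ s in Ioi x, s ^ (-n - 1) * (h s - c) =
      wint h n c x y + ∫ s in Ioi y, s ^ (-n - 1) * (h s - c) := by
  have key : ∀ x y, 0 < x → x ≤ y → ∫ s in Ioi x, s ^ (-n - 1) * (h s - c) =
      wint h n c x y + ∫ s in Ioi y, s ^ (-n - 1) * (h s - c) := by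
    intro x y hx hxy
    have hd : Disjoint (Ioc x y) (Ioi y) := Set.disjoint_left.2 fun z hz hz' => not_lt.2 hz.2 hz'
    rw [wint, intervalIntegral.integral_of_le hxy, ← setIntegral_union hd measurableSet_Ioi]
    · rw [Ioc_union_Ioi_eq_Ioi hxy]
    · exact (integrableOn_Ioi_rpow_mul_sub hn c hx (hi x hx)).mono_set Ioc_subset_Ioi_self
    · exact integrableOn_Ioi_rpow_mul_sub hn c (hx.trans_le hxy) (hi y (hx.trans_le hxy))
  rcases le_total x y with hxy | hxy
  · exact key x y hx hxy
  · rw [key y x hy hxy, IncRC.wint_symm h n c x y]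
    ring

/-- The inequality is strict because h tends to ∞ and so exceeds h x from some y on; the tail is
split there. -/
theorem IncRC.lt_integral_Ioi {h : ℝ → ℝ} (H : IncRC h) {n : ℝ} (hn : 0 < n) (c : ℝ) {x : ℝ}
    (hx : 0 < x) (hi : ∀ x, 0 < x → IntegrableOn (fun s => s ^ (-n - 1) * h s) (Ioi x))
    (top : Tendsto h atTop atTop) :
    (h x - c) * (x ^ (-n) / n) < ∫ s in Ioi x, s ^ (-n - 1) * (h s - c) := by
  obtain ⟨y, hxy, hy⟩ := ((eventually_gt_atTop x).and (top.eventually_gt_atTop (h x))).exists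
  have hy0 := hx.trans hxy
  rw [integral_Ioi_eq_wint_add hn c hx hy0 hi]
  have h1 := le_integral_Ioi_of_monotoneOn H.mono hn c hy0 (hi y hy0)
  have h2 := H.left_le_wint hn.ne' c hx hxy.le
  have h3 : 0 < y ^ (-n) / n := div_pos (Real.rpow_pos_of_pos hy0 _) hn
  have h4 : kp n x y = x ^ (-n) / n - y ^ (-n) / n := by rw [kp]; field_simp; ring
  rw [h4] at h2
  nlinarith

namespace FBSetup

theorem tail_eq {h : ℝ → ℝ} {m n k δ : ℝ} (S : FBSetup h m n k δ) {x : ℝ} (hx : 0 < x) :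
    ∫ s in Ioi x, s ^ (-n - 1) * (h s - k) = -wint h n k δ x := by
  have := integral_Ioi_eq_wint_add S.hn k S.hδ hx S.intI
  rw [S.eqδ] at this
  linarith

/-- `tailV` is the average of h - k over ]x, ∞[ for the weight n xⁿ s^{-n-1} of total mass 1, and h
increases. -/
theorem sub_lt_tailV {h : ℝ → ℝ} {m n k δ : ℝ} (S : FBSetup h m n k δ) {x : ℝ} (hx : 0 < x) :
    h x - k < tailV h n k δ x := by
  have h1 := S.lt_integral_Ioi S.hn k hx S.intI S.top
  rw [S.tail_eq hx] at h1
  have h2 := mul_lt_mul_of_pos_left h1 (mul_pos S.hn (Real.rpow_pos_of_pos hx n))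
  have h3 : n * x ^ n * ((h x - k) * (x ^ (-n) / n)) = h x - k := by
    have := S.hn.ne'
    field_simp
    linear_combination (h x - k) * rpow_mul_rpow_neg n hx
  rw [h3] at h2
  rw [tailV]
  linarith

theorem tailV_self {h : ℝ → ℝ} {n k δ : ℝ} : tailV h n k δ δ = 0 := by
  simp [tailV, IncRC.wint_self]

theorem continuousOn_tailV {h : ℝ → ℝ} {m n k δ : ℝ} (S : FBSetup h m n k δ) :
    ContinuousOn (tailV h n k δ) (Ioi 0) :=
  continuousOn_const.mul ((continuousOn_rpow_Ioi n).mul (S.continuousOn_wint n k S.hδ))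

/-- The right derivative is n/t times the excess of the average over h t - k. -/
theorem tailV_lt {h : ℝ → ℝ} {m n k δ : ℝ} (S : FBSetup h m n k δ) {x y : ℝ} (hx : 0 < x)
    (hxy : x < y) : tailV h n k δ x < tailV h n k δ y := by
  refine lt_of_rightDeriv_pos (f' := fun t => n * t⁻¹ * (tailV h n k δ t - (h t - k))) hxy
    (S.continuousOn_tailV.mono fun z hz => hx.trans_le hz.1) (fun t ht => ?_) (fun t ht => ?_)
  · have ht0 : 0 < t := hx.trans_le ht.1
    have hp : HasDerivWithinAt (fun x : ℝ => x ^ n) (n * t ^ (n - 1)) (Ici t) t :=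
      (Real.hasDerivAt_rpow_const (Or.inl ht0.ne')).hasDerivWithinAt
    refine ((hp.mul (S.hasDerivWithinAt_wint n k S.hδ ht0)).const_mul (-n)).congr_deriv ?_
    rw [← mul_assoc (t ^ n), rpow_mul_rpow_neg_sub_one n ht0, rpow_sub_one_eq n ht0, tailV]
    ring
  · have ht0 : 0 < t := hx.trans_le ht.1
    exact mul_pos (mul_pos S.hn (inv_pos.2 ht0)) (sub_pos.2 (S.sub_lt_tailV ht0))

theorem tailV_pos {h : ℝ → ℝ} {m n k δ : ℝ} (S : FBSetup h m n k δ) {x : ℝ} (hx : δ < x) :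
    0 < tailV h n k δ x := by
  have := S.tailV_lt S.hδ hx
  rwa [tailV_self] at this

theorem lt_at_δ {h : ℝ → ℝ} {m n k δ : ℝ} (S : FBSetup h m n k δ) : h δ < k := by
  have := S.sub_lt_tailV S.hδ
  rw [tailV_self] at this
  linarith

/-- The derivative of the value function in the open mode is positive right of `δ`. -/
theorem solZ_pos {h : ℝ → ℝ} {m n k δ : ℝ} (S : FBSetup h m n k δ) {x : ℝ} (hx : δ < x) :
    0 < solZ h m n k δ x := by
  have hx0 := S.hδ.trans hx
  have hm := S.hm
  have h1 := S.wint_le_right hm.ne k S.hδ hx.le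
  have h2 : 0 < x ^ m := Real.rpow_pos_of_pos hx0 m
  have h3 : -m * x ^ m * kp m δ x = 1 - x ^ m * δ ^ (-m) := by
    have := hm.ne
    rw [kp]
    field_simp
    linear_combination rpow_mul_rpow_neg m hx0
  have h4 : 0 < x ^ m * δ ^ (-m) := mul_pos h2 (Real.rpow_pos_of_pos S.hδ _)
  have h5 := kp_pos hm.ne S.hδ hx
  have h6 := mul_le_mul_of_nonneg_left h1 (mul_pos (neg_pos.2 hm) h2).le
  have h7 := S.sub_lt_tailV hx0
  have h8 := S.tailV_pos hx
  have h9 : -m * x ^ m * ((h x - k) * kp m δ x) = (h x - k) * (1 - x ^ m * δ ^ (-m)) := by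
    rw [← h3]; ring
  have h10 : 0 < 1 - x ^ m * δ ^ (-m) := by
    rw [← h3]; exact mul_pos (mul_pos (neg_pos.2 hm) h2) h5
  -- The subtracted term is at most θ(h x - k), where θ = 1 - x^m δ^{-m} lies in ]0, 1[. As `tailV`
  -- exceeds both 0 and h x - k, either sign of h x - k gives a positive difference.
  have e : solZ h m n k δ x = tailV h n k δ x - -m * x ^ m * wint h m k δ x := by
    rw [solZ, tailV]; ring
  rw [e]
  rcases le_total (h x - k) 0 with hc | hc
  · nlinarith
  · nlinarith

/-- When `fbE` equals k ζ^{-n}, the left side is the constraint ζ < x; it becomes a threshold for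
the increasing function `tailV`. -/
theorem fbE_gt_iff {h : ℝ → ℝ} {n k δ c x : ℝ} (hx : 0 < x) :
    k * x ^ (-n) < fbE h n k δ c x ↔ c < tailV h n k δ x := by
  have e : fbE h n k δ c x - k * x ^ (-n) = x ^ (-n) * (tailV h n k δ x - c) := by
    rw [fbE, tailV]
    linear_combination (n * wint h n k δ x) * rpow_mul_rpow_neg n hx
  rw [← sub_pos, e, mul_pos_iff_of_pos_left (Real.rpow_pos_of_pos hx _), sub_pos]

theorem fbE_of_tailV_eq {h : ℝ → ℝ} {n k δ c x : ℝ} (hx : 0 < x) (hc : tailV h n k δ x = c) :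
    fbE h n k δ c x = k * x ^ (-n) := by
  rw [fbE, ← hc, tailV]
  linear_combination (n * wint h n k δ x) * rpow_mul_rpow_neg n hx

theorem fbE_pos {h : ℝ → ℝ} {m n k δ c x : ℝ} (S : FBSetup h m n k δ) (hx : 0 < x)
    (hc : c ≤ tailV h n k δ x) : 0 < fbE h n k δ c x := by
  have h0 : 0 < k * x ^ (-n) := mul_pos S.hk (Real.rpow_pos_of_pos hx _)
  rcases hc.lt_or_eq with hc | hc
  · exact h0.trans ((fbE_gt_iff hx).2 hc)
  · rwa [fbE_of_tailV_eq hx hc.symm]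

/-- Here the eliminated ζ equals x, and `fbF` reduces to -x^{-m} `solZ`. -/
theorem fbF_neg {h : ℝ → ℝ} {m n k δ c x : ℝ} (S : FBSetup h m n k δ) (hx : δ < x)
    (hc : tailV h n k δ x = c) : fbF h m n k δ c x < 0 := by
  have hx0 := S.hδ.trans hx
  have h1 := S.solZ_pos hx
  have e : (fbE h n k δ c x / k) ^ (m / n) = x ^ (-m) := by
    rw [fbE_of_tailV_eq hx0 hc, mul_div_cancel_left₀ _ S.hk.ne', ← Real.rpow_mul hx0.le]
    congr 1
    field_simp [S.hn.ne']
  have e2 : fbF h m n k δ c x = -(x ^ (-m) * solZ h m n k δ x) := by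
    rw [fbF, e, fbM, ← hc, solZ, tailV]
    linear_combination (m * wint h m k δ x) * rpow_mul_rpow_neg m hx0
  rw [e2]
  exact neg_neg_of_pos (mul_pos (Real.rpow_pos_of_pos hx0 _) h1)

theorem continuousOn_fbM {h : ℝ → ℝ} {m n k δ : ℝ} (S : FBSetup h m n k δ) (c : ℝ) :
    ContinuousOn (fbM h m k δ c) (Ioi 0) :=
  (continuousOn_const.mul (S.continuousOn_wint m k S.hδ)).add
    (continuousOn_const.mul (continuousOn_rpow_Ioi _))

theorem continuousOn_fbE {h : ℝ → ℝ} {m n k δ : ℝ} (S : FBSetup h m n k δ) (c : ℝ) :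
    ContinuousOn (fbE h n k δ c) (Ioi 0) :=
  (continuousOn_const.mul (S.continuousOn_wint n k S.hδ)).add
    (continuousOn_const.mul (continuousOn_rpow_Ioi _))

theorem tailV_le {h : ℝ → ℝ} {m n k δ : ℝ} (S : FBSetup h m n k δ) {x y : ℝ} (hx : 0 < x)
    (hxy : x ≤ y) : tailV h n k δ x ≤ tailV h n k δ y := by
  rcases hxy.eq_or_lt with rfl | h
  · exact le_rfl
  · exact (S.tailV_lt hx h).le

theorem continuousOn_fbF {h : ℝ → ℝ} {m n k δ c a b : ℝ} (S : FBSetup h m n k δ) (ha : 0 < a)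
    (hc : c ≤ tailV h n k δ a) : ContinuousOn (fbF h m n k δ c) (Icc a b) := by
  have sub : Icc a b ⊆ Ioi 0 := fun z hz => ha.trans_le hz.1
  refine ((S.continuousOn_fbM c).mono sub).sub (continuousOn_const.mul ?_)
  refine ContinuousOn.rpow_const (((S.continuousOn_fbE c).mono sub).div_const k) fun z hz => ?_
  exact Or.inl (div_pos (S.fbE_pos (sub hz) (hc.trans (S.tailV_le ha hz.1))) S.hk).ne'

theorem hasDerivWithinAt_fbF {h : ℝ → ℝ} {m n k δ c x : ℝ} (S : FBSetup h m n k δ) (hx : 0 < x)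
    (hc : c ≤ tailV h n k δ x) :
    HasDerivWithinAt (fbF h m n k δ c)
      (-m * (x ^ (-m - 1) - (fbE h n k δ c x / k) ^ (m / n - 1) * x ^ (-n - 1)) * (h x - c))
      (Ici x) x := by
  have hp : ∀ p : ℝ, HasDerivWithinAt (fun x : ℝ => x ^ (-p)) (-p * x ^ (-p - 1)) (Ici x) x :=
    fun p => (Real.hasDerivAt_rpow_const (Or.inl hx.ne')).hasDerivWithinAt
  have hq : ∀ p : ℝ, HasDerivWithinAt
      (fun x => -p * wint h p k δ x + (k - c) * x ^ (-p)) (-p * x ^ (-p - 1) * (h x - c))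
      (Ici x) x := fun p => by
    refine (((S.hasDerivWithinAt_wint p k S.hδ hx).const_mul (-p)).add
      ((hp p).const_mul (k - c))).congr_deriv ?_
    ring
  have hE := (((hq n).div_const k).rpow_const (p := m / n)
    (Or.inl (div_pos (S.fbE_pos hx hc) S.hk).ne')).const_mul k
  refine ((hq m).sub hE).congr_deriv ?_
  have := S.hk.ne'
  have := S.hn.ne'
  rw [fbE]
  field_simp
  ring

/-- The first power is (x^{-n})^{m/n-1} x^{-n-1}. The exponent m/n - 1 is negative and `fbE`/k is at
least x^{-n}. Hence the right derivative of `fbF` has the sign of h - c once `tailV` > c. -/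
theorem fbF_bracket_nonneg {h : ℝ → ℝ} {m n k δ c x : ℝ} (S : FBSetup h m n k δ) (hx : 0 < x)
    (hc : c ≤ tailV h n k δ x) :
    0 ≤ x ^ (-m - 1) - (fbE h n k δ c x / k) ^ (m / n - 1) * x ^ (-n - 1) ∧
    (c < tailV h n k δ x →
      0 < x ^ (-m - 1) - (fbE h n k δ c x / k) ^ (m / n - 1) * x ^ (-n - 1)) := by
  have hq : m / n - 1 < 0 := by
    have := div_neg_of_neg_of_pos S.hm S.hn
    linarith
  have e : x ^ (-m - 1) = (x ^ (-n)) ^ (m / n - 1) * x ^ (-n - 1) := by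
    rw [← Real.rpow_mul hx.le, ← Real.rpow_add hx]
    congr 1
    field_simp [S.hn.ne']
    ring
  have hxn : 0 < x ^ (-n) := Real.rpow_pos_of_pos hx _
  have hx1 : 0 < x ^ (-n - 1) := Real.rpow_pos_of_pos hx _
  have strict : c < tailV h n k δ x →
      0 < x ^ (-m - 1) - (fbE h n k δ c x / k) ^ (m / n - 1) * x ^ (-n - 1) := by
    intro hc
    rw [e, ← sub_mul]
    refine mul_pos (sub_pos.2 (Real.rpow_lt_rpow_of_neg hxn ?_ hq)) hx1
    rw [lt_div_iff₀ S.hk, mul_comm]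
    exact (fbE_gt_iff hx).2 hc
  refine ⟨?_, strict⟩
  rcases hc.lt_or_eq with hc | hc
  · exact (strict hc).le
  · rw [e, fbE_of_tailV_eq hx hc.symm, mul_div_cancel_left₀ _ S.hk.ne', sub_self]

theorem exists_tailV_eq {h : ℝ → ℝ} {m n k δ c : ℝ} (S : FBSetup h m n k δ) (hc : 0 < c) :
    ∃ x, δ < x ∧ tailV h n k δ x = c := by
  obtain ⟨y, hy, hy2⟩ :=
    ((eventually_gt_atTop δ).and (S.top.eventually_gt_atTop (k + c))).exists
  have h1 := S.sub_lt_tailV (S.hδ.trans hy)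
  obtain ⟨x, hx, hx2⟩ := intermediate_value_Ioo hy.le
    (S.continuousOn_tailV.mono fun z hz => S.hδ.trans_le hz.1)
    (show c ∈ Ioo _ _ from ⟨by rwa [tailV_self], by linarith⟩)
  exact ⟨x, hx.1, hx2⟩

/-- Where `fbF` is nonnegative, the level `c` of `h` has been passed. -/
theorem exists_lt_of_fbF_nonneg {h : ℝ → ℝ} {m n k δ c x : ℝ} (S : FBSetup h m n k δ)
    (hc0 : 0 < c) (hx : 0 < x) (hc : c ≤ tailV h n k δ x) (hF : 0 ≤ fbF h m n k δ c x) :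
    ∃ y, δ < y ∧ y < x ∧ c < h y := by
  obtain ⟨x₀, hx₀, e⟩ := S.exists_tailV_eq hc0
  have hx₀0 := S.hδ.trans hx₀
  have hle : x₀ ≤ x := by
    by_contra! hlt
    have := S.tailV_lt hx hlt
    linarith
  -- If h ≤ c on ]δ, x[, then `fbF` cannot rise from its negative value at x₀.
  by_contra! hcon
  have h1 := S.fbF_neg hx₀ e
  have h2 : -fbF h m n k δ c x₀ ≤ -fbF h m n k δ c x := by
    refine le_of_rightDeriv_nonneg (f := fun x => -fbF h m n k δ c x) hle
      (S.continuousOn_fbF hx₀0 e.ge).neg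
      (fun t ht => (S.hasDerivWithinAt_fbF (hx₀0.trans_le ht.1)
        (e.ge.trans (S.tailV_le hx₀0 ht.1))).neg) (fun t ht => ?_)
    have ht0 := hx₀0.trans_le ht.1
    have h3 := (S.fbF_bracket_nonneg ht0 (e.ge.trans (S.tailV_le hx₀0 ht.1))).1
    have h4 := hcon t (hx₀.trans_le ht.1) ht.2
    have h5 := mul_nonneg (mul_nonneg (neg_pos.2 S.hm).le h3) (sub_nonneg.2 h4)
    linarith
  linarith

/-- A nonnegative value shows that h has already passed c, so `fbF` increases from there on. In
particular a zero is crossed only once. -/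
theorem fbF_lt {h : ℝ → ℝ} {m n k δ c x y : ℝ} (S : FBSetup h m n k δ)
    (hc0 : 0 < c) (hx : 0 < x) (hc : c < tailV h n k δ x) (hF : 0 ≤ fbF h m n k δ c x)
    (hxy : x < y) : fbF h m n k δ c x < fbF h m n k δ c y := by
  obtain ⟨z, hz, hzx, hzc⟩ := S.exists_lt_of_fbF_nonneg hc0 hx hc.le hF
  refine lt_of_rightDeriv_pos hxy (S.continuousOn_fbF hx hc.le)
    (fun t ht => S.hasDerivWithinAt_fbF (hx.trans_le ht.1)
      (hc.le.trans (S.tailV_le hx ht.1))) (fun t ht => ?_)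
  have ht0 := hx.trans_le ht.1
  have ht1 := hc.trans_le (S.tailV_le hx ht.1)
  refine mul_pos (mul_pos (neg_pos.2 S.hm) ((S.fbF_bracket_nonneg ht0 ht1.le).2 ht1)) (sub_pos.2 ?_)
  exact hzc.trans_le (S.mono (S.hδ.trans hz) ht0 (hzx.le.trans ht.1))

theorem exists_fbF_nonneg {h : ℝ → ℝ} {m n k δ c a : ℝ} (S : FBSetup h m n k δ)
    (hδa : δ < a) (hc : tailV h n k δ a = c) :
    ∃ x, a < x ∧ 0 ≤ fbF h m n k δ c x := by
  have hm : 0 < -m := neg_pos.2 S.hm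
  have ha := S.hδ.trans hδa
  -- Beyond X one has h - k ≥ c + 1, so the integral in `fbM` contributes (c + 1) x^{-m} up to a
  -- constant. With (k - c) x^{-m} added and at most k x^{-m} subtracted, one x^{-m} remains, and x
  -- is chosen so that it absorbs the constant.
  obtain ⟨X, hX, hXh⟩ :=
    ((eventually_gt_atTop a).and (S.top.eventually_ge_atTop (k + c + 1))).exists
  have hX0 := ha.trans hX
  obtain ⟨x, hx, hx2⟩ := ((eventually_gt_atTop X).and
    ((tendsto_rpow_atTop hm).eventually_ge_atTop
      ((c + 1) * X ^ (-m) - -m * wint h m k δ X))).exists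
  have hx0 := hX0.trans hx
  have hax := hX.trans hx
  refine ⟨x, hax, ?_⟩
  have h1 : (fbE h n k δ c x / k) ^ (m / n) ≤ x ^ (-m) := by
    have e : x ^ (-m) = (x ^ (-n)) ^ (m / n) := by
      rw [← Real.rpow_mul hx0.le]
      congr 1
      field_simp [S.hn.ne']
    rw [e]
    refine Real.rpow_le_rpow_of_nonpos (Real.rpow_pos_of_pos hx0 _) ?_
      (div_neg_of_neg_of_pos S.hm S.hn).le
    rw [le_div_iff₀ S.hk, mul_comm]
    exact ((fbE_gt_iff hx0).2 (hc ▸ S.tailV_lt ha hax)).le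
  have h2 := S.left_le_wint S.hm.ne k hX0 hx.le
  have h3 := S.wint_add m k S.hδ hX0 hx0
  have h4 : -m * kp m X x = x ^ (-m) - X ^ (-m) := by
    rw [kp]; field_simp [S.hm.ne]
  have h5 := kp_pos S.hm.ne hX0 hx
  have h6 : (c + 1) * kp m X x ≤ wint h m k X x :=
    (mul_le_mul_of_nonneg_right (by linarith) h5.le).trans h2
  have h7 := mul_le_mul_of_nonneg_left h6 hm.le
  have h8 : -m * ((c + 1) * kp m X x) = (c + 1) * (x ^ (-m) - X ^ (-m)) := by rw [← h4]; ring
  have h9 := mul_le_mul_of_nonneg_left h1 S.hk.le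
  rw [fbF, fbM, h3]
  nlinarith

theorem _root_.FBSol.lt_tailV {h : ℝ → ℝ} {m n k δ c ζ α : ℝ} (S : FBSetup h m n k δ)
    (T : FBSol h m n k δ c ζ α) : c < tailV h n k δ α := by
  rw [← fbE_gt_iff (T.hζ.trans T.hζα), T.eqE]
  exact mul_lt_mul_of_pos_left (rpow_neg_lt_rpow_neg S.hn T.hζ T.hζα) S.hk

theorem _root_.FBSol.fbF_eq {h : ℝ → ℝ} {m n k δ c ζ α : ℝ} (S : FBSetup h m n k δ)
    (T : FBSol h m n k δ c ζ α) : fbF h m n k δ c α = 0 := by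
  rw [fbF, T.eqE, T.eqM, mul_div_cancel_left₀ _ S.hk.ne', ← Real.rpow_mul T.hζ.le, sub_eq_zero]
  congr 2
  field_simp [S.hn.ne']

theorem exists_sol {h : ℝ → ℝ} {m n k δ c : ℝ} (S : FBSetup h m n k δ) (hc : 0 < c) :
    ∃ ζ α, FBSol h m n k δ c ζ α := by
  obtain ⟨a, ha, e⟩ := S.exists_tailV_eq hc
  have ha0 := S.hδ.trans ha
  obtain ⟨x, hx, hF⟩ := S.exists_fbF_nonneg ha e
  obtain ⟨α, hα, hF0⟩ := intermediate_value_Ioc hx.le (S.continuousOn_fbF ha0 e.ge)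
    (show (0 : ℝ) ∈ Ioc _ _ from ⟨S.fbF_neg ha e, hF⟩)
  have hα0 := ha0.trans hα.1
  have hv : c < tailV h n k δ α := e ▸ S.tailV_lt ha0 hα.1
  have hE : 0 < fbE h n k δ c α / k := div_pos (S.fbE_pos hα0 hv.le) S.hk
  have e1 : ((fbE h n k δ c α / k) ^ (-1 / n)) ^ (-n) = fbE h n k δ c α / k := by
    rw [← Real.rpow_mul hE.le, show -1 / n * -n = 1 by field_simp [S.hn.ne'], Real.rpow_one]
  have e2 : ((fbE h n k δ c α / k) ^ (-1 / n)) ^ (-m) = (fbE h n k δ c α / k) ^ (m / n) := by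
    rw [← Real.rpow_mul hE.le]
    congr 1
    ring
  -- ζ is recovered from k ζ^{-n} = `fbE`; the zero of `fbF` is then the other equation.
  refine ⟨(fbE h n k δ c α / k) ^ (-1 / n), α, Real.rpow_pos_of_pos hE _, ha.trans hα.1, ?_, ?_, ?_⟩
  · rw [← rpow_neg_lt_rpow_neg_iff S.hn (Real.rpow_pos_of_pos hE _) hα0, e1, lt_div_iff₀ S.hk,
      mul_comm]
    exact (fbE_gt_iff hα0).2 hv
  · rw [e2]
    rw [fbF] at hF0
    linarith
  · rw [e1, mul_div_cancel₀ _ S.hk.ne']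

theorem _root_.FBSol.exists_lt {h : ℝ → ℝ} {m n k δ c ζ α : ℝ} (S : FBSetup h m n k δ)
    (hc : 0 < c) (T : FBSol h m n k δ c ζ α) : ∃ y, δ < y ∧ y < α ∧ c < h y :=
  S.exists_lt_of_fbF_nonneg hc (T.hζ.trans T.hζα) (T.lt_tailV S).le (T.fbF_eq S).ge

/-- The change of `fbE` from x to y is -n times the weighted integral of h - c over [x, y]. -/
theorem fbE_lt {h : ℝ → ℝ} {m n k δ c x y : ℝ} (S : FBSetup h m n k δ) (hx : 0 < x) (hxy : x < y)
    (hc : c < h x) : fbE h n k δ c y < fbE h n k δ c x := by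
  have h1 := S.wint_add n k S.hδ hx (hx.trans hxy)
  have h2 := S.wint_const S.hn.ne' k c hx (hx.trans hxy)
  have h3 := S.wint_pos S.hn.ne' hx hxy hc.le hx hxy hc
  have h4 : n * kp n x y = x ^ (-n) - y ^ (-n) := by
    rw [kp]; field_simp [S.hn.ne']; ring
  rw [fbE, fbE, h1, h2]
  have := mul_pos S.hn h3
  linear_combination this + (k - c) * h4

/-- At α₂, lowering the level raises both `fbM` and `fbE`, so `fbF` for c₁ is positive there and α₁
lies to the left. Between α₁ and α₂ the payoff exceeds c₁, so `fbE` decreases, which gives k ζ₂^{-n}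
< `fbE` at α₂ < `fbE` at α₁ = k ζ₁^{-n}. -/
theorem sol_mono {h : ℝ → ℝ} {m n k δ c₁ ζ₁ α₁ c₂ ζ₂ α₂ : ℝ} (S : FBSetup h m n k δ)
    (hc₁ : 0 < c₁) (hc : c₁ < c₂) (T₁ : FBSol h m n k δ c₁ ζ₁ α₁)
    (T₂ : FBSol h m n k δ c₂ ζ₂ α₂) : ζ₁ < ζ₂ ∧ α₁ < α₂ := by
  have hα₁ := S.hδ.trans T₁.hδα
  have hα₂ := S.hδ.trans T₂.hδα
  have hE : k * ζ₂ ^ (-n) < fbE h n k δ c₁ α₂ := by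
    rw [← T₂.eqE, fbE, fbE]
    have := Real.rpow_pos_of_pos hα₂ (-n)
    nlinarith
  have hM : k * ζ₂ ^ (-m) < fbM h m k δ c₁ α₂ := by
    rw [← T₂.eqM, fbM, fbM]
    have := Real.rpow_pos_of_pos hα₂ (-m)
    nlinarith
  have hF : 0 < fbF h m n k δ c₁ α₂ := by
    have h1 : (fbE h n k δ c₁ α₂ / k) ^ (m / n) < ζ₂ ^ (-m) := by
      have e : ζ₂ ^ (-m) = (ζ₂ ^ (-n)) ^ (m / n) := by
        rw [← Real.rpow_mul T₂.hζ.le]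
        congr 1
        field_simp [S.hn.ne']
      rw [e]
      refine Real.rpow_lt_rpow_of_neg (Real.rpow_pos_of_pos T₂.hζ _) ?_
        (div_neg_of_neg_of_pos S.hm S.hn)
      rwa [lt_div_iff₀ S.hk, mul_comm]
    have := mul_lt_mul_of_pos_left h1 S.hk
    rw [fbF]
    linarith
  have hv := hc.trans (T₂.lt_tailV S)
  have hα : α₁ < α₂ := by
    by_contra! hle
    rcases hle.eq_or_lt with h1 | h1
    · rw [h1, T₁.fbF_eq S] at hF
      exact lt_irrefl _ hF
    · have := S.fbF_lt hc₁ hα₂ hv hF.le h1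
      rw [T₁.fbF_eq S] at this
      linarith
  refine ⟨?_, hα⟩
  obtain ⟨y, hy, hyα, hyc⟩ := T₁.exists_lt S hc₁
  have h1 : c₁ < h α₁ := hyc.trans_le (S.mono (S.hδ.trans hy) hα₁ hyα.le)
  have h2 := hE.trans (S.fbE_lt hα₁ hα h1)
  rw [T₁.eqE] at h2
  exact (rpow_neg_lt_rpow_neg_iff S.hn T₁.hζ T₂.hζ).1 (lt_of_mul_lt_mul_left h2 S.hk.le)

theorem sol_unique {h : ℝ → ℝ} {m n k δ c ζ₁ α₁ ζ₂ α₂ : ℝ} (S : FBSetup h m n k δ)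
    (hc : 0 < c) (T₁ : FBSol h m n k δ c ζ₁ α₁) (T₂ : FBSol h m n k δ c ζ₂ α₂) :
    ζ₁ = ζ₂ ∧ α₁ = α₂ := by
  have hα : α₁ = α₂ := by
    rcases lt_trichotomy α₁ α₂ with h1 | h1 | h1
    · have := S.fbF_lt hc (S.hδ.trans T₁.hδα) (T₁.lt_tailV S) (T₁.fbF_eq S).ge h1
      rw [T₁.fbF_eq S, T₂.fbF_eq S] at this
      exact absurd this (lt_irrefl _)
    · exact h1
    · have := S.fbF_lt hc (S.hδ.trans T₂.hδα) (T₂.lt_tailV S) (T₂.fbF_eq S).ge h1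
      rw [T₁.fbF_eq S, T₂.fbF_eq S] at this
      exact absurd this (lt_irrefl _)
  subst hα
  refine ⟨?_, rfl⟩
  have h1 : ζ₁ ^ (-n) = ζ₂ ^ (-n) :=
    mul_left_cancel₀ S.hk.ne' (T₁.eqE.symm.trans T₂.eqE)
  rcases lt_trichotomy ζ₁ ζ₂ with h2 | h2 | h2
  · exact absurd h1 (rpow_neg_lt_rpow_neg S.hn T₁.hζ h2).ne'
  · exact h2
  · exact absurd h1 (rpow_neg_lt_rpow_neg S.hn T₂.hζ h2).ne

end FBSetup

/-! ### The critical level, continuity in the level, and the difference of the two modes -/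

theorem incRC_zero : IncRC (fun _ => 0) :=
  ⟨fun _ _ _ _ _ => le_rfl, fun _ _ => continuousWithinAt_const⟩

theorem wint_zero {p : ℝ} (hp : p ≠ 0) (k : ℝ) {a x : ℝ} (ha : 0 < a) (hx : 0 < x) :
    wint (fun _ => 0) p k a x = -k * kp p a x := by
  rw [incRC_zero.wint_const hp k 0 ha hx]
  simp [wint]

/-- If `h` is negative at first and its integral with the weight `s^{-n-1}` is nonnegative, then its
integral with the weight `s^{-m-1}`, which favours large `s`, is positive. -/
theorem IncRC.wint_pos_of_wint_nonneg {h : ℝ → ℝ} (H : IncRC h) {m n δ a : ℝ} (hmn : m < n)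
    (hδ : 0 < δ) (hδa : δ < a) (hneg : h δ < 0) (hn : 0 ≤ wint h n 0 δ a) :
    0 < wint h m 0 δ a := by
  -- x₀ = sup B is where h stops being negative on [δ, a]. Right-continuity puts it strictly beyond
  -- δ.
  set B : Set ℝ := {x | x ∈ Icc δ a ∧ h x < 0} with hB
  have hBδ : δ ∈ B := ⟨left_mem_Icc.2 hδa.le, hneg⟩
  have hBb : BddAbove B := ⟨a, fun x hx => hx.1.2⟩
  set x₀ := sSup B with hx₀
  have hx₀a : x₀ ≤ a := csSup_le ⟨δ, hBδ⟩ fun x hx => hx.1.2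
  have hδx₀ : δ < x₀ := by
    have h1 : ∀ᶠ x in 𝓝[>] δ, h x < 0 :=
      ((H.rc δ hδ).mono Ioi_subset_Ici_self).eventually_lt_const hneg
    obtain ⟨x, hx, hx2⟩ := (h1.and (Ioc_mem_nhdsGT hδa)).exists
    exact hx2.1.trans_le (le_csSup hBb ⟨⟨hx2.1.le, hx2.2⟩, hx⟩)
  have hx₀0 := hδ.trans hδx₀
  have hlow : ∀ s, 0 < s → s < x₀ → h s < 0 := by
    intro s hs hsx
    obtain ⟨t, ht, hst⟩ := exists_lt_of_lt_csSup ⟨δ, hBδ⟩ hsx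
    exact (H.mono hs (hs.trans hst) hst.le).trans_lt ht.2
  have hhigh : ∀ s, x₀ < s → s ≤ a → 0 ≤ h s := by
    intro s hs hsa
    by_contra! hcon
    exact not_lt.2 (le_csSup hBb ⟨⟨hδx₀.le.trans hs.le, hsa⟩, hcon⟩) hs
  have e : ∀ s : ℝ, 0 < s → s ^ (-m - 1) = s ^ (n - m) * s ^ (-n - 1) := fun s hs => by
    rw [← Real.rpow_add hs]; ring_nf
  have hnm : 0 < n - m := by linarith
  have i : ∀ q a x : ℝ, 0 < a → 0 < x →
      IntervalIntegrable (fun s => s ^ q * (h s - 0)) volume a x :=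
    fun q a x ha hx => H.intervalIntegrable q 0 ha hx
  -- The integrand (s^{n-m} - x₀^{n-m}) s^{-n-1} h(s) is nonnegative on both sides of x₀, since both
  -- factors change sign there; it is strictly positive on the left.
  have h1 : 0 < wint h m 0 δ x₀ - x₀ ^ (n - m) * wint h n 0 δ x₀ := by
    rw [wint, wint, ← intervalIntegral.integral_const_mul, ← intervalIntegral.integral_sub
      (i _ _ _ hδ hx₀0) ((i _ _ _ hδ hx₀0).const_mul _)]
    refine intervalIntegral.intervalIntegral_pos_of_pos_on
      ((i _ _ _ hδ hx₀0).sub ((i _ _ _ hδ hx₀0).const_mul _)) (fun s hs => ?_) hδx₀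
    have hs0 := hδ.trans hs.1
    have h2 := Real.rpow_lt_rpow hs0.le hs.2 hnm
    have h3 := mul_pos_of_neg_of_neg (sub_neg.2 h2)
      (mul_neg_of_pos_of_neg (Real.rpow_pos_of_pos hs0 (-n - 1)) (hlow s hs0 hs.2))
    rw [e s hs0]
    linear_combination h3
  have h2 : 0 ≤ wint h m 0 x₀ a - x₀ ^ (n - m) * wint h n 0 x₀ a := by
    have ha0 := hδ.trans hδa
    rw [wint, wint, ← intervalIntegral.integral_const_mul, ← intervalIntegral.integral_sub
      (i _ _ _ hx₀0 ha0) ((i _ _ _ hx₀0 ha0).const_mul _)]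
    refine intervalIntegral.integral_nonneg_of_ae_restrict hx₀a ?_
    rw [← restrict_Ioo_eq_restrict_Icc]
    refine (ae_restrict_mem measurableSet_Ioo).mono fun s hs => ?_
    have hs0 := hx₀0.trans hs.1
    have h2 := Real.rpow_lt_rpow hx₀0.le hs.1 hnm
    have h3 := mul_nonneg (sub_pos.2 h2).le
      (mul_nonneg (Real.rpow_pos_of_pos hs0 (-n - 1)).le (hhigh s hs.1 hs.2.le))
    simp only [Pi.zero_apply]
    rw [e s hs0]
    linear_combination h3
  have h3 := H.wint_add m 0 hδ hx₀0 (hδ.trans hδa)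
  have h4 := H.wint_add n 0 hδ hx₀0 (hδ.trans hδa)
  have h5 := mul_nonneg (Real.rpow_pos_of_pos hx₀0 (n - m)).le hn
  rw [h4] at h5
  rw [h3]
  linarith

namespace FBSetup

/-- The level for which the two exit points coincide. -/
theorem exists_sol_eq {h : ℝ → ℝ} {m n k δ : ℝ} (S : FBSetup h m n k δ) (hneg : h δ < 0) :
    ∃ c α, 0 < c ∧ FBSol h m n k δ c δ α := by
  have hm := S.hm
  have hn := S.hn
  have hδ := S.hδ
  obtain ⟨x₁, hx₁, hx₁n⟩ : ∃ x, δ < x ∧ h x < 0 := by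
    have h1 : ∀ᶠ x in 𝓝[>] δ, h x < 0 :=
      ((S.rc δ hδ).mono Ioi_subset_Ici_self).eventually_lt_const hneg
    obtain ⟨x, hx, hx2⟩ := (h1.and self_mem_nhdsWithin).exists
    exact ⟨x, hx2, hx⟩
  have hpos := S.solZ_pos_of_lt hm hn hδ hx₁ hx₁n
  -- The integral at level k tends to 0 by (1), while passing to level 0 adds at least k `kp n δ x₁`
  -- > 0.
  obtain ⟨x₂, hx₂, hx₂n⟩ : ∃ x, x₁ < x ∧ 0 < wint h n 0 δ x := by
    have hlim : Tendsto (fun x => wint h n k δ x) atTop (𝓝 0) := by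
      have := intervalIntegral_tendsto_integral_Ioi δ
        (integrableOn_Ioi_rpow_mul_sub hn k hδ (S.intI δ hδ)) tendsto_id
      rwa [S.eqδ] at this
    have hkp : 0 < k * kp n δ x₁ := mul_pos S.hk (kp_pos hn.ne' hδ hx₁)
    obtain ⟨x, hx, hx2⟩ := ((hlim.eventually (lt_mem_nhds (neg_neg_of_pos hkp))).and
      (eventually_gt_atTop x₁)).exists
    refine ⟨x, hx2, ?_⟩
    have hx0 := hδ.trans (hx₁.trans hx2)
    have h1 := S.wint_const hn.ne' 0 k hδ hx0
    have h2 : kp n δ x₁ < kp n δ x := by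
      have := rpow_neg_lt_rpow_neg hn (hδ.trans hx₁) hx2
      rw [kp, kp, div_lt_div_right_of_neg (by linarith)]
      linarith
    have h3 := mul_lt_mul_of_pos_left h2 S.hk
    rw [h1]
    linarith
  have hx₂0 := hδ.trans (hx₁.trans hx₂)
  have hx₂m := S.wint_pos_of_wint_nonneg (hm.trans hn) hδ (hx₁.trans hx₂) hneg hx₂n.le
  have hneg2 : solZ h m n 0 δ x₂ < 0 := by
    have h1 := mul_neg_of_neg_of_pos (mul_neg_of_neg_of_pos hm (Real.rpow_pos_of_pos hx₂0 m)) hx₂m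
    have h2 := mul_pos (mul_pos hn (Real.rpow_pos_of_pos hx₂0 n)) hx₂n
    rw [solZ]
    linarith
  -- With ζ = δ the system reads c = -m α^m ∫ s^{-m-1} h = -n αⁿ ∫ s^{-n-1} h over [δ, α].
  -- Eliminating c leaves the vanishing of `solZ` at level 0.
  obtain ⟨α, hα, hα0⟩ := intermediate_value_Icc' hx₂.le
    ((S.continuousOn_solZ m n 0 hδ).mono fun z hz => (hδ.trans hx₁).trans_le hz.1)
    (show (0 : ℝ) ∈ Icc _ _ from ⟨hneg2.le, hpos.le⟩)
  have hδα : δ < α := hx₁.trans_le hα.1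
  have hα00 := hδ.trans hδα
  -- Positivity of c: otherwise both weighted integrals would be nonnegative, the one with weight
  -- s^{-m-1} positive, and `solZ` could not vanish.
  have hw : wint h n 0 δ α < 0 := by
    by_contra! hcon
    have h0 := S.wint_pos_of_wint_nonneg (hm.trans hn) hδ hδα hneg hcon
    have h1 := mul_neg_of_neg_of_pos (mul_neg_of_neg_of_pos hm (Real.rpow_pos_of_pos hα00 m)) h0
    have h2 := mul_nonneg (mul_pos hn (Real.rpow_pos_of_pos hα00 n)).le hcon
    rw [solZ] at hα0
    linarith
  refine ⟨-(n * α ^ n * wint h n 0 δ α), α, ?_, hδ, hδα, hδα, ?_, ?_⟩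
  · have := mul_neg_of_pos_of_neg (mul_pos hn (Real.rpow_pos_of_pos hα00 n)) hw
    linarith
  · rw [fbM, S.wint_const hm.ne k 0 hδ hα00]
    have e : m * kp m δ α = δ ^ (-m) - α ^ (-m) := by
      rw [kp]; field_simp [hm.ne]; ring
    rw [solZ] at hα0
    linear_combination (k * e) - α ^ (-m) * hα0 +
      (m * wint h m 0 δ α) * rpow_mul_rpow_neg m hα00
  · rw [fbE, S.wint_const hn.ne' k 0 hδ hα00]
    have e : n * kp n δ α = δ ^ (-n) - α ^ (-n) := by
      rw [kp]; field_simp [hn.ne']; ring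
    linear_combination (k * e) + (n * wint h n 0 δ α) * rpow_mul_rpow_neg n hα00

/-- At level 0, `fbE` equals k δ^{-n} - c α^{-n} minus a nonnegative integral, so k ζ^{-n} is
smaller than k δ^{-n}. -/
theorem lt_of_nonneg {h : ℝ → ℝ} {m n k δ c ζ α : ℝ} (S : FBSetup h m n k δ) (hc : 0 < c)
    (hpos : 0 ≤ h δ) (T : FBSol h m n k δ c ζ α) : δ < ζ := by
  by_contra! hle
  have hα := S.hδ.trans T.hδα
  have h1 : δ ^ (-n) ≤ ζ ^ (-n) := Real.rpow_le_rpow_of_nonpos T.hζ hle (by linarith [S.hn])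
  have h2 := T.eqE
  have e : n * kp n δ α = δ ^ (-n) - α ^ (-n) := by
    rw [kp]; field_simp [S.hn.ne']; ring
  rw [fbE, S.wint_const S.hn.ne' k 0 S.hδ hα] at h2
  have h3 := mul_nonneg S.hn.le (S.wint_nonneg S.hn.ne' S.hδ T.hδα.le hpos)
  have h4 := mul_pos hc (Real.rpow_pos_of_pos hα (-n))
  have h5 := mul_le_mul_of_nonneg_left h1 S.hk.le
  have h6 : k * (n * kp n δ α) = k * (δ ^ (-n) - α ^ (-n)) := by rw [e]
  linarith

/-- Continuity from the left of the solution in the level `c`. -/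
theorem tendsto_sol {h : ℝ → ℝ} {m n k δ c ζ α : ℝ} (S : FBSetup h m n k δ) (hc : 0 < c)
    (T : FBSol h m n k δ c ζ α) {z a : ℝ → ℝ}
    (hza : ∀ e ∈ Ioo 0 c, FBSol h m n k δ e (z e) (a e)) :
    Tendsto (fun e => z e ^ (-n)) (𝓝[<] c) (𝓝 (ζ ^ (-n))) := by
  have hα := S.hδ.trans T.hδα
  have hmem : ∀ᶠ e in 𝓝[<] c, e ∈ Ioo 0 c := Ioo_mem_nhdsLT hc
  have hlim : Tendsto a (𝓝[<] c) (𝓝 α) := by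
    refine tendsto_order.2 ⟨fun b hb => ?_, fun b hb => ?_⟩
    -- Lower bound: pick b' in ]max b x₀, α[. Being beyond x₀ makes `fbE` positive and `fbF`
    -- continuous in the level at c. Its negative value at b' persists for nearby levels and keeps
    -- their zeros to the right of b'.
    · obtain ⟨x₀, hx₀, e₀⟩ := S.exists_tailV_eq hc
      have hx₀α : x₀ < α := by
        by_contra! hle
        have h1 := S.tailV_le hα hle
        have h2 := T.lt_tailV S
        linarith
      have hb₁ : max b x₀ < α := max_lt hb hx₀α
      obtain ⟨b', hb', hb'α⟩ := exists_between hb₁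
      have hb'x₀ : x₀ < b' := (le_max_right _ _).trans_lt hb'
      have hb'0 : 0 < b' := (S.hδ.trans hx₀).trans hb'x₀
      have hv : c < tailV h n k δ b' := e₀ ▸ S.tailV_lt (S.hδ.trans hx₀) hb'x₀
      have hF : fbF h m n k δ c b' < 0 := by
        by_contra! hF
        have := S.fbF_lt hc hb'0 hv hF hb'α
        rw [T.fbF_eq S] at this
        linarith
      have hcont : ContinuousAt (fun e => fbF h m n k δ e b') c := by
        have hE : 0 < fbE h n k δ c b' / k := div_pos (S.fbE_pos hb'0 hv.le) S.hk
        unfold fbF fbM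
        refine ContinuousAt.sub (by fun_prop) (continuousAt_const.mul ?_)
        refine ContinuousAt.rpow_const ?_ (Or.inl hE.ne')
        unfold fbE
        fun_prop
      have hev : ∀ᶠ e in 𝓝[<] c, fbF h m n k δ e b' < 0 :=
        (hcont.eventually_lt_const hF).filter_mono nhdsWithin_le_nhds
      filter_upwards [hmem, hev] with e he hFe
      refine ((le_max_left _ _).trans_lt hb').trans ?_
      by_contra! hle
      have Te := hza e he
      rcases hle.eq_or_lt with h1 | h1
      · rw [← h1, Te.fbF_eq S] at hFe
        exact lt_irrefl _ hFe
      · have := S.fbF_lt he.1 (S.hδ.trans Te.hδα) (Te.lt_tailV S) (Te.fbF_eq S).ge h1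
        rw [Te.fbF_eq S] at this
        linarith
    -- The upper bound is monotonicity in the level.
    · filter_upwards [hmem] with e he
      exact (S.sol_mono he.1 he.2 (hza e he) T).2.trans hb
  have hw : Tendsto (fun e => (-n * wint h n k δ (a e) + (k - e) * a e ^ (-n)) / k) (𝓝[<] c)
      (𝓝 ((-n * wint h n k δ α + (k - c) * α ^ (-n)) / k)) := by
    have h1 : ContinuousAt (wint h n k δ) α :=
      (S.continuousOn_wint n k S.hδ).continuousAt (Ioi_mem_nhds hα)
    have h2 : ContinuousAt (fun x : ℝ => x ^ (-n)) α :=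
      Real.continuousAt_rpow_const _ _ (Or.inl hα.ne')
    have h3 : Tendsto (fun e : ℝ => e) (𝓝[<] c) (𝓝 c) := nhdsWithin_le_nhds
    exact (((h1.tendsto.comp hlim).const_mul (-n)).add
      ((h3.const_sub k).mul (h2.tendsto.comp hlim))).div_const k
  have e1 : ζ ^ (-n) = (-n * wint h n k δ α + (k - c) * α ^ (-n)) / k := by
    rw [eq_div_iff S.hk.ne', mul_comm, ← T.eqE, fbE]
  rw [e1]
  refine hw.congr' ?_
  filter_upwards [hmem] with e he
  rw [div_eq_iff S.hk.ne', mul_comm (z e ^ (-n)), ← (hza e he).eqE, fbE]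

/-- The free-boundary equations match the coefficients of x^m and xⁿ on the two sides, so the
difference of the modes can be rebased at α, where the slopes agree. -/
theorem _root_.FBSol.solZ_eq {h : ℝ → ℝ} {m n k δ c ζ α : ℝ} (S : FBSetup h m n k δ)
    (T : FBSol h m n k δ c ζ α) {x : ℝ} (hx : 0 < x) :
    solZ (fun _ => 0) m n k ζ x - solZ h m n k δ x = -solZ h m n c α x := by
  have hα := S.hδ.trans T.hδα
  have hm := S.hm.ne
  have hn := S.hn.ne'
  have e : ∀ p : ℝ, p ≠ 0 → ∀ a, p * kp p a x = a ^ (-p) - x ^ (-p) := fun p hp a => by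
    rw [kp]; field_simp; ring
  have h1 := T.eqM
  have h2 := T.eqE
  rw [fbM] at h1
  rw [fbE] at h2
  simp only [solZ]
  rw [wint_zero hm k T.hζ hx, wint_zero hn k T.hζ hx, S.wint_add m k S.hδ hα hx,
    S.wint_add n k S.hδ hα hx, S.wint_const hm k c hα hx, S.wint_const hn k c hα hx]
  linear_combination -k * x ^ m * e m hm ζ + k * x ^ n * e n hn ζ + x ^ m * h1 - x ^ n * h2
    - (c - k) * x ^ m * e m hm α + (c - k) * x ^ n * e n hn α
    + c * rpow_mul_rpow_neg m hx - c * rpow_mul_rpow_neg n hx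

/-- The constant is the switching cost: multiplied by C it becomes K₁. -/
theorem _root_.FBSol.solY_eq {h : ℝ → ℝ} {m n k δ c ζ α : ℝ} (S : FBSetup h m n k δ)
    (T : FBSol h m n k δ c ζ α) {x : ℝ} (hx : 0 < x) :
    solY (fun _ => 0) m n k ζ x - solY h m n k δ x = -solY h m n c α x - c * (1 / n - 1 / m) := by
  have hα := S.hδ.trans T.hδα
  have hm := S.hm.ne
  have hn := S.hn.ne'
  have e : ∀ p : ℝ, p ≠ 0 → ∀ a, kp p a x = (1 / p) * (a ^ (-p) - x ^ (-p)) := fun p hp a => by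
    rw [kp]; field_simp; ring
  have h1 := T.eqM
  have h2 := T.eqE
  rw [fbM] at h1
  rw [fbE] at h2
  have i1 : 1 / m * m = 1 := by field_simp
  have i2 : 1 / n * n = 1 := by field_simp
  simp only [solY]
  rw [wint_zero hm k T.hζ hx, wint_zero hn k T.hζ hx, S.wint_add m k S.hδ hα hx,
    S.wint_add n k S.hδ hα hx, S.wint_const hm k c hα hx, S.wint_const hn k c hα hx,
    e m hm, e n hn, e m hm, e n hn]
  linear_combination (1 / m) * x ^ m * h1 - (1 / n) * x ^ n * h2
    + (1 / m) * c * rpow_mul_rpow_neg m hx - (1 / n) * c * rpow_mul_rpow_neg n hx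
    + x ^ m * wint h m k δ α * i1 - x ^ n * wint h n k δ α * i2

end FBSetup

/-! ### Integrability of the running payoff against the resolvent kernel -/

/-- A Brownian motion is indistinguishable from a process with measurable coordinates and
continuous paths. -/
theorem exists_measurable_continuous_version {Ω : Type*} [MeasurableSpace Ω] {P : Measure Ω}
    {W : ℝ≥0 → Ω → ℝ} (hW : IsBrownianReal W P) :
    ∃ V : ℝ≥0 → Ω → ℝ, (∀ t, Measurable (V t)) ∧ (∀ ω, Continuous (V · ω)) ∧
      ∀ᵐ ω ∂P, ∀ t, V t ω = W t ω := by
  classical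
  let q := TopologicalSpace.denseSeq ℝ≥0
  have hq : DenseRange q := TopologicalSpace.denseRange_denseSeq ℝ≥0
  have hm : ∀ i, AEMeasurable (W (q i)) P := fun i => hW.toIsPreBrownianReal.aemeasurable _
  have hgood : ∀ᵐ ω ∂P, Continuous (W · ω) ∧ ∀ i, W (q i) ω = (hm i).mk _ ω :=
    hW.cont.and (ae_all_iff.2 fun i => (hm i).ae_eq_mk)
  -- Resetting the paths to 0 on a measurable null set keeps them continuous. Measurability holds at
  -- the times `q i` and passes to limits along this dense sequence.
  obtain ⟨N, hNsub, hNm, hN0⟩ := exists_measurable_superset_of_null hgood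
  have hN : ∀ ω, ω ∉ N → Continuous (W · ω) ∧ ∀ i, W (q i) ω = (hm i).mk _ ω := by
    intro ω hω
    by_contra hcon
    exact hω (hNsub hcon)
  have hcont : ∀ ω, Continuous fun t => if ω ∈ N then 0 else W t ω := by
    intro ω
    by_cases hω : ω ∈ N
    · simp only [hω, if_true]
      exact continuous_const
    · simp only [hω, if_false]
      exact (hN ω hω).1
  refine ⟨fun t ω => if ω ∈ N then 0 else W t ω, fun t => ?_, hcont, ?_⟩
  · have hqm : ∀ i, Measurable fun ω => if ω ∈ N then 0 else W (q i) ω := by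
      intro i
      have : (fun ω => if ω ∈ N then 0 else W (q i) ω) =
          fun ω => if ω ∈ N then 0 else (hm i).mk _ ω := by
        ext ω
        by_cases hω : ω ∈ N
        · simp [hω]
        · simp [hω, (hN ω hω).2 i]
      rw [this]
      exact Measurable.ite hNm measurable_const (hm i).measurable_mk
    obtain ⟨u, hu, hut⟩ := mem_closure_iff_seq_limit.1 (hq t)
    choose j hj using hu
    refine measurable_of_tendsto_metrizable (fun i => hqm (j i)) ?_
    rw [tendsto_pi_nhds]
    intro ω
    have := ((hcont ω).tendsto t).comp hut
    refine this.congr fun i => ?_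
    simp only [Function.comp_apply, ← hj i]
  · have : ∀ᵐ ω ∂P, ω ∉ N := measure_eq_zero_iff_ae_notMem.1 hN0
    filter_upwards [this] with ω hω t
    simp [hω]

/-- The transition density of Brownian motion with drift `μ` and variance `2 s` per unit of time,
discounted at the rate `r`. -/
def discountedKernel (r μ s t y : ℝ) : ℝ :=
  Real.exp (-r * t) *
    ((√(2 * Real.pi * (2 * s * t)))⁻¹ * Real.exp (-(y - μ * t) ^ 2 / (2 * (2 * s * t))))

theorem measurable_discountedKernel (r μ s : ℝ) :
    Measurable (Function.uncurry (discountedKernel r μ s)) := by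
  unfold discountedKernel Function.uncurry
  fun_prop

/-- For a root `κ` of the characteristic equation, the discounted density is `e^{-κ y}` times the
density of a process with the drift `μ + 2 s κ`. -/
theorem discountedKernel_eq {r μ s t κ : ℝ} (hs : 0 < s) (ht : 0 < t)
    (hκ : s * κ ^ 2 + μ * κ - r = 0) (y : ℝ) :
    discountedKernel r μ s t y = Real.exp (-κ * y) *
      ((√(2 * Real.pi * (2 * s * t)))⁻¹ *
        Real.exp (-(y - (μ + 2 * s * κ) * t) ^ 2 / (2 * (2 * s * t)))) := by
  have e : Real.exp (-r * t) * Real.exp (-(y - μ * t) ^ 2 / (2 * (2 * s * t))) =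
      Real.exp (-κ * y) * Real.exp (-(y - (μ + 2 * s * κ) * t) ^ 2 / (2 * (2 * s * t))) := by
    rw [← Real.exp_add, ← Real.exp_add]
    congr 1
    field_simp
    linear_combination 4 * s * t ^ 2 * hκ
  rw [discountedKernel]
  linear_combination (√(2 * Real.pi * (2 * s * t)))⁻¹ * e

/-- A lower bound for the resolvent kernel. -/
theorem exists_le_lintegral_discountedKernel {r μ s κ : ℝ} (hs : 0 < s)
    (hκ : s * κ ^ 2 + μ * κ - r = 0) (hl : μ + 2 * s * κ ≠ 0) :
    ∃ C : ℝ, 0 < C ∧ ∀ y : ℝ, 1 ≤ |y| → 0 < y / (μ + 2 * s * κ) →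
      ENNReal.ofReal (C * Real.exp (-κ * y)) ≤
        ∫⁻ t in Ioi (0 : ℝ), ENNReal.ofReal (discountedKernel r μ s t y) := by
  set l := μ + 2 * s * κ with hl_def
  have hl' : 0 < |l| := abs_pos.2 hl
  set B : ℝ := 2 * Real.pi * (2 * s * (1 / |l| + 1)) with hB
  have hB0 : 0 < B := by positivity
  set D : ℝ := Real.exp (-(|l| ^ 3 / (4 * s))) with hD
  have hD0 : 0 < D := Real.exp_pos _
  refine ⟨(√B)⁻¹ * D, by positivity, fun y hy hyl => ?_⟩
  have hy0 : 0 < |y| := by linarith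
  have hsq : 0 < √|y| := Real.sqrt_pos.2 hy0
  have hsqy : √|y| ≤ |y| := by
    rw [Real.sqrt_le_left hy0.le]
    nlinarith
  have eyl : y / l = |y| / |l| := by rw [← abs_div, abs_of_pos hyl]
  -- After the tilt the drift is l, and y is typically reached near time y/l. On a window of length
  -- √|y| the density is at least a constant over √|y|, so its integral has a bound free of |y|.
  have key : ∀ t ∈ Icc (y / l) (y / l + √|y|),
      (√|y|)⁻¹ * ((√B)⁻¹ * D * Real.exp (-κ * y)) ≤ discountedKernel r μ s t y := by
    intro t ht
    have ht0 : 0 < t := hyl.trans_le ht.1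
    rw [discountedKernel_eq hs ht0 hκ y, ← hl_def]
    have h1 : (√|y|)⁻¹ * (√B)⁻¹ ≤ (√(2 * Real.pi * (2 * s * t)))⁻¹ := by
      rw [← mul_inv, ← Real.sqrt_mul hy0.le]
      refine inv_anti₀ (Real.sqrt_pos.2 (by positivity)) (Real.sqrt_le_sqrt ?_)
      have h2 : t ≤ |y| * (1 / |l| + 1) := by
        have := ht.2
        rw [eyl] at this
        calc t ≤ |y| / |l| + √|y| := this
          _ ≤ |y| / |l| + |y| := by linarith
          _ = _ := by ring
      rw [hB]
      have h3 : 0 < 2 * Real.pi * (2 * s) := by positivity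
      nlinarith
    have h2 : D ≤ Real.exp (-(y - l * t) ^ 2 / (2 * (2 * s * t))) := by
      rw [hD, Real.exp_le_exp, neg_div, neg_le_neg_iff]
      have h3 : (y - l * t) ^ 2 ≤ |l| ^ 2 * |y| := by
        have e : y - l * t = -(l * (t - y / l)) := by field_simp; ring
        rw [e, neg_sq, mul_pow, sq_abs]
        have h4 : 0 ≤ t - y / l := by linarith [ht.1]
        have h5 : t - y / l ≤ √|y| := by linarith [ht.2]
        have h6 : (t - y / l) ^ 2 ≤ |y| := by
          calc (t - y / l) ^ 2 ≤ (√|y|) ^ 2 := by gcongr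
            _ = |y| := Real.sq_sqrt hy0.le
        exact mul_le_mul_of_nonneg_left h6 (sq_nonneg l)
      rw [div_le_div_iff₀ (by positivity) (by positivity)]
      have h7 : |y| ≤ |l| * t := by
        have := ht.1
        rw [eyl, div_le_iff₀ hl'] at this
        linarith
      have h8 : |l| ^ 2 * |y| ≤ |l| ^ 2 * (|l| * t) := by gcongr
      have h9 : (y - l * t) ^ 2 ≤ |l| ^ 3 * t := by linarith [h3.trans h8]
      nlinarith
    calc (√|y|)⁻¹ * ((√B)⁻¹ * D * Real.exp (-κ * y))
        = Real.exp (-κ * y) * (((√|y|)⁻¹ * (√B)⁻¹) * D) := by ring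
      _ ≤ _ := by gcongr
  calc ENNReal.ofReal ((√B)⁻¹ * D * Real.exp (-κ * y))
      = ∫⁻ _t in Icc (y / l) (y / l + √|y|),
          ENNReal.ofReal ((√|y|)⁻¹ * ((√B)⁻¹ * D * Real.exp (-κ * y))) := by
        rw [setLIntegral_const, Real.volume_Icc, add_sub_cancel_left,
          ← ENNReal.ofReal_mul (by positivity)]
        congr 1
        field_simp
    _ ≤ ∫⁻ t in Icc (y / l) (y / l + √|y|), ENNReal.ofReal (discountedKernel r μ s t y) :=
        setLIntegral_mono' measurableSet_Icc fun t ht => ENNReal.ofReal_le_ofReal (key t ht)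
    _ ≤ _ := lintegral_mono_set fun t ht => hyl.trans_le ht.1

/-! ### Characteristic roots and integrability at 0 and ∞ -/

namespace SwitchData

theorem σ_sq_pos {D : SwitchData} (hσ : D.σ ≠ 0) : 0 < D.σ ^ 2 := by positivity

theorem sq_lt_discr {D : SwitchData} (hr : 0 < D.r) (hσ : D.σ ≠ 0) :
    (D.b - D.σ ^ 2) ^ 2 < (D.b - D.σ ^ 2) ^ 2 + 4 * D.σ ^ 2 * D.r := by
  have := σ_sq_pos hσ
  have : 0 < 4 * D.σ ^ 2 * D.r := by positivity
  linarith

theorem m_add_n {D : SwitchData} (hσ : D.σ ≠ 0) : D.σ ^ 2 * (D.m + D.n) = D.σ ^ 2 - D.b := by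
  rw [m, n]
  field_simp
  ring

theorem m_mul_n {D : SwitchData} (hr : 0 < D.r) (hσ : D.σ ≠ 0) :
    D.σ ^ 2 * (D.m * D.n) = -D.r := by
  have h0 := sq_lt_discr hr hσ
  have h1 := Real.sq_sqrt ((sq_nonneg (D.b - D.σ ^ 2)).trans h0.le)
  rw [m, n]
  generalize √((D.b - D.σ ^ 2) ^ 2 + 4 * D.σ ^ 2 * D.r) = q at h1 ⊢
  field_simp
  linear_combination -h1

theorem m_neg {D : SwitchData} (hr : 0 < D.r) (hσ : D.σ ≠ 0) : D.m < 0 := by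
  have h0 := Real.lt_sqrt_of_sq_lt (x := D.σ ^ 2 - D.b)
    (y := (D.b - D.σ ^ 2) ^ 2 + 4 * D.σ ^ 2 * D.r)
    (by linarith [sq_lt_discr hr hσ, sub_sq_comm D.b (D.σ ^ 2)])
  rw [m]
  have := σ_sq_pos hσ
  exact div_neg_of_neg_of_pos (by linarith) (by linarith)

theorem n_pos {D : SwitchData} (hr : 0 < D.r) (hσ : D.σ ≠ 0) : 0 < D.n := by
  have h0 := Real.lt_sqrt_of_sq_lt (x := D.b - D.σ ^ 2)
    (y := (D.b - D.σ ^ 2) ^ 2 + 4 * D.σ ^ 2 * D.r) (sq_lt_discr hr hσ)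
  rw [n]
  have := σ_sq_pos hσ
  exact div_pos (by linarith) (by linarith)

theorem root_m {D : SwitchData} (hr : 0 < D.r) (hσ : D.σ ≠ 0) :
    D.σ ^ 2 * D.m ^ 2 + (D.b - D.σ ^ 2) * D.m - D.r = 0 := by
  linear_combination D.m * m_add_n hσ - m_mul_n hr hσ

theorem root_n {D : SwitchData} (hr : 0 < D.r) (hσ : D.σ ≠ 0) :
    D.σ ^ 2 * D.n ^ 2 + (D.b - D.σ ^ 2) * D.n - D.r = 0 := by
  linear_combination D.n * m_add_n hσ - m_mul_n hr hσ

theorem PayoffAssumption.incRC {D : SwitchData} {Ω : Type*} [MeasurableSpace Ω] {P : Measure Ω}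
    {W : ℝ≥0 → Ω → ℝ} (hh : D.PayoffAssumption P W) : IncRC D.h := ⟨hh.increasing, hh.rightCont⟩

theorem measurable_comp_exp {h : ℝ → ℝ} (H : MonotoneOn h (Ioi 0)) :
    Measurable fun y => h (Real.exp y) :=
  Monotone.measurable fun _ _ hxy =>
    H (Real.exp_pos _) (Real.exp_pos _) (Real.exp_le_exp.2 hxy)

/-- The integrability assumption in terms of the resolvent kernel. -/
theorem PayoffAssumption.lintegral_kernel_lt_top {D : SwitchData} {Ω : Type*} [MeasurableSpace Ω]
    {P : Measure Ω} [IsProbabilityMeasure P] {W : ℝ≥0 → Ω → ℝ} (hW : IsBrownianReal W P)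
    (hσ : D.σ ≠ 0) (hh : D.PayoffAssumption P W) :
    ∫⁻ y, ENNReal.ofReal |D.h (Real.exp y)| * ∫⁻ t in Ioi (0 : ℝ),
      ENNReal.ofReal (discountedKernel D.r (D.b - D.σ ^ 2) (D.σ ^ 2) t y) < ∞ := by
  obtain ⟨V, hVm, hVc, hVW⟩ := exists_measurable_continuous_version hW
  set g : ℝ → ℝ := fun y => |D.h (Real.exp y)| with hg
  have hgm : Measurable g := (measurable_comp_exp hh.increasing).norm
  have hVu : Measurable (Function.uncurry V) :=
    measurable_uncurry_of_continuous_of_measurable hVc hVm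
  set X : Ω → ℝ → ℝ := fun ω t =>
    √2 * D.σ * V t.toNNReal ω + (D.b - D.σ ^ 2) * (t.toNNReal : ℝ) with hX
  have hXm : Measurable (Function.uncurry X) := by
    have : Measurable fun p : Ω × ℝ => V p.2.toNNReal p.1 :=
      hVu.comp ((measurable_real_toNNReal.comp measurable_snd).prodMk measurable_fst)
    simp only [hX, Function.uncurry_def]
    exact (this.const_mul _).add
      ((measurable_coe_nnreal_real.comp (measurable_real_toNNReal.comp measurable_snd)).const_mul _)
  -- The single starting point 1 suffices: log X then starts at 0, and its law at time t has the
  -- density in `discountedKernel`.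
  have h1 := hh.integrability 1 one_pos
  have e1 : ∫⁻ ω, (∫⁻ t in Ioi (0 : ℝ), ENNReal.ofReal (Real.exp (-D.r * t) *
      |D.h (D.gbm W 1 t.toNNReal ω)|)) ∂P =
      ∫⁻ ω, (∫⁻ t in Ioi (0 : ℝ), ENNReal.ofReal (Real.exp (-D.r * t) * g (X ω t))) ∂P := by
    refine lintegral_congr_ae ?_
    filter_upwards [hVW] with ω hω
    refine lintegral_congr fun t => ?_
    simp only [hg, hX, gbm, hω, one_mul]
    rw [add_comm]
  have hF : Measurable (Function.uncurry fun (ω : Ω) (t : ℝ) =>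
      ENNReal.ofReal (Real.exp (-D.r * t) * g (X ω t))) := by
    have h2 : Measurable fun p : Ω × ℝ => g (Function.uncurry X p) := hgm.comp hXm
    simp only [Function.uncurry_def] at h2 ⊢
    exact ((Real.measurable_exp.comp (measurable_snd.const_mul _)).mul h2).ennreal_ofReal
  rw [e1, lintegral_lintegral_swap hF.aemeasurable] at h1
  have e2 : ∀ t ∈ Ioi (0 : ℝ),
      ∫⁻ ω, ENNReal.ofReal (Real.exp (-D.r * t) * g (X ω t)) ∂P =
      ∫⁻ y, ENNReal.ofReal (g y) *
        ENNReal.ofReal (discountedKernel D.r (D.b - D.σ ^ 2) (D.σ ^ 2) t y) := by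
    intro t ht
    have ht0 : 0 < t := ht
    have hlawV : HasLaw (V t.toNNReal) (gaussianReal 0 t.toNNReal) P :=
      (hW.toIsPreBrownianReal.hasLaw_eval t.toNNReal).congr (hVW.mono fun ω hω => hω _)
    have hlaw := gaussianReal_add_const (gaussianReal_const_mul hlawV (√2 * D.σ))
      ((D.b - D.σ ^ 2) * (t.toNNReal : ℝ))
    have hv : (NNReal.mk ((√2 * D.σ) ^ 2) (sq_nonneg _) * t.toNNReal : ℝ≥0) ≠ 0 := by
      refine mul_ne_zero ?_ (by simpa using ht0)
      rw [Ne, ← NNReal.coe_eq_zero, NNReal.coe_mk]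
      positivity
    have hGm : Measurable fun y => ENNReal.ofReal (Real.exp (-D.r * t) * g y) :=
      (hgm.const_mul _).ennreal_ofReal
    have e3 := hlaw.lintegral_comp (f := fun y => ENNReal.ofReal (Real.exp (-D.r * t) * g y))
      hGm.aemeasurable
    rw [gaussianReal_of_var_ne_zero _ hv, lintegral_withDensity_eq_lintegral_mul _
      (measurable_gaussianPDF _ _) hGm] at e3
    refine e3.trans (lintegral_congr fun y => ?_)
    simp only [Pi.mul_apply, gaussianPDF]
    rw [← ENNReal.ofReal_mul (gaussianPDFReal_nonneg _ _ _), ← ENNReal.ofReal_mul (abs_nonneg _)]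
    congr 1
    have e4 : ((NNReal.mk ((√2 * D.σ) ^ 2) (sq_nonneg _) * t.toNNReal : ℝ≥0) : ℝ) =
        2 * D.σ ^ 2 * t := by
      rw [NNReal.coe_mul, NNReal.coe_mk, Real.coe_toNNReal _ ht0.le, mul_pow,
        Real.sq_sqrt (by norm_num)]
    rw [gaussianPDFReal, e4, discountedKernel, mul_zero, zero_add, Real.coe_toNNReal _ ht0.le]
    ring
  rw [setLIntegral_congr_fun measurableSet_Ioi e2] at h1
  have hK : Measurable (Function.uncurry fun (t y : ℝ) => ENNReal.ofReal (g y) *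
      ENNReal.ofReal (discountedKernel D.r (D.b - D.σ ^ 2) (D.σ ^ 2) t y)) := by
    have := (measurable_discountedKernel D.r (D.b - D.σ ^ 2) (D.σ ^ 2)).ennreal_ofReal
    simp only [Function.uncurry_def] at this ⊢
    exact (hgm.comp measurable_snd).ennreal_ofReal.mul this
  rw [lintegral_lintegral_swap hK.aemeasurable] at h1
  refine lt_of_le_of_lt (lintegral_mono fun y => ?_) h1
  rw [lintegral_const_mul]
  have := (measurable_discountedKernel D.r (D.b - D.σ ^ 2) (D.σ ^ 2)).comp
    (measurable_id.prodMk (measurable_const (a := y)))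
  exact this.ennreal_ofReal

/-- Integrability of the payoff in the variable `y = log s`, away from `y = 0`. -/
theorem PayoffAssumption.integrableOn_exp {D : SwitchData} {Ω : Type*} [MeasurableSpace Ω]
    {P : Measure Ω} [IsProbabilityMeasure P] {W : ℝ≥0 → Ω → ℝ} (hW : IsBrownianReal W P)
    (hσ : D.σ ≠ 0) (hh : D.PayoffAssumption P W) {κ : ℝ}
    (hκ : D.σ ^ 2 * κ ^ 2 + (D.b - D.σ ^ 2) * κ - D.r = 0)
    (hl : D.b - D.σ ^ 2 + 2 * D.σ ^ 2 * κ ≠ 0) {S : Set ℝ} (hS : MeasurableSet S)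
    (hS' : ∀ y ∈ S, 1 ≤ |y| ∧ 0 < y / (D.b - D.σ ^ 2 + 2 * D.σ ^ 2 * κ)) :
    IntegrableOn (fun y => Real.exp (-κ * y) * D.h (Real.exp y)) S := by
  obtain ⟨C, hC, hle⟩ := exists_le_lintegral_discountedKernel (σ_sq_pos hσ) hκ hl
  have hm : Measurable fun y => Real.exp (-κ * y) * D.h (Real.exp y) :=
    (Real.measurable_exp.comp (measurable_id.const_mul _)).mul (measurable_comp_exp hh.increasing)
  refine ⟨hm.aestronglyMeasurable, ?_⟩
  rw [hasFiniteIntegral_iff_norm]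
  have h1 := hh.lintegral_kernel_lt_top hW hσ
  have h2 : ENNReal.ofReal C *
      ∫⁻ y in S, ENNReal.ofReal ‖Real.exp (-κ * y) * D.h (Real.exp y)‖ < ∞ := by
    rw [← lintegral_const_mul _ hm.norm.ennreal_ofReal]
    refine lt_of_le_of_lt ?_ h1
    refine le_trans ?_ (setLIntegral_le_lintegral S _)
    refine setLIntegral_mono' hS fun y hy => ?_
    have h3 := hle y (hS' y hy).1 (hS' y hy).2
    calc ENNReal.ofReal C * ENNReal.ofReal ‖Real.exp (-κ * y) * D.h (Real.exp y)‖
        = ENNReal.ofReal |D.h (Real.exp y)| * ENNReal.ofReal (C * Real.exp (-κ * y)) := by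
          rw [← ENNReal.ofReal_mul hC.le, ← ENNReal.ofReal_mul (abs_nonneg _), norm_mul,
            Real.norm_eq_abs, Real.norm_eq_abs, abs_of_pos (Real.exp_pos _)]
          congr 1
          ring
      _ ≤ _ := by gcongr
  by_contra hcon
  rw [not_lt, top_le_iff] at hcon
  rw [hcon, ENNReal.mul_top (by simpa using hC)] at h2
  exact lt_irrefl _ h2

theorem integrableOn_image_exp {h : ℝ → ℝ} {p : ℝ} {S : Set ℝ} (hS : MeasurableSet S)
    (hi : IntegrableOn (fun y => Real.exp (-p * y) * h (Real.exp y)) S) :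
    IntegrableOn (fun s => s ^ (-p - 1) * h s) (Real.exp '' S) := by
  rw [integrableOn_image_iff_integrableOn_abs_deriv_smul hS
    (fun x _ => (Real.hasDerivAt_exp x).hasDerivWithinAt) Real.exp_injective.injOn]
  refine hi.congr_fun (fun y _ => ?_) hS
  simp only [smul_eq_mul]
  rw [abs_of_pos (Real.exp_pos _), ← Real.exp_mul, ← mul_assoc, ← Real.exp_add]
  congr 2
  ring

/-- The root n tilts the drift upwards and m tilts it downwards, so the kernel bound applies for y →
∞ and y → -∞ respectively. -/
theorem drift_eq_n {D : SwitchData} (hσ : D.σ ≠ 0) :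
    D.b - D.σ ^ 2 + 2 * D.σ ^ 2 * D.n = D.σ ^ 2 * (D.n - D.m) := by
  linear_combination m_add_n hσ

theorem drift_eq_m {D : SwitchData} (hσ : D.σ ≠ 0) :
    D.b - D.σ ^ 2 + 2 * D.σ ^ 2 * D.m = -(D.σ ^ 2 * (D.n - D.m)) := by
  linear_combination m_add_n hσ

theorem PayoffAssumption.integrableOn_Ioi {D : SwitchData} {Ω : Type*} [MeasurableSpace Ω]
    {P : Measure Ω} [IsProbabilityMeasure P] {W : ℝ≥0 → Ω → ℝ} (hW : IsBrownianReal W P)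
    (hr : 0 < D.r) (hσ : D.σ ≠ 0) (hh : D.PayoffAssumption P W) {x : ℝ} (hx : 0 < x) :
    IntegrableOn (fun s => s ^ (-D.n - 1) * D.h s) (Ioi x) := by
  have hd : 0 < D.b - D.σ ^ 2 + 2 * D.σ ^ 2 * D.n := by
    rw [drift_eq_n hσ]
    exact mul_pos (σ_sq_pos hσ) (by linarith [m_neg hr hσ, n_pos hr hσ])
  have h1 := integrableOn_image_exp (p := D.n) measurableSet_Ioi
    (hh.integrableOn_exp hW hσ (root_n hr hσ) hd.ne' (S := Ioi 1) measurableSet_Ioi fun y hy => by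
      have hy' : 1 < y := hy
      exact ⟨by rw [abs_of_pos (by linarith)]; exact hy'.le, div_pos (by linarith) hd⟩)
  have h2 : Ioi (Real.exp 1) ⊆ Real.exp '' Ioi 1 := fun s hs => by
    have hs0 : 0 < s := (Real.exp_pos 1).trans hs
    exact ⟨Real.log s, (Real.lt_log_iff_exp_lt hs0).2 hs, Real.exp_log hs0⟩
  have h3 : IntegrableOn (fun s => s ^ (-D.n - 1) * D.h s) (Ioc x (max x (Real.exp 1))) := by
    have := (hh.incRC.intervalIntegrable (-D.n - 1) 0 hx
      (hx.trans_le (le_max_left x (Real.exp 1)))).1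
    simpa using this
  refine (h3.union (h1.mono_set h2)).mono_set fun s hs => ?_
  rcases le_or_gt s (Real.exp 1) with hs' | hs'
  · exact Or.inl ⟨hs, hs'.trans (le_max_right _ _)⟩
  · exact Or.inr hs'

theorem PayoffAssumption.integrableOn_Ioc {D : SwitchData} {Ω : Type*} [MeasurableSpace Ω]
    {P : Measure Ω} [IsProbabilityMeasure P] {W : ℝ≥0 → Ω → ℝ} (hW : IsBrownianReal W P)
    (hr : 0 < D.r) (hσ : D.σ ≠ 0) (hh : D.PayoffAssumption P W) {x : ℝ} (hx : 0 < x) :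
    IntegrableOn (fun s => s ^ (-D.m - 1) * D.h s) (Ioc 0 x) := by
  have hd : D.b - D.σ ^ 2 + 2 * D.σ ^ 2 * D.m < 0 := by
    rw [drift_eq_m hσ]
    exact neg_neg_of_pos (mul_pos (σ_sq_pos hσ) (by linarith [m_neg hr hσ, n_pos hr hσ]))
  have h1 := integrableOn_image_exp (p := D.m) measurableSet_Iio
    (hh.integrableOn_exp hW hσ (root_m hr hσ) hd.ne (S := Iio (-1)) measurableSet_Iio fun y hy => by
      have hy' : y < -1 := hy
      exact ⟨by rw [abs_of_neg (by linarith)]; linarith, div_pos_of_neg_of_neg (by linarith) hd⟩)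
  have h2 : Ioo 0 (Real.exp (-1)) ⊆ Real.exp '' Iio (-1) := fun s hs =>
    ⟨Real.log s, (Real.log_lt_iff_lt_exp hs.1).2 hs.2, Real.exp_log hs.1⟩
  -- The cut lies strictly below e^{-1}: the image of the half-line omits e^{-1}, and `Ioc` omits
  -- its left end.
  have hl : 0 < min x (Real.exp (-1) / 2) := lt_min hx (by positivity)
  have h3 : IntegrableOn (fun s => s ^ (-D.m - 1) * D.h s) (Ioc (min x (Real.exp (-1) / 2)) x) := by
    have := (hh.incRC.intervalIntegrable (-D.m - 1) 0 hl hx).1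
    simpa using this
  refine ((h1.mono_set h2).union h3).mono_set fun s hs => ?_
  rcases lt_or_ge s (Real.exp (-1)) with hs' | hs'
  · exact Or.inl ⟨hs.1, hs'⟩
  · refine Or.inr ⟨(min_le_right _ _).trans_lt ?_, hs.2⟩
    linarith [Real.exp_pos (-1)]

/-! ### Analytic form of the standing assumptions -/

/-- The standing assumptions, with the integrability condition in analytic form. -/
structure Admissible (D : SwitchData) : Prop where
  r_pos : 0 < D.r
  σ_ne : D.σ ≠ 0
  inc : IncRC D.h
  top : Tendsto D.h atTop atTop
  intI : ∀ x, 0 < x → IntegrableOn (fun s => s ^ (-D.n - 1) * D.h s) (Ioi x)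
  int0 : ∀ x, 0 < x → IntegrableOn (fun s => s ^ (-D.m - 1) * D.h s) (Ioc 0 x)

theorem PayoffAssumption.admissible {D : SwitchData} {Ω : Type*} [MeasurableSpace Ω]
    {P : Measure Ω} [IsProbabilityMeasure P] {W : ℝ≥0 → Ω → ℝ} (hW : IsBrownianReal W P)
    (hr : 0 < D.r) (hσ : D.σ ≠ 0) (hh : D.PayoffAssumption P W) : D.Admissible :=
  ⟨hr, hσ, hh.incRC, hh.tendsto_atTop, fun _ hx => hh.integrableOn_Ioi hW hr hσ hx,
    fun _ hx => hh.integrableOn_Ioc hW hr hσ hx⟩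

/-- The constant `k = -rK`. -/
def k (D : SwitchData) : ℝ := -(D.r * D.K)

/-- The constant `1 / (σ² (n - m))`. -/
def C (D : SwitchData) : ℝ := 1 / (D.σ ^ 2 * (D.n - D.m))

namespace Admissible

theorem m_neg {D : SwitchData} (H : D.Admissible) : D.m < 0 := SwitchData.m_neg H.r_pos H.σ_ne

theorem n_pos {D : SwitchData} (H : D.Admissible) : 0 < D.n := SwitchData.n_pos H.r_pos H.σ_ne

theorem C_pos {D : SwitchData} (H : D.Admissible) : 0 < D.C :=
  one_div_pos.2 (mul_pos (σ_sq_pos H.σ_ne) (by linarith [H.m_neg, H.n_pos]))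

/-- A constant payoff rt has the constant solution t; algebraically this is σ² m n = -r. -/
theorem C_mul {D : SwitchData} (H : D.Admissible) (t : ℝ) :
    D.C * (D.r * t * (1 / D.n - 1 / D.m)) = t := by
  have h1 := m_mul_n H.r_pos H.σ_ne
  have hm := H.m_neg.ne
  have hn := H.n_pos.ne'
  have hσ := H.σ_ne
  have hd : D.n - D.m ≠ 0 := by linarith [H.m_neg, H.n_pos]
  rw [C]
  field_simp
  linear_combination t * (D.m - D.n) * h1

/-- By monotonicity the limit at 0 is the infimum of h over ]0, 1[. -/
theorem h0_lt_iff {D : SwitchData} (H : D.Admissible) (a : ℝ) :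
    D.h0 < (a : EReal) ↔ ∃ x, 0 < x ∧ D.h x < a := by
  have hmono : MonotoneOn (fun x : ℝ => (D.h x : EReal)) (Ioo 0 1) := fun x hx y hy hxy =>
    EReal.coe_le_coe_iff.2 (H.inc.mono hx.1 hy.1 hxy)
  have hlim := hmono.tendsto_nhdsWithin_Ioo_right (nonempty_Ioo.2 one_pos) (OrderBot.bddBelow _)
  rw [h0, hlim.limUnder_eq, sInf_lt_iff]
  constructor
  · rintro ⟨_, ⟨x, hx, rfl⟩, hlt⟩
    exact ⟨x, hx.1, EReal.coe_lt_coe_iff.1 hlt⟩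
  · rintro ⟨x, hx, hlt⟩
    have h1 : 0 < min x (1 / 2) := lt_min hx (by norm_num)
    refine ⟨_, ⟨min x (1 / 2), ⟨h1, (min_le_right _ _).trans_lt (by norm_num)⟩, rfl⟩, ?_⟩
    exact EReal.coe_lt_coe_iff.2 ((H.inc.mono h1 hx (min_le_left _ _)).trans_lt hlt)

/-! ### The equation for `δ` -/

theorem deltaEq_iff {D : SwitchData} (δ : ℝ) :
    D.DeltaEq δ ↔ ∫ s in Ioi δ, s ^ (-D.n - 1) * (D.h s - D.k) = 0 := by
  simp only [DeltaEq, k, sub_neg_eq_add]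

theorem lt_of_deltaEq {D : SwitchData} (H : D.Admissible) {δ : ℝ} (hδ : 0 < δ)
    (hd : D.DeltaEq δ) : D.h δ < D.k := by
  have h1 := H.inc.lt_integral_Ioi H.n_pos D.k hδ H.intI H.top
  rw [deltaEq_iff] at hd
  rw [hd] at h1
  by_contra! hcon
  have := mul_nonneg (sub_nonneg.2 hcon) (div_pos (Real.rpow_pos_of_pos hδ (-D.n)) H.n_pos).le
  linarith

/-- At the larger root h is still below k, so the integral of h - k between two distinct roots would
be negative, not 0. -/
theorem deltaEq_unique {D : SwitchData} (H : D.Admissible) {δ δ' : ℝ} (hδ : 0 < δ)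
    (hδ' : 0 < δ') (hd : D.DeltaEq δ) (hd' : D.DeltaEq δ') : δ = δ' := by
  have key : ∀ δ δ', 0 < δ → D.DeltaEq δ → D.DeltaEq δ' → ¬ δ < δ' := by
    intro δ δ' hδ hd hd' hlt
    have h1 := H.lt_of_deltaEq (hδ.trans hlt) hd'
    have h2 := integral_Ioi_eq_wint_add H.n_pos D.k hδ (hδ.trans hlt) H.intI
    rw [(deltaEq_iff _).1 hd, (deltaEq_iff _).1 hd'] at h2
    have h3 := H.inc.wint_le_right H.n_pos.ne' D.k hδ hlt.le
    have h4 := mul_neg_of_neg_of_pos (sub_neg.2 h1) (kp_pos H.n_pos.ne' hδ hlt)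
    linarith
  exact le_antisymm (not_lt.1 (key _ _ hδ' hd' hd)) (not_lt.1 (key _ _ hδ hd hd'))

theorem exists_deltaEq {D : SwitchData} (H : D.Admissible) {x₁ : ℝ} (hx₁ : 0 < x₁)
    (hlt : D.h x₁ < D.k) : ∃ δ, 0 < δ ∧ D.DeltaEq δ := by
  have hn := H.n_pos
  set Q : ℝ → ℝ := fun x => ∫ s in Ioi x, s ^ (-D.n - 1) * (D.h s - D.k) with hQ
  have hQadd : ∀ x y, 0 < x → 0 < y → Q x = wint D.h D.n D.k x y + Q y := fun x y hx hy =>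
    integral_Ioi_eq_wint_add hn D.k hx hy H.intI
  obtain ⟨y, hy, hyk⟩ := ((eventually_gt_atTop x₁).and (H.top.eventually_ge_atTop D.k)).exists
  have hy0 := hx₁.trans hy
  have hQy : 0 < Q y := by
    refine lt_of_le_of_lt ?_ (H.inc.lt_integral_Ioi hn D.k hy0 H.intI H.top)
    exact mul_nonneg (sub_nonneg.2 hyk) (div_pos (Real.rpow_pos_of_pos hy0 _) hn).le
  have hgap : 0 < D.k - D.h x₁ := sub_pos.2 hlt
  -- Near 0 the weight s^{-n-1} has divergent mass and h - k ≤ h x₁ - k < 0. The bound on tⁿ makes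
  -- the integral over [t⁻¹, x₁] outweigh Q x₁.
  obtain ⟨t, ht, ht2⟩ := ((eventually_gt_atTop x₁⁻¹).and
    ((tendsto_rpow_atTop hn).eventually_ge_atTop
    (x₁ ^ (-D.n) + D.n * Q x₁ / (D.k - D.h x₁)))).exists
  have ht0 : 0 < t := (inv_pos.2 hx₁).trans ht
  have hd0 : 0 < t⁻¹ := inv_pos.2 ht0
  have hdx : t⁻¹ < x₁ := inv_lt_of_inv_lt₀ hx₁ ht
  have hQd : Q t⁻¹ ≤ 0 := by
    have h1 := H.inc.wint_le_right hn.ne' D.k hd0 hdx.le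
    have e : kp D.n t⁻¹ x₁ = (t ^ D.n - x₁ ^ (-D.n)) / D.n := by
      rw [kp, Real.inv_rpow ht0.le, Real.rpow_neg ht0.le, inv_inv, ← neg_div_neg_eq]
      congr 1 <;> ring
    have h2 : Q x₁ ≤ (D.k - D.h x₁) * ((t ^ D.n - x₁ ^ (-D.n)) / D.n) := by
      have h3 : D.n * Q x₁ / (D.k - D.h x₁) ≤ t ^ D.n - x₁ ^ (-D.n) := by linarith
      rw [div_le_iff₀ hgap] at h3
      rw [← mul_div_assoc, le_div_iff₀ hn]
      linarith
    rw [hQadd _ _ hd0 hx₁]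
    rw [e] at h1
    linarith
  have hcont : ContinuousOn Q (Icc t⁻¹ y) := by
    have h1 : ContinuousOn (fun x => -wint D.h D.n D.k y x + Q y) (Icc t⁻¹ y) :=
      ((H.inc.continuousOn_wint D.n D.k hy0).neg.add continuousOn_const).mono
        fun z hz => hd0.trans_le hz.1
    refine h1.congr fun x hx => ?_
    rw [hQadd x y (hd0.trans_le hx.1) hy0, IncRC.wint_symm]
  obtain ⟨δ, hδ, hδ0⟩ := intermediate_value_Icc (hdx.trans hy).le hcont
    (show (0 : ℝ) ∈ Icc _ _ from ⟨hQd, hQy.le⟩)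
  exact ⟨δ, hd0.trans_le hδ.1, (deltaEq_iff δ).2 hδ0⟩

theorem fbSetup {D : SwitchData} (H : D.Admissible) (hK : D.K < 0) {δ : ℝ} (hδ : 0 < δ)
    (hd : D.DeltaEq δ) : FBSetup D.h D.m D.n D.k δ where
  toIncRC := H.inc
  hm := H.m_neg
  hn := H.n_pos
  hk := by have := mul_neg_of_pos_of_neg H.r_pos hK; rw [k]; linarith
  hδ := hδ
  top := H.top
  intI := H.intI
  eqδ := (deltaEq_iff δ).1 hd

theorem G₁_eq {D : SwitchData} (H : D.Admissible) (K₁ ζ : ℝ) {δ α : ℝ} (hδ : 0 < δ)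
    (hα : 0 < α) :
    D.G₁ K₁ δ ζ α = D.k * ζ ^ (-D.m) - fbM D.h D.m D.k δ (D.r * K₁) α := by
  have e : D.m * kp D.m δ α = δ ^ (-D.m) - α ^ (-D.m) := by
    rw [kp]; field_simp [H.m_neg.ne]; ring
  have h1 := H.inc.wint_const H.m_neg.ne D.k (D.r * K₁) hδ hα
  rw [fbM, h1, G₁, ← wint, k]
  linear_combination -(D.r * K₁ + D.r * D.K) * e

theorem G₂_eq {D : SwitchData} (H : D.Admissible) (K₁ ζ : ℝ) {δ α : ℝ} (hδ : 0 < δ)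
    (hα : 0 < α) :
    D.G₂ K₁ δ ζ α = fbE D.h D.n D.k δ (D.r * K₁) α - D.k * ζ ^ (-D.n) := by
  have e : D.n * kp D.n δ α = δ ^ (-D.n) - α ^ (-D.n) := by
    rw [kp]; field_simp [H.n_pos.ne']; ring
  have h1 := H.inc.wint_const H.n_pos.ne' D.k (D.r * K₁) hδ hα
  rw [fbE, h1, G₂, ← wint, k]
  linear_combination (D.r * K₁ + D.r * D.K) * e

theorem freeBoundary_iff {D : SwitchData} (H : D.Admissible) (K₁ δ ζ α : ℝ) :
    D.FreeBoundary K₁ δ ζ α ↔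
      0 < δ ∧ D.DeltaEq δ ∧ FBSol D.h D.m D.n D.k δ (D.r * K₁) ζ α := by
  constructor
  · intro F
    have hδ : 0 < δ := F.pos.trans_le (min_le_left _ _)
    have hδα : δ < α := (le_max_left _ _).trans_lt F.lt
    refine ⟨hδ, F.eq_delta, F.pos.trans_le (min_le_right _ _), hδα,
      (le_max_right _ _).trans_lt F.lt, ?_, ?_⟩
    · have := H.G₁_eq K₁ ζ hδ (hδ.trans hδα)
      rw [F.eq₁] at this
      linarith
    · have := H.G₂_eq K₁ ζ hδ (hδ.trans hδα)
      rw [F.eq₂] at this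
      linarith
  · rintro ⟨hδ, hd, T⟩
    refine ⟨lt_min hδ T.hζ, max_lt T.hδα T.hζα, hd, ?_, ?_⟩
    · rw [H.G₁_eq K₁ ζ hδ (hδ.trans T.hδα), T.eqM, sub_self]
    · rw [H.G₂_eq K₁ ζ hδ (hδ.trans T.hδα), T.eqE, sub_self]

/-! ### Integrals up to `0` and `∞` -/

theorem integral_Ioc_rpow {m x : ℝ} (hm : m < 0) (hx : 0 < x) :
    ∫ s in Ioc 0 x, s ^ (-m - 1) = x ^ (-m) / (-m) := by
  rw [← intervalIntegral.integral_of_le hx.le, integral_rpow (Or.inl (by linarith)),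
    show -m - 1 + 1 = -m by ring, Real.zero_rpow (by linarith), sub_zero]

theorem integrableOn_Ioc_rpow {m x : ℝ} (hm : m < 0) (hx : 0 < x) :
    IntegrableOn (fun s : ℝ => s ^ (-m - 1)) (Ioc 0 x) :=
  (intervalIntegrable_iff_integrableOn_Ioc_of_le hx.le).1
    (intervalIntegral.intervalIntegrable_rpow' (by linarith))

theorem integral_Ioc_sub {D : SwitchData} (H : D.Admissible) (c : ℝ) {x : ℝ} (hx : 0 < x) :
    ∫ s in Ioc 0 x, s ^ (-D.m - 1) * (D.h s - c) =
      (∫ s in Ioc 0 x, s ^ (-D.m - 1) * D.h s) - c * (x ^ (-D.m) / (-D.m)) := by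
  rw [← integral_Ioc_rpow H.m_neg hx, ← integral_const_mul, ← integral_sub (H.int0 x hx)
    ((integrableOn_Ioc_rpow H.m_neg hx).const_mul c)]
  congr 1
  ext s
  ring

theorem integral_Ioi_sub {D : SwitchData} (H : D.Admissible) (c : ℝ) {x : ℝ} (hx : 0 < x) :
    ∫ s in Ioi x, s ^ (-D.n - 1) * (D.h s - c) =
      (∫ s in Ioi x, s ^ (-D.n - 1) * D.h s) - c * (x ^ (-D.n) / D.n) := by
  rw [← integral_Ioi_rpow_neg_sub_one H.n_pos hx, ← integral_const_mul, ← integral_sub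
    (H.intI x hx) ((integrableOn_Ioi_rpow_of_lt (by linarith [H.n_pos]) hx).const_mul c)]
  congr 1
  ext s
  ring

theorem integral_Ioc_eq {D : SwitchData} (H : D.Admissible) {x y : ℝ} (hx : 0 < x)
    (hxy : x ≤ y) :
    ∫ s in Ioc 0 y, s ^ (-D.m - 1) * D.h s =
      (∫ s in Ioc 0 x, s ^ (-D.m - 1) * D.h s) + wint D.h D.m 0 x y := by
  have hy := hx.trans_le hxy
  have i := (intervalIntegrable_iff_integrableOn_Ioc_of_le hy.le).2 (H.int0 y hy)
  have i1 := (intervalIntegrable_iff_integrableOn_Ioc_of_le hx.le).2 (H.int0 x hx)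
  have i2 : IntervalIntegrable (fun s => s ^ (-D.m - 1) * D.h s) volume x y := by
    simpa using H.inc.intervalIntegrable (-D.m - 1) 0 hx hy
  rw [← intervalIntegral.integral_of_le hx.le, ← intervalIntegral.integral_of_le hy.le, wint]
  simp only [sub_zero]
  exact (intervalIntegral.integral_add_adjacent_intervals i1 i2).symm

end Admissible

/-! ### The candidate functions -/

/-- A solution of the free-boundary system together with the assumptions of the main case. -/
structure Solved (D : SwitchData) (K₁ δ ζ α : ℝ) : Prop where
  adm : D.Admissible
  K_neg : D.K < 0
  K₁_pos : 0 < K₁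
  S : FBSetup D.h D.m D.n D.k δ
  T : FBSol D.h D.m D.n D.k δ (D.r * K₁) ζ α

namespace Solved

theorem c_pos {D : SwitchData} {K₁ δ ζ α : ℝ} (X : D.Solved K₁ δ ζ α) : 0 < D.r * K₁ :=
  mul_pos X.adm.r_pos X.K₁_pos

theorem α_pos {D : SwitchData} {K₁ δ ζ α : ℝ} (X : D.Solved K₁ δ ζ α) : 0 < α :=
  X.T.hζ.trans X.T.hζα

theorem A_eq {D : SwitchData} {K₁ δ ζ α : ℝ} (X : D.Solved K₁ δ ζ α) :
    D.A δ = -D.C * ((∫ s in Ioc 0 δ, s ^ (-D.m - 1) * D.h s) -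
      D.k * (δ ^ (-D.m) / (-D.m))) := by
  rw [← X.adm.integral_Ioc_sub D.k X.S.hδ, A, C, k]
  simp only [sub_neg_eq_add]

theorem A_pos {D : SwitchData} {K₁ δ ζ α : ℝ} (X : D.Solved K₁ δ ζ α) : 0 < D.A δ := by
  have hδ := X.S.hδ
  have hC := X.adm.C_pos
  -- Replacing k by h δ splits A into a positive term, since h δ < k, and the integral of h δ - h,
  -- nonnegative by monotonicity.
  have e : D.A δ = D.C * ((D.k - D.h δ) * (δ ^ (-D.m) / (-D.m)) +
      ∫ s in Ioc 0 δ, s ^ (-D.m - 1) * (D.h δ - D.h s)) := by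
    have h1 : ∫ s in Ioc 0 δ, s ^ (-D.m - 1) * (D.h δ - D.h s) =
        -∫ s in Ioc 0 δ, s ^ (-D.m - 1) * (D.h s - D.h δ) := by
      rw [← integral_neg]
      congr 1
      ext s
      ring
    rw [h1, X.adm.integral_Ioc_sub (D.h δ) hδ, X.A_eq]
    ring
  have h2 : 0 ≤ ∫ s in Ioc 0 δ, s ^ (-D.m - 1) * (D.h δ - D.h s) :=
    setIntegral_nonneg measurableSet_Ioc fun s hs =>
      mul_nonneg (Real.rpow_pos_of_pos hs.1 _).le
        (sub_nonneg.2 (X.adm.inc.mono hs.1 hδ hs.2))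
  have h3 := mul_pos (sub_pos.2 X.S.lt_at_δ)
    (div_pos (Real.rpow_pos_of_pos hδ (-D.m)) (neg_pos.2 X.adm.m_neg))
  rw [e]
  exact mul_pos hC (by linarith)

/-- The choice of A and equation (1) remove the homogeneous terms, so value and slope fit to -K and
0 at δ. -/
theorem open_eq {D : SwitchData} {K₁ δ ζ α : ℝ} (X : D.Solved K₁ δ ζ α) {x : ℝ} (hx : δ ≤ x) :
    D.A δ * x ^ D.m + D.R x = -D.K + D.C * solY D.h D.m D.n D.k δ x := by
  have hδ := X.S.hδ
  have hx0 := hδ.trans_le hx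
  have hm := X.adm.m_neg.ne
  have hn := X.adm.n_pos.ne'
  have h1 := X.adm.integral_Ioc_eq hδ hx
  have h2 := X.adm.inc.wint_const hm 0 D.k hδ hx0
  have h3 := X.S.tail_eq hx0
  rw [X.adm.integral_Ioi_sub D.k hx0] at h3
  have h4 : (∫ s in Ioi x, s ^ (-D.n - 1) * D.h s) =
    -wint D.h D.n D.k δ x + D.k * (x ^ (-D.n) / D.n) := by linarith
  have h5 := X.adm.C_mul D.K
  rw [R, ← C, X.A_eq, h1, h2, h4, solY]
  generalize (∫ s in Ioc 0 δ, s ^ (-D.m - 1) * D.h s) = I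
  have e : x ^ D.m * kp D.m δ x = -(1 / D.m) * (1 - x ^ D.m * δ ^ (-D.m)) := by
    rw [kp]
    field_simp
    linear_combination -rpow_mul_rpow_neg D.m hx0
  have hk : D.k = -(D.r * D.K) := rfl
  have e2 : x ^ D.n * (x ^ (-D.n) / D.n) = 1 / D.n := by
    rw [← mul_div_assoc, rpow_mul_rpow_neg D.n hx0]
  have e3 : δ ^ (-D.m) / (-D.m) = -(1 / D.m) * δ ^ (-D.m) := by field_simp
  rw [e3]
  linear_combination -h5 + D.C * D.k * e + D.C * D.k * e2 + D.C * (1 / D.n - 1 / D.m) * hk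

theorem Δ₁_eq {D : SwitchData} {K₁ δ ζ α : ℝ} (X : D.Solved K₁ δ ζ α) :
    D.Δ₁ K₁ δ α = -(D.C * (D.k * (1 / D.m) * ζ ^ (-D.m))) := by
  have hδ := X.S.hδ
  have hα := X.α_pos
  have hm := X.adm.m_neg.ne
  have h1 := X.T.eqM
  have e : D.m * kp D.m δ α = δ ^ (-D.m) - α ^ (-D.m) := by
    rw [kp]; field_simp; ring
  rw [Δ₁, ← C, X.adm.integral_Ioc_sub (D.r * K₁) hα, X.A_eq,
    X.adm.integral_Ioc_eq hδ X.T.hδα.le, X.adm.inc.wint_const hm 0 D.k hδ hα]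
  rw [fbM] at h1
  generalize (∫ s in Ioc 0 δ, s ^ (-D.m - 1) * D.h s) = I
  have i1 : 1 / D.m * D.m = 1 := by field_simp
  have e3 : ∀ t : ℝ, t / (-D.m) = -(1 / D.m) * t := fun t => by field_simp
  rw [e3, e3]
  linear_combination -(1 / D.m) * D.C * h1 + D.C * (1 / D.m) * D.k * e
    - D.C * (wint D.h D.m D.k δ α + D.k * kp D.m δ α) * i1

theorem Δ₂_eq {D : SwitchData} {K₁ δ ζ α : ℝ} (X : D.Solved K₁ δ ζ α) :
    D.Δ₂ K₁ α = D.C * (D.k * (1 / D.n) * ζ ^ (-D.n)) := by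
  have hα := X.α_pos
  have hn := X.adm.n_pos.ne'
  have h1 := X.T.eqE
  have h3 := X.S.tail_eq hα
  rw [X.adm.integral_Ioi_sub D.k hα] at h3
  rw [Δ₂, ← C, X.adm.integral_Ioi_sub (D.r * K₁) hα]
  rw [fbE] at h1
  have i1 : 1 / D.n * D.n = 1 := by field_simp
  have e3 : ∀ t : ℝ, t / D.n = (1 / D.n) * t := fun t => by field_simp
  rw [e3] at h3 ⊢
  linear_combination D.C * (1 / D.n) * h1 + D.C * h3 + D.C * wint D.h D.n D.k δ α * i1

/-- By the free-boundary equations Δ₁ and Δ₂ are exactly the coefficients that give smooth fit to -K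
at ζ. -/
theorem closed_eq {D : SwitchData} {K₁ δ ζ α : ℝ} (X : D.Solved K₁ δ ζ α) {x : ℝ} (hx : 0 < x) :
    D.Δ₁ K₁ δ α * x ^ D.m + D.Δ₂ K₁ α * x ^ D.n =
      -D.K + D.C * solY (fun _ => 0) D.m D.n D.k ζ x := by
  have hm := X.adm.m_neg.ne
  have hn := X.adm.n_pos.ne'
  have e : ∀ p : ℝ, p ≠ 0 → kp p ζ x = (1 / p) * (ζ ^ (-p) - x ^ (-p)) := fun p hp => by
    rw [kp]; field_simp; ring
  have h5 := X.adm.C_mul D.K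
  have hk : D.r * D.K = -D.k := by rw [k]; ring
  rw [hk] at h5
  rw [X.Δ₁_eq, X.Δ₂_eq, solY, wint_zero hm D.k X.T.hζ hx, wint_zero hn D.k X.T.hζ hx,
    e _ hm, e _ hn]
  linear_combination -h5 - D.C * D.k * (1 / D.m) * rpow_mul_rpow_neg D.m hx
    + D.C * D.k * (1 / D.n) * rpow_mul_rpow_neg D.n hx

theorem w₁_of_le {D : SwitchData} {δ x : ℝ} (hx : x ≤ δ) : D.w₁ δ x = -D.K := if_pos hx

theorem w₁_of_ge {D : SwitchData} {K₁ δ ζ α : ℝ} (X : D.Solved K₁ δ ζ α) {x : ℝ} (hx : δ ≤ x) :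
    D.w₁ δ x = -D.K + D.C * solY D.h D.m D.n D.k δ x := by
  rcases hx.eq_or_lt with rfl | h
  · rw [w₁_of_le le_rfl, solY_self, mul_zero, add_zero]
  · rw [w₁, if_neg (not_le.2 h), X.open_eq hx]

theorem w₀_of_le {D : SwitchData} {K₁ δ ζ α x : ℝ} (hx : x ≤ ζ) :
    D.w₀ K₁ δ ζ α x = -D.K := if_pos hx

theorem w₀_of_mem {D : SwitchData} {K₁ δ ζ α : ℝ} (X : D.Solved K₁ δ ζ α) {x : ℝ}
    (hx : ζ ≤ x) (hx' : x ≤ α) :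
    D.w₀ K₁ δ ζ α x = -D.K + D.C * solY (fun _ => 0) D.m D.n D.k ζ x := by
  rcases hx.eq_or_lt with rfl | h
  · rw [w₀_of_le le_rfl, solY_self, mul_zero, add_zero]
  · rw [w₀, if_neg (not_le.2 h), if_pos hx', X.closed_eq (X.T.hζ.trans h)]

/-- The two candidates in terms of the same particular solution. -/
theorem sub_eq {D : SwitchData} {K₁ δ ζ α : ℝ} (X : D.Solved K₁ δ ζ α) {x : ℝ} (hx : 0 < x) :
    D.C * solY (fun _ => 0) D.m D.n D.k ζ x - D.C * solY D.h D.m D.n D.k δ x =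
      -K₁ - D.C * solY D.h D.m D.n (D.r * K₁) α x := by
  have h1 := X.T.solY_eq X.S hx
  have h2 := X.adm.C_mul K₁
  linear_combination D.C * h1 - h2

theorem w₀_of_ge {D : SwitchData} {K₁ δ ζ α : ℝ} (X : D.Solved K₁ δ ζ α) {x : ℝ}
    (hx : α ≤ x) :
    D.w₀ K₁ δ ζ α x = -D.K + D.C * solY D.h D.m D.n D.k δ x - K₁ := by
  rcases hx.eq_or_lt with rfl | h
  · have h1 := X.sub_eq X.α_pos
    rw [solY_self] at h1
    rw [X.w₀_of_mem X.T.hζα.le le_rfl]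
    linarith
  · rw [w₀, if_neg (not_le.2 (X.T.hζα.trans h)), if_neg (not_le.2 h),
      X.open_eq (X.T.hδα.trans h).le]

end Solved

end SwitchData

/-! ### Regularity, monotonicity and the HJB equation for the candidates -/

/-- The second derivative of `solY f m n c a` at a point of continuity of `f`. -/
def solY'' (f : ℝ → ℝ) (m n c a x : ℝ) : ℝ :=
  (m ^ 2 * x ^ m * wint f m c a x - n ^ 2 * x ^ n * wint f n c a x + (m - n) * (f x - c) -
    solZ f m n c a x) / x ^ 2

namespace IncRC

theorem solY_le {f : ℝ → ℝ} (H : IncRC f) {m n c a x y : ℝ} (ha : 0 < a) (hx : 0 < x)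
    (hxy : x ≤ y) (h0 : ∀ t ∈ Ico x y, 0 ≤ solZ f m n c a t) :
    solY f m n c a x ≤ solY f m n c a y :=
  le_of_rightDeriv_nonneg hxy
    ((H.continuousOn_solY m n c ha).mono fun _ hz => hx.trans_le hz.1)
    (fun _ ht => (H.hasDerivAt_solY m n c ha (hx.trans_le ht.1)).hasDerivWithinAt)
    fun t ht => div_nonneg (h0 t ht) (hx.trans_le ht.1).le

theorem solY_ge {f : ℝ → ℝ} (H : IncRC f) {m n c a x y : ℝ} (ha : 0 < a) (hx : 0 < x)
    (hxy : x ≤ y) (h0 : ∀ t ∈ Ico x y, solZ f m n c a t ≤ 0) :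
    solY f m n c a y ≤ solY f m n c a x := by
  have := le_of_rightDeriv_nonneg (f := fun x => -solY f m n c a x) hxy
    ((H.continuousOn_solY m n c ha).neg.mono fun _ hz => hx.trans_le hz.1)
    (fun _ ht => (H.hasDerivAt_solY m n c ha (hx.trans_le ht.1)).neg.hasDerivWithinAt)
    fun t ht => by
      rw [neg_nonneg]
      exact div_nonpos_of_nonpos_of_nonneg (h0 t ht) (hx.trans_le ht.1).le
  linarith

/-- The continuity points of a monotone function are dense, also after removing finitely many. -/
theorem exists_continuousAt {f : ℝ → ℝ} (H : IncRC f) (F : Finset ℝ) {a b : ℝ} (ha : 0 ≤ a)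
    (hab : a < b) : ∃ y ∈ Ioo a b, y ∉ F ∧ ContinuousAt f y := by
  have h1 : {x ∈ Ioi (0 : ℝ) | ¬ContinuousWithinAt f (Ioi 0) x}.Countable :=
    H.mono.countable_not_continuousWithinAt
  have h2 : ({x ∈ Ioi (0 : ℝ) | ¬ContinuousWithinAt f (Ioi 0) x} ∪ (F : Set ℝ)).Countable :=
    h1.union F.countable_toSet
  obtain ⟨y, hy, hyab⟩ := (h2.dense_compl ℝ).exists_mem_open isOpen_Ioo (nonempty_Ioo.2 hab)
  have hy0 : 0 < y := ha.trans_lt hyab.1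
  refine ⟨y, hyab, fun hF => hy (Or.inr hF), ?_⟩
  by_contra hcon
  refine hy (Or.inl ⟨hy0, fun hw => hcon (hw.continuousAt (Ioi_mem_nhds hy0))⟩)

end IncRC

namespace SwitchData

/-- The characteristic equations annihilate the x^m and xⁿ terms. What is left is the (m - n)(f - c)
part of the second derivative, normalised by C. -/
theorem Admissible.euler_eq {D : SwitchData} (H : D.Admissible) (f : ℝ → ℝ) (c a : ℝ) {x : ℝ}
    (hx : 0 < x) :
    D.σ ^ 2 * x ^ 2 * (D.C * solY'' f D.m D.n c a x) +
      D.b * x * (D.C * (solZ f D.m D.n c a x / x)) - D.r * (D.C * solY f D.m D.n c a x) =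
      -(f x - c) := by
  have h1 := root_m H.r_pos H.σ_ne
  have h2 := root_n H.r_pos H.σ_ne
  have hC : D.C * (D.σ ^ 2 * (D.n - D.m)) = 1 := by
    rw [C, one_div_mul_cancel]
    have := H.C_pos
    rw [C, one_div_pos] at this
    exact this.ne'
  have e1 : x ^ 2 * solY'' f D.m D.n c a x =
      D.m ^ 2 * x ^ D.m * wint f D.m c a x - D.n ^ 2 * x ^ D.n * wint f D.n c a x +
        (D.m - D.n) * (f x - c) - solZ f D.m D.n c a x := by
    rw [solY'', mul_div_cancel₀]
    positivity
  have e2 : x * (solZ f D.m D.n c a x / x) = solZ f D.m D.n c a x := by field_simp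
  have e3 : solZ f D.m D.n c a x =
    D.m * x ^ D.m * wint f D.m c a x - D.n * x ^ D.n * wint f D.n c a x := rfl
  have e4 : solY f D.m D.n c a x = x ^ D.m * wint f D.m c a x - x ^ D.n * wint f D.n c a x := rfl
  linear_combination D.σ ^ 2 * D.C * e1 + D.b * D.C * e2 + (D.b - D.σ ^ 2) * D.C * e3
    - D.r * D.C * e4 + D.C * x ^ D.m * wint f D.m c a x * h1
    - D.C * x ^ D.n * wint f D.n c a x * h2 - (f x - c) * hC

namespace Solved

/-! ### Derivatives of the candidates -/

theorem w₁_eq {D : SwitchData} {K₁ δ ζ α : ℝ} (X : D.Solved K₁ δ ζ α) :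
    D.w₁ δ = fun x => if x ≤ δ then -D.K else -D.K + D.C * solY D.h D.m D.n D.k δ x := by
  ext x
  split_ifs with h
  · exact w₁_of_le h
  · exact X.w₁_of_ge (not_le.1 h).le

theorem w₀_eq {D : SwitchData} {K₁ δ ζ α : ℝ} (X : D.Solved K₁ δ ζ α) :
    D.w₀ K₁ δ ζ α = fun x => if x ≤ ζ then -D.K else if x ≤ α then
      -D.K + D.C * solY (fun _ => 0) D.m D.n D.k ζ x else
      -D.K + D.C * solY D.h D.m D.n D.k δ x - K₁ := by
  ext x
  split_ifs with h h'
  · exact w₀_of_le h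
  · exact X.w₀_of_mem (not_le.1 h).le h'
  · exact X.w₀_of_ge (not_le.1 h').le

theorem hasDerivAt_openPart {D : SwitchData} {K₁ δ ζ α : ℝ} (X : D.Solved K₁ δ ζ α) (x : ℝ)
    (hx : 0 < x) :
    HasDerivAt (fun x => -D.K + D.C * solY D.h D.m D.n D.k δ x)
      (D.C * (solZ D.h D.m D.n D.k δ x / x)) x :=
  ((X.S.hasDerivAt_solY D.m D.n D.k X.S.hδ hx).const_mul D.C).const_add _

theorem hasDerivAt_closedPart {D : SwitchData} {K₁ δ ζ α : ℝ} (X : D.Solved K₁ δ ζ α) (x : ℝ)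
    (hx : 0 < x) :
    HasDerivAt (fun x => -D.K + D.C * solY (fun _ => 0) D.m D.n D.k ζ x)
      (D.C * (solZ (fun _ => 0) D.m D.n D.k ζ x / x)) x :=
  ((incRC_zero.hasDerivAt_solY D.m D.n D.k X.T.hζ hx).const_mul D.C).const_add _

theorem solZ_eq_at_α {D : SwitchData} {K₁ δ ζ α : ℝ} (X : D.Solved K₁ δ ζ α) :
    solZ (fun _ => 0) D.m D.n D.k ζ α = solZ D.h D.m D.n D.k δ α := by
  have := X.T.solZ_eq X.S X.α_pos
  rw [solZ_self] at this
  linarith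

theorem hasDerivAt_w₁ {D : SwitchData} {K₁ δ ζ α : ℝ} (X : D.Solved K₁ δ ζ α) {x : ℝ}
    (hx : 0 < x) :
    HasDerivAt (D.w₁ δ) (if x ≤ δ then 0 else D.C * (solZ D.h D.m D.n D.k δ x / x)) x := by
  rw [X.w₁_eq]
  refine hasDerivAt_ite_le (f' := fun _ => 0) (fun x _ => hasDerivAt_const x _)
    X.hasDerivAt_openPart ?_ ?_ hx
  · rw [solY_self]; ring
  · rw [solZ_self]; ring

theorem continuousOn_deriv_w₁ {D : SwitchData} {K₁ δ ζ α : ℝ} (X : D.Solved K₁ δ ζ α) :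
    ContinuousOn (fun x => if x ≤ δ then 0 else D.C * (solZ D.h D.m D.n D.k δ x / x)) (Ioi 0) := by
  refine continuousOn_ite_le continuousOn_const
    (continuousOn_const.mul (X.S.continuousOn_solZ_div D.m D.n D.k X.S.hδ)) ?_
  rw [solZ_self]; ring

theorem hasDerivAt_w₀ {D : SwitchData} {K₁ δ ζ α : ℝ} (X : D.Solved K₁ δ ζ α) {x : ℝ}
    (hx : 0 < x) :
    HasDerivAt (D.w₀ K₁ δ ζ α) (if x ≤ ζ then 0 else if x ≤ α then
      D.C * (solZ (fun _ => 0) D.m D.n D.k ζ x / x) else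
      D.C * (solZ D.h D.m D.n D.k δ x / x)) x := by
  rw [X.w₀_eq]
  refine hasDerivAt_ite_le (f' := fun _ => 0) (g' := fun x => if x ≤ α then
      D.C * (solZ (fun _ => 0) D.m D.n D.k ζ x / x) else
      D.C * (solZ D.h D.m D.n D.k δ x / x)) (fun x _ => hasDerivAt_const x _)
    (fun x hx => hasDerivAt_ite_le
      (f' := fun x => D.C * (solZ (fun _ => 0) D.m D.n D.k ζ x / x))
      (g' := fun x => D.C * (solZ D.h D.m D.n D.k δ x / x))
      X.hasDerivAt_closedPart (fun x hx => (X.hasDerivAt_openPart x hx).sub_const _) ?_ ?_ hx)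
    ?_ ?_ hx
  · have := X.w₀_of_mem X.T.hζα.le le_rfl
    rw [← this, X.w₀_of_ge le_rfl]
  · rw [X.solZ_eq_at_α]
  · rw [if_pos X.T.hζα.le, solY_self]; ring
  · rw [if_pos X.T.hζα.le, solZ_self]; ring

theorem continuousOn_deriv_w₀ {D : SwitchData} {K₁ δ ζ α : ℝ} (X : D.Solved K₁ δ ζ α) :
    ContinuousOn (fun x => if x ≤ ζ then 0 else if x ≤ α then
      D.C * (solZ (fun _ => 0) D.m D.n D.k ζ x / x) else
      D.C * (solZ D.h D.m D.n D.k δ x / x)) (Ioi 0) := by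
  refine continuousOn_ite_le continuousOn_const (continuousOn_ite_le
    (continuousOn_const.mul (incRC_zero.continuousOn_solZ_div D.m D.n D.k X.T.hζ))
    (continuousOn_const.mul (X.S.continuousOn_solZ_div D.m D.n D.k X.S.hδ)) ?_) ?_
  · rw [X.solZ_eq_at_α]
  · rw [if_pos X.T.hζα.le, solZ_self]; ring

theorem hasDerivAt_deriv_w₁ {D : SwitchData} {K₁ δ ζ α : ℝ} (X : D.Solved K₁ δ ζ α) {x : ℝ}
    (hx : 0 < x) (hxδ : x ≠ δ) (hc : ContinuousAt D.h x) :
    HasDerivAt (deriv (D.w₁ δ))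
      (if x ≤ δ then 0 else D.C * solY'' D.h D.m D.n D.k δ x) x := by
  rcases lt_or_gt_of_ne hxδ with h | h
  · rw [if_pos h.le]
    refine (hasDerivAt_const x (0 : ℝ)).congr_of_eventuallyEq ?_
    filter_upwards [Ioo_mem_nhds hx h] with y hy
    rw [(X.hasDerivAt_w₁ hy.1).deriv, if_pos hy.2.le]
  · rw [if_neg (not_le.2 h)]
    refine ((X.S.hasDerivAt_solZ_div D.m D.n D.k X.S.hδ hx hc).const_mul
      D.C).congr_of_eventuallyEq ?_
    filter_upwards [Ioi_mem_nhds h] with y hy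
    rw [(X.hasDerivAt_w₁ (X.S.hδ.trans hy)).deriv, if_neg (not_le.2 hy)]

theorem hasDerivAt_deriv_w₀ {D : SwitchData} {K₁ δ ζ α : ℝ} (X : D.Solved K₁ δ ζ α) {x : ℝ}
    (hx : 0 < x) (hxζ : x ≠ ζ) (hxα : x ≠ α) (hc : ContinuousAt D.h x) :
    HasDerivAt (deriv (D.w₀ K₁ δ ζ α))
      (if x ≤ ζ then 0 else if x ≤ α then D.C * solY'' (fun _ => 0) D.m D.n D.k ζ x else
        D.C * solY'' D.h D.m D.n D.k δ x) x := by
  rcases lt_or_gt_of_ne hxζ with h | h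
  · rw [if_pos h.le]
    refine (hasDerivAt_const x (0 : ℝ)).congr_of_eventuallyEq ?_
    filter_upwards [Ioo_mem_nhds hx h] with y hy
    rw [(X.hasDerivAt_w₀ hy.1).deriv, if_pos hy.2.le]
  rw [if_neg (not_le.2 h)]
  rcases lt_or_gt_of_ne hxα with h' | h'
  · rw [if_pos h'.le]
    refine ((incRC_zero.hasDerivAt_solZ_div D.m D.n D.k X.T.hζ hx continuousAt_const).const_mul
      D.C).congr_of_eventuallyEq ?_
    filter_upwards [Ioo_mem_nhds h h'] with y hy
    rw [(X.hasDerivAt_w₀ (X.T.hζ.trans hy.1)).deriv, if_neg (not_le.2 hy.1), if_pos hy.2.le]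
  · rw [if_neg (not_le.2 h')]
    refine ((X.S.hasDerivAt_solZ_div D.m D.n D.k X.S.hδ hx hc).const_mul
      D.C).congr_of_eventuallyEq ?_
    filter_upwards [Ioi_mem_nhds h'] with y hy
    rw [(X.hasDerivAt_w₀ (X.α_pos.trans hy)).deriv, if_neg (not_le.2 (X.T.hζα.trans hy)),
      if_neg (not_le.2 hy)]

/-! ### Monotonicity of the candidates -/

theorem solZ_closed_pos {D : SwitchData} {K₁ δ ζ α : ℝ} (X : D.Solved K₁ δ ζ α) {x : ℝ}
    (hx : ζ < x) : 0 < solZ (fun _ => 0) D.m D.n D.k ζ x :=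
  incRC_zero.solZ_pos_of_lt X.adm.m_neg X.adm.n_pos X.T.hζ hx X.S.hk

theorem monotoneOn_w₁ {D : SwitchData} {K₁ δ ζ α : ℝ} (X : D.Solved K₁ δ ζ α) :
    MonotoneOn (D.w₁ δ) (Ioi 0) := by
  refine monotoneOn_of_deriv_nonneg (convex_Ioi 0)
    (fun x hx => (X.hasDerivAt_w₁ hx).continuousAt.continuousWithinAt)
    (fun x hx => (X.hasDerivAt_w₁ (interior_subset hx)).differentiableAt.differentiableWithinAt)
    fun x hx => ?_
  have hx0 : 0 < x := interior_subset hx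
  rw [(X.hasDerivAt_w₁ hx0).deriv]
  split_ifs with h
  · exact le_rfl
  · exact mul_nonneg X.adm.C_pos.le (div_nonneg (X.S.solZ_pos (not_le.1 h)).le hx0.le)

theorem monotoneOn_w₀ {D : SwitchData} {K₁ δ ζ α : ℝ} (X : D.Solved K₁ δ ζ α) :
    MonotoneOn (D.w₀ K₁ δ ζ α) (Ioi 0) := by
  refine monotoneOn_of_deriv_nonneg (convex_Ioi 0)
    (fun x hx => (X.hasDerivAt_w₀ hx).continuousAt.continuousWithinAt)
    (fun x hx => (X.hasDerivAt_w₀ (interior_subset hx)).differentiableAt.differentiableWithinAt)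
    fun x hx => ?_
  have hx0 : 0 < x := interior_subset hx
  rw [(X.hasDerivAt_w₀ hx0).deriv]
  split_ifs with h h'
  · exact le_rfl
  · exact mul_nonneg X.adm.C_pos.le (div_nonneg (X.solZ_closed_pos (not_le.1 h)).le hx0.le)
  · exact mul_nonneg X.adm.C_pos.le
      (div_nonneg (X.S.solZ_pos (X.T.hδα.trans (not_le.1 h'))).le hx0.le)

theorem neg_K_le_w₁ {D : SwitchData} {K₁ δ ζ α : ℝ} (X : D.Solved K₁ δ ζ α) {x : ℝ}
    (hx : 0 < x) : -D.K ≤ D.w₁ δ x := by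
  have hm : 0 < min x δ := lt_min hx X.S.hδ
  have := X.monotoneOn_w₁ hm hx (min_le_left x δ)
  rwa [w₁_of_le (min_le_right x δ)] at this

theorem neg_K_le_w₀ {D : SwitchData} {K₁ δ ζ α : ℝ} (X : D.Solved K₁ δ ζ α) {x : ℝ}
    (hx : 0 < x) : -D.K ≤ D.w₀ K₁ δ ζ α x := by
  have hm : 0 < min x ζ := lt_min hx X.T.hζ
  have := X.monotoneOn_w₀ hm hx (min_le_left x ζ)
  rwa [w₀_of_le (min_le_right x ζ)] at this

/-! ### The difference of the candidates -/

theorem sub_of_mem {D : SwitchData} {K₁ δ ζ α : ℝ} (X : D.Solved K₁ δ ζ α) {x : ℝ}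
    (hδ : δ ≤ x) (hζ : ζ ≤ x) (hα : x ≤ α) :
    D.w₀ K₁ δ ζ α x - D.w₁ δ x = -K₁ - D.C * solY D.h D.m D.n (D.r * K₁) α x := by
  rw [X.w₀_of_mem hζ hα, X.w₁_of_ge hδ, ← X.sub_eq (X.T.hζ.trans_le hζ)]
  ring

theorem sub_of_ge {D : SwitchData} {K₁ δ ζ α : ℝ} (X : D.Solved K₁ δ ζ α) {x : ℝ}
    (hα : α ≤ x) : D.w₀ K₁ δ ζ α x - D.w₁ δ x = -K₁ := by
  rw [X.w₀_of_ge hα, X.w₁_of_ge (X.T.hδα.le.trans hα)]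
  ring

theorem solZ_pos_of_nonneg {D : SwitchData} {K₁ δ ζ α : ℝ} (X : D.Solved K₁ δ ζ α) {x y : ℝ}
    (hx : 0 < x) (hxy : x < y) (hy : y < α) (h0 : 0 ≤ solZ D.h D.m D.n (D.r * K₁) α x) :
    0 < solZ D.h D.m D.n (D.r * K₁) α y := by
  obtain ⟨z, hz, hzα, hzc⟩ := X.T.exists_lt X.S X.c_pos
  exact X.S.solZ_pos_of_nonneg X.adm.m_neg X.adm.n_pos hx hxy hy (X.S.hδ.trans hz) hzα hzc h0

/-- The maximum point of `w₀ - w₁` when `ζ < δ`. -/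
theorem exists_turning {D : SwitchData} {K₁ δ ζ α : ℝ} (X : D.Solved K₁ δ ζ α) (hζδ : ζ < δ) :
    ∃ y ∈ Ioo δ α, solZ D.h D.m D.n (D.r * K₁) α y = 0 ∧
      (∀ x, 0 < x → x < y → solZ D.h D.m D.n (D.r * K₁) α x < 0) ∧
      ∀ x, y < x → x < α → 0 < solZ D.h D.m D.n (D.r * K₁) α x := by
  obtain ⟨z, hz, hzα, hzc⟩ := X.T.exists_lt X.S X.c_pos
  have hz0 := X.S.hδ.trans hz
  have h1 : solZ D.h D.m D.n (D.r * K₁) α δ < 0 := by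
    have h2 := X.T.solZ_eq X.S X.S.hδ
    have h3 := X.solZ_closed_pos hζδ
    rw [solZ_self] at h2
    linarith
  have h2 : 0 < solZ D.h D.m D.n (D.r * K₁) α z :=
    X.S.solZ_pos_of_gt X.adm.m_neg X.adm.n_pos hz0 hzα hzc.le hz0 hzα hzc
  obtain ⟨y, hy, hy0⟩ := intermediate_value_Ioo hz.le
    ((X.S.continuousOn_solZ D.m D.n (D.r * K₁) X.α_pos).mono fun t ht => X.S.hδ.trans_le ht.1)
    (show (0 : ℝ) ∈ Ioo _ _ from ⟨h1, h2⟩)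
  have hyα := hy.2.trans hzα
  refine ⟨y, ⟨hy.1, hyα⟩, hy0, fun x hx hxy => ?_, fun x hx hxα => ?_⟩
  · by_contra! hcon
    exact (X.solZ_pos_of_nonneg hx hxy hyα hcon).ne' hy0
  · exact X.solZ_pos_of_nonneg (X.S.hδ.trans hy.1) hx hxα hy0.ge

theorem solY_nonpos {D : SwitchData} {K₁ δ ζ α : ℝ} (X : D.Solved K₁ δ ζ α) {x : ℝ}
    (hx : 0 < x) (hxα : x ≤ α) (h0 : 0 ≤ solZ D.h D.m D.n (D.r * K₁) α x) :
    solY D.h D.m D.n (D.r * K₁) α x ≤ 0 := by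
  have h1 := X.S.solY_le (m := D.m) (n := D.n) (c := D.r * K₁) X.α_pos hx hxα fun t ht => by
    rcases ht.1.eq_or_lt with rfl | h
    · exact h0
    · exact (X.solZ_pos_of_nonneg hx h ht.2 h0).le
  rwa [solY_self] at h1

/-- At ζ the closed slope is 0 while the open slope is nonnegative. -/
theorem solZ_nonneg_at_ζ {D : SwitchData} {K₁ δ ζ α : ℝ} (X : D.Solved K₁ δ ζ α) (hδζ : δ ≤ ζ) :
    0 ≤ solZ D.h D.m D.n (D.r * K₁) α ζ := by
  have h2 := X.T.solZ_eq X.S X.T.hζ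
  rw [solZ_self] at h2
  rcases hδζ.eq_or_lt with rfl | h
  · rw [solZ_self] at h2
    linarith
  · have := X.S.solZ_pos h
    linarith

/-- If `δ ≤ ζ`, then `w₀ ≤ w₁`. -/
theorem sub_nonpos {D : SwitchData} {K₁ δ ζ α : ℝ} (X : D.Solved K₁ δ ζ α) (hδζ : δ ≤ ζ) {x : ℝ}
    (hx : 0 < x) : D.w₀ K₁ δ ζ α x - D.w₁ δ x ≤ 0 := by
  rcases le_total x ζ with h | h
  · rw [w₀_of_le h]
    linarith [X.neg_K_le_w₁ hx]
  rcases le_total x α with h' | h'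
  -- On [ζ, α] the difference decreases from its value at ζ, where w₀ = -K ≤ w₁.
  · have h1 := X.S.solY_le (m := D.m) (n := D.n) (c := D.r * K₁) X.α_pos X.T.hζ h fun t ht => by
      rcases ht.1.eq_or_lt with rfl | h2
      · exact X.solZ_nonneg_at_ζ hδζ
      · exact (X.solZ_pos_of_nonneg X.T.hζ h2 (ht.2.trans_le h') (X.solZ_nonneg_at_ζ hδζ)).le
    have h2 := X.sub_of_mem (hδζ.trans h) h h'
    have h3 := X.sub_of_mem hδζ le_rfl X.T.hζα.le
    rw [w₀_of_le le_rfl] at h3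
    have h4 := X.neg_K_le_w₁ X.T.hζ
    have h5 := mul_le_mul_of_nonneg_left h1 X.adm.C_pos.le
    linarith
  · rw [X.sub_of_ge h']
    linarith [X.K₁_pos]

/-- On [δ ∨ ζ, α], where `solZ` ≥ 0 the difference decreases to its value -K₁ at α. If ζ < δ and
`solZ` < 0, it has increased from δ, where it is nonnegative. If δ ≤ ζ, then to the left of ζ the
candidate w₀ is constant and w₁ increases, so ζ is the worst point there. -/
theorem neg_K₁_le_sub {D : SwitchData} {K₁ δ ζ α : ℝ} (X : D.Solved K₁ δ ζ α) {x : ℝ}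
    (hx : 0 < x) : -K₁ ≤ D.w₀ K₁ δ ζ α x - D.w₁ δ x := by
  have hK := X.K₁_pos
  rcases le_total α x with hα | hα
  · rw [X.sub_of_ge hα]
  rcases le_total x δ with hδ | hδ
  · rw [w₁_of_le hδ]
    linarith [X.neg_K_le_w₀ hx]
  have key : ∀ x, δ ≤ x → ζ ≤ x → x ≤ α → 0 ≤ solZ D.h D.m D.n (D.r * K₁) α x →
      -K₁ ≤ D.w₀ K₁ δ ζ α x - D.w₁ δ x := by
    intro x h1 h2 h3 h4
    rw [X.sub_of_mem h1 h2 h3]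
    have := mul_nonpos_of_nonneg_of_nonpos X.adm.C_pos.le
      (X.solY_nonpos (X.S.hδ.trans_le h1) h3 h4)
    linarith
  rcases le_or_gt δ ζ with hδζ | hζδ
  · have hZ := X.solZ_nonneg_at_ζ hδζ
    rcases le_total x ζ with h | h
    · have h1 := key ζ hδζ le_rfl X.T.hζα.le hZ
      have h2 := X.monotoneOn_w₁ hx X.T.hζ h
      rw [w₀_of_le le_rfl] at h1
      rw [w₀_of_le h]
      linarith
    · refine key x hδ h hα ?_
      rcases h.eq_or_lt with rfl | h
      · exact hZ
      rcases hα.eq_or_lt with rfl | hα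
      · rw [solZ_self]
      · exact (X.solZ_pos_of_nonneg X.T.hζ h hα hZ).le
  · rcases le_or_gt 0 (solZ D.h D.m D.n (D.r * K₁) α x) with h | h
    · exact key x hδ (hζδ.le.trans hδ) hα h
    · have h1 := X.S.solY_ge (m := D.m) (n := D.n) (c := D.r * K₁) X.α_pos X.S.hδ hδ
        fun t ht => by
          by_contra! hcon
          rcases hα.eq_or_lt with rfl | hα
          · rw [solZ_self] at h
            exact lt_irrefl _ h
          · exact lt_asymm h (X.solZ_pos_of_nonneg (X.S.hδ.trans_le ht.1) ht.2 hα hcon.le)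
      have h2 := X.sub_of_mem hδ (hζδ.le.trans hδ) hα
      have h3 := X.sub_of_mem le_rfl hζδ.le X.T.hδα.le
      rw [w₁_of_le le_rfl] at h3
      have h4 := X.neg_K_le_w₀ X.S.hδ
      have h5 := mul_le_mul_of_nonneg_left h1 X.adm.C_pos.le
      linarith

/-- The maximum of `w₀ - w₁` when `ζ < δ`. -/
theorem sub_le_turning {D : SwitchData} {K₁ δ ζ α : ℝ} (X : D.Solved K₁ δ ζ α) (hζδ : ζ < δ)
    {y : ℝ} (hy : y ∈ Ioo δ α) (h0 : solZ D.h D.m D.n (D.r * K₁) α y = 0)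
    (hneg : ∀ x, 0 < x → x < y → solZ D.h D.m D.n (D.r * K₁) α x < 0)
    (hpos : ∀ x, y < x → x < α → 0 < solZ D.h D.m D.n (D.r * K₁) α x)
    {x : ℝ} (hx : 0 < x) :
    D.w₀ K₁ δ ζ α x - D.w₁ δ x ≤ D.w₀ K₁ δ ζ α y - D.w₁ δ y := by
  have hy0 := X.S.hδ.trans hy.1
  have hy1 := X.sub_of_mem hy.1.le (hζδ.trans hy.1).le hy.2.le
  have key1 : ∀ x, δ ≤ x → x ≤ y →
      D.w₀ K₁ δ ζ α x - D.w₁ δ x ≤ D.w₀ K₁ δ ζ α y - D.w₁ δ y := by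
    intro x h1 h2
    have hx0 := X.S.hδ.trans_le h1
    rw [hy1, X.sub_of_mem h1 (hζδ.le.trans h1) (h2.trans hy.2.le)]
    have := X.S.solY_ge (m := D.m) (n := D.n) (c := D.r * K₁) X.α_pos hx0 h2
      fun t ht => (hneg t (hx0.trans_le ht.1) ht.2).le
    have := mul_le_mul_of_nonneg_left this X.adm.C_pos.le
    linarith
  rcases le_total x δ with h | h
  · refine le_trans ?_ (key1 δ le_rfl hy.1.le)
    have := X.monotoneOn_w₀ hx X.S.hδ h
    rw [w₁_of_le h, w₁_of_le le_rfl]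
    linarith
  rcases le_total x y with h' | h'
  · exact key1 x h h'
  rcases le_total x α with h2 | h2
  · rw [hy1, X.sub_of_mem h (hζδ.le.trans h) h2]
    have := X.S.solY_le (m := D.m) (n := D.n) (c := D.r * K₁) X.α_pos hy0 h' fun t ht => by
      rcases ht.1.eq_or_lt with rfl | h3
      · exact h0.ge
      · exact (hpos t h3 (ht.2.trans_le h2)).le
    have := mul_le_mul_of_nonneg_left this X.adm.C_pos.le
    linarith
  · rw [X.sub_of_ge h2]
    exact X.neg_K₁_le_sub hy0

/-! ### The HJB equation -/

theorem satisfiesHJB {D : SwitchData} {K₁ δ ζ α : ℝ} (X : D.Solved K₁ δ ζ α) {K₀ : ℝ}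
    (hd : ∀ x, 0 < x → D.w₀ K₁ δ ζ α x - D.w₁ δ x ≤ K₀) :
    D.SatisfiesHJB K₁ K₀ (D.w₁ δ) (D.w₀ K₁ δ ζ α) := by
  refine ⟨contDiffOn_one_of_hasDerivAt (fun x hx => X.hasDerivAt_w₁ hx) X.continuousOn_deriv_w₁,
    contDiffOn_one_of_hasDerivAt (fun x hx => X.hasDerivAt_w₀ hx) X.continuousOn_deriv_w₀,
    {δ, ζ, α}, fun x hx hF hc => ?_⟩
  simp only [Finset.mem_insert, Finset.mem_singleton, not_or] at hF
  obtain ⟨hxδ, hxζ, hxα⟩ := hF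
  have d1 := X.hasDerivAt_deriv_w₁ hx hxδ hc
  have d0 := X.hasDerivAt_deriv_w₀ hx hxζ hxα hc
  refine ⟨d1.differentiableAt, d0.differentiableAt, ?_, ?_⟩
  · have b1 := hd x hx
    have b2 := X.neg_K_le_w₁ hx
    rw [d1.deriv, (X.hasDerivAt_w₁ hx).deriv]
    rcases lt_or_gt_of_ne hxδ with h | h
    · rw [if_pos h.le, if_pos h.le]
      have e := w₁_of_le (D := D) h.le
      refine le_antisymm (max_le ?_ (max_le (by linarith) (by linarith)))
        (le_max_of_le_right (le_max_of_le_right (by linarith)))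
      -- In the stopping region the differential expression is h x + rK, negative since h x ≤ h δ <
      -- k.
      have h1 : D.h x ≤ D.h δ := X.S.mono hx X.S.hδ h.le
      have h2 := X.S.lt_at_δ
      rw [k] at h2
      rw [e]
      linarith
    · rw [if_neg (not_le.2 h), if_neg (not_le.2 h)]
      have e := X.w₁_of_ge h.le
      have h1 := X.adm.euler_eq D.h D.k δ hx
      have hk : D.k = -(D.r * D.K) := rfl
      have h2 : D.σ ^ 2 * x ^ 2 * (D.C * solY'' D.h D.m D.n D.k δ x) +
          D.b * x * (D.C * (solZ D.h D.m D.n D.k δ x / x)) - D.r * D.w₁ δ x + D.h x = 0 := by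
        rw [e]
        linear_combination h1 + hk
      rw [h2]
      exact le_antisymm (max_le le_rfl (max_le (by linarith) (by linarith))) (le_max_left _ _)
  · have b1 := X.neg_K₁_le_sub hx
    have b2 := X.neg_K_le_w₀ hx
    rw [d0.deriv, (X.hasDerivAt_w₀ hx).deriv]
    rcases lt_or_gt_of_ne hxζ with h | h
    · rw [if_pos h.le, if_pos h.le]
      have e := w₀_of_le (D := D) (K₁ := K₁) (δ := δ) (α := α) h.le
      refine le_antisymm (max_le ?_ (max_le (by linarith) (by linarith)))
        (le_max_of_le_right (le_max_of_le_right (by linarith)))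
      have h2 := X.S.hk
      rw [k] at h2
      rw [e]
      linarith
    rw [if_neg (not_le.2 h), if_neg (not_le.2 h)]
    have hk : D.k = -(D.r * D.K) := rfl
    rcases lt_or_gt_of_ne hxα with h' | h'
    · rw [if_pos h'.le, if_pos h'.le]
      have e := X.w₀_of_mem h.le h'.le
      have h1 := X.adm.euler_eq (fun _ => 0) D.k ζ hx
      have h2 : D.σ ^ 2 * x ^ 2 * (D.C * solY'' (fun _ => 0) D.m D.n D.k ζ x) +
          D.b * x * (D.C * (solZ (fun _ => 0) D.m D.n D.k ζ x / x)) -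
            D.r * D.w₀ K₁ δ ζ α x = 0 := by
        rw [e]
        linear_combination h1 + hk
      rw [h2]
      exact le_antisymm (max_le le_rfl (max_le (by linarith) (by linarith))) (le_max_left _ _)
    · rw [if_neg (not_le.2 h'), if_neg (not_le.2 h')]
      have e := X.w₀_of_ge h'.le
      have e2 := X.sub_of_ge h'.le
      have h1 := X.adm.euler_eq D.h D.k δ hx
      -- Beyond α, w₀ = w₁ - K₁ makes the differential expression rK₁ - h, so h must have passed rK₁
      -- before α.
      obtain ⟨z, hz, hzα, hzc⟩ := X.T.exists_lt X.S X.c_pos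
      have h3 : D.r * K₁ < D.h x :=
        hzc.trans_le (X.S.mono (X.S.hδ.trans hz) hx (hzα.trans h').le)
      refine le_antisymm (max_le ?_ (max_le (by linarith) (by linarith)))
        (le_max_of_le_right (le_max_of_le_left (by linarith)))
      rw [e]
      linarith

/-- The equation is available only at continuity points of h outside a finite set; these are dense
and the difference is continuous. -/
theorem sub_le_of_satisfiesHJB {D : SwitchData} {K₁ δ ζ α : ℝ} (X : D.Solved K₁ δ ζ α) {K₀ : ℝ}
    (hJ : D.SatisfiesHJB K₁ K₀ (D.w₁ δ) (D.w₀ K₁ δ ζ α)) {x : ℝ} (hx : 0 < x) :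
    D.w₀ K₁ δ ζ α x - D.w₁ δ x ≤ K₀ := by
  obtain ⟨-, -, F, hF⟩ := hJ
  by_contra! hcon
  have hc : ContinuousAt (fun x => D.w₀ K₁ δ ζ α x - D.w₁ δ x) x :=
    (X.hasDerivAt_w₀ hx).continuousAt.sub (X.hasDerivAt_w₁ hx).continuousAt
  obtain ⟨a, b, hab, hsub⟩ := mem_nhds_iff_exists_Ioo_subset.1
    ((hc.eventually_const_lt hcon).and (Ioi_mem_nhds hx))
  obtain ⟨y, hy, hyF, hyc⟩ := X.S.exists_continuousAt F (le_max_right a 0)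
    (max_lt (hab.1.trans hab.2) (hx.trans hab.2))
  have h1 := hsub ⟨(le_max_left a 0).trans_lt hy.1, hy.2⟩
  have h2 := (hF y h1.2 hyF hyc).2.2.1
  have h3 : D.w₀ K₁ δ ζ α y - D.w₁ δ y - K₀ ≤ 0 := by
    rw [← h2]
    exact le_max_of_le_right (le_max_left _ _)
  linarith [h1.1]

/-! ### The turning point -/

theorem deriv_sub_of_lt {D : SwitchData} {K₁ δ ζ α : ℝ} (X : D.Solved K₁ δ ζ α) {x : ℝ}
    (hx : ζ < x) (hxδ : x ≤ δ) :
    deriv (fun x => D.w₀ K₁ δ ζ α x - D.w₁ δ x) x =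
      D.C * (solZ (fun _ => 0) D.m D.n D.k ζ x / x) := by
  have hx0 := X.T.hζ.trans hx
  rw [((X.hasDerivAt_w₀ hx0).fun_sub (X.hasDerivAt_w₁ hx0)).deriv, if_neg (not_le.2 hx),
    if_pos (hxδ.trans X.T.hδα.le), if_pos hxδ, sub_zero]

theorem deriv_sub_of_gt {D : SwitchData} {K₁ δ ζ α : ℝ} (X : D.Solved K₁ δ ζ α) {x : ℝ}
    (hx : ζ < x) (hxδ : δ < x) (hxα : x ≤ α) :
    deriv (fun x => D.w₀ K₁ δ ζ α x - D.w₁ δ x) x =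
      -(D.C * (solZ D.h D.m D.n (D.r * K₁) α x / x)) := by
  have hx0 := X.T.hζ.trans hx
  rw [((X.hasDerivAt_w₀ hx0).fun_sub (X.hasDerivAt_w₁ hx0)).deriv, if_neg (not_le.2 hx),
    if_pos hxα, if_neg (not_le.2 hxδ)]
  have := X.T.solZ_eq X.S hx0
  rw [← mul_sub, ← sub_div, this]
  ring

end Solved

namespace Solved

theorem isXHat {D : SwitchData} {K₁ δ ζ α : ℝ} (X : D.Solved K₁ δ ζ α) (hζδ : ζ < δ)
    {y : ℝ} (hy : y ∈ Ioo δ α)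
    (hneg : ∀ x, 0 < x → x < y → solZ D.h D.m D.n (D.r * K₁) α x < 0)
    (hpos : ∀ x, y < x → x < α → 0 < solZ D.h D.m D.n (D.r * K₁) α x) :
    D.IsXHat K₁ δ ζ α y := by
  have hC := X.adm.C_pos
  refine ⟨hy, fun x hx => ?_, fun x hx => ?_⟩
  · have hx0 := X.T.hζ.trans hx.1
    rcases le_or_gt x δ with h | h
    · rw [X.deriv_sub_of_lt hx.1 h]
      exact mul_pos hC (div_pos (X.solZ_closed_pos hx.1) hx0)
    · rw [X.deriv_sub_of_gt hx.1 h (hx.2.trans hy.2).le]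
      have := mul_neg_of_pos_of_neg hC (div_neg_of_neg_of_pos (hneg x hx0 hx.2) hx0)
      linarith
  · have hδx := hy.1.trans hx.1
    have hx0 := X.S.hδ.trans hδx
    rw [X.deriv_sub_of_gt (hζδ.trans hδx) hδx hx.2.le]
    have := mul_pos hC (div_pos (hpos x hx.1 hx.2) hx0)
    linarith

end Solved

theorem IsXHat.unique {D : SwitchData} {K₁ δ ζ α y y' : ℝ} (hζδ : ζ < δ)
    (h : D.IsXHat K₁ δ ζ α y) (h' : D.IsXHat K₁ δ ζ α y') : y = y' := by
  have key : ∀ y y', D.IsXHat K₁ δ ζ α y → D.IsXHat K₁ δ ζ α y' → ¬ y < y' := by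
    intro y y' h h' hlt
    obtain ⟨x, hx, hx'⟩ := exists_between hlt
    exact lt_asymm (h'.2.1 x ⟨hζδ.trans (h.1.1.trans hx), hx'⟩)
      (h.2.2 x ⟨hx, hx'.trans h'.1.2⟩)
  exact le_antisymm (not_lt.1 (key _ _ h' h)) (not_lt.1 (key _ _ h h'))

namespace Solved

/-- At the turning point m y^m and n yⁿ times the two weighted integrals coincide, so `solY` is a
multiple of the second one alone. -/
theorem K₀Expr_eq {D : SwitchData} {K₁ δ ζ α : ℝ} (X : D.Solved K₁ δ ζ α) (hζδ : ζ < δ)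
    {y : ℝ} (hy : y ∈ Ioo δ α) (h0 : solZ D.h D.m D.n (D.r * K₁) α y = 0) :
    D.K₀Expr K₁ α y = D.w₀ K₁ δ ζ α y - D.w₁ δ y := by
  rw [X.sub_of_mem hy.1.le (hζδ.trans hy.1).le hy.2.le, K₀Expr, ← wint, IncRC.wint_symm]
  have h1 := X.adm.C_mul (D.n * y ^ D.n / D.r * wint D.h D.n (D.r * K₁) α y)
  have hr := X.adm.r_pos.ne'
  have hn := X.adm.n_pos.ne'
  have hm := X.adm.m_neg.ne
  have e : D.r * (D.n * y ^ D.n / D.r * wint D.h D.n (D.r * K₁) α y) * (1 / D.n - 1 / D.m) =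
      -solY D.h D.m D.n (D.r * K₁) α y := by
    rw [solZ] at h0
    rw [solY]
    field_simp
    linear_combination h0
  rw [e] at h1
  linear_combination -h1

/-- The difference is nonnegative at δ, where w₁ = -K, and increases strictly up to y. -/
theorem turning_pos {D : SwitchData} {K₁ δ ζ α : ℝ} (X : D.Solved K₁ δ ζ α) (hζδ : ζ < δ)
    {y : ℝ} (hy : y ∈ Ioo δ α)
    (hneg : ∀ x, 0 < x → x < y → solZ D.h D.m D.n (D.r * K₁) α x < 0) :
    0 < D.w₀ K₁ δ ζ α y - D.w₁ δ y := by
  have hlt := lt_of_rightDeriv_pos (f := fun x => -solY D.h D.m D.n (D.r * K₁) α x) hy.1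
    ((X.S.continuousOn_solY D.m D.n (D.r * K₁) X.α_pos).neg.mono fun _ hz => X.S.hδ.trans_le hz.1)
    (fun _ ht => (X.S.hasDerivAt_solY D.m D.n (D.r * K₁) X.α_pos
      (X.S.hδ.trans_le ht.1)).neg.hasDerivWithinAt)
    fun t ht => by
      have ht0 := X.S.hδ.trans_le ht.1
      rw [neg_pos]
      exact div_neg_of_neg_of_pos (hneg t ht0 ht.2) ht0
  have h2 := X.sub_of_mem hy.1.le (hζδ.trans hy.1).le hy.2.le
  have h3 := X.sub_of_mem le_rfl hζδ.le X.T.hδα.le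
  rw [w₁_of_le le_rfl] at h3
  have h4 := X.neg_K_le_w₀ X.S.hδ
  have h5 := mul_lt_mul_of_pos_left hlt X.adm.C_pos
  linarith

/-- A bound for the maximum of `w₀ - w₁` in terms of the distance to the critical level. -/
theorem turning_le {D : SwitchData} {K₁ δ ζ α K₁' α' : ℝ} (X : D.Solved K₁ δ ζ α)
    (X' : D.Solved K₁' δ δ α') (hK : K₁ < K₁') (hζδ : ζ < δ) {y : ℝ} (hy : y ∈ Ioo δ α) :
    D.w₀ K₁ δ ζ α y - D.w₁ δ y ≤
      D.C * (D.k * (α' ^ D.n * ((ζ ^ (-D.n) - δ ^ (-D.n)) / D.n))) := by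
  have hc : D.r * K₁ < D.r * K₁' := mul_lt_mul_of_pos_left hK X.adm.r_pos
  have hα := (X.S.sol_mono X.c_pos hc X.T X'.T).2
  have hy0 := X.S.hδ.trans hy.1
  have hm := X.adm.m_neg.ne
  have hn := X.adm.n_pos.ne'
  -- At the critical level w₀ ≤ w₁, with the same w₁. It remains to compare the closed candidates
  -- based at ζ and δ: their x^m contribution has a favourable sign and is dropped, and y < α'
  -- bounds the other.
  have h1 := X'.sub_nonpos le_rfl hy0
  rw [X'.w₀_of_mem hy.1.le (hy.2.trans hα).le] at h1
  rw [X.w₀_of_mem (hζδ.trans hy.1).le hy.2.le]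
  have e : ∀ p : ℝ, p ≠ 0 → kp p ζ y - kp p δ y = kp p ζ δ := fun p hp => by
    simp only [kp]; field_simp; ring
  have e1 : solY (fun _ => 0) D.m D.n D.k ζ y - solY (fun _ => 0) D.m D.n D.k δ y =
      D.k * (y ^ D.n * kp D.n ζ δ) - D.k * (y ^ D.m * kp D.m ζ δ) := by
    simp only [solY]
    rw [wint_zero hm D.k X.T.hζ hy0, wint_zero hn D.k X.T.hζ hy0, wint_zero hm D.k X.S.hδ hy0,
      wint_zero hn D.k X.S.hδ hy0, ← e _ hm, ← e _ hn]
    ring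
  have h2 : 0 ≤ D.k * (y ^ D.m * kp D.m ζ δ) :=
    mul_nonneg X.S.hk.le (mul_nonneg (Real.rpow_pos_of_pos hy0 _).le
      (kp_nonneg hm X.T.hζ hζδ.le))
  have e2 : kp D.n ζ δ = (ζ ^ (-D.n) - δ ^ (-D.n)) / D.n := by
    rw [kp, ← neg_div_neg_eq]
    congr 1 <;> ring
  have h3 : D.k * (y ^ D.n * kp D.n ζ δ) ≤ D.k * (α' ^ D.n * kp D.n ζ δ) := by
    have h4 : y ^ D.n ≤ α' ^ D.n :=
      Real.rpow_le_rpow hy0.le (hy.2.trans hα).le X.adm.n_pos.le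
    have h5 := kp_nonneg hn X.T.hζ hζδ.le
    have := X.S.hk
    gcongr
  rw [← e2]
  have h6 : solY (fun _ => 0) D.m D.n D.k ζ y - solY (fun _ => 0) D.m D.n D.k δ y ≤
      D.k * (α' ^ D.n * kp D.n ζ δ) := by linarith
  have h7 := mul_le_mul_of_nonneg_left h6 X.adm.C_pos.le
  linarith

/-- With h replaced by -rK₀ the expression becomes K₀ - (K₀ + K₁) yⁿ α^{-n}. -/
theorem K₀Expr_le {D : SwitchData} {K₁ δ ζ α : ℝ} (X : D.Solved K₁ δ ζ α) {y K₀ : ℝ}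
    (hK₀ : 0 < K₀) (hy : y ∈ Ioo δ α) (hh : ∀ x, 0 < x → -(D.r * K₀) ≤ D.h x) :
    D.K₀Expr K₁ α y ≤ K₀ := by
  have hy0 := X.S.hδ.trans hy.1
  have hr := X.adm.r_pos
  have hn := X.adm.n_pos
  have h1 := X.S.le_wint hn.ne' (D.r * K₁) (-(D.r * K₀)) hy0 hy.2.le
    fun s hs => hh s (hy0.trans hs.1)
  have e : D.n * y ^ D.n * kp D.n y α = 1 - y ^ D.n * α ^ (-D.n) := by
    rw [kp]
    field_simp
    linear_combination rpow_mul_rpow_neg D.n hy0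
  have h2 := mul_le_mul_of_nonneg_left h1
    (div_pos (mul_pos hn (Real.rpow_pos_of_pos hy0 D.n)) hr).le
  have e2 : D.n * y ^ D.n / D.r * ((-(D.r * K₀) - D.r * K₁) * kp D.n y α) =
      -(K₀ + K₁) * (1 - y ^ D.n * α ^ (-D.n)) := by
    rw [← e]
    field_simp
    ring
  have h3 : 0 < y ^ D.n * α ^ (-D.n) :=
    mul_pos (Real.rpow_pos_of_pos hy0 _) (Real.rpow_pos_of_pos X.α_pos _)
  have h4 := mul_pos (add_pos hK₀ X.K₁_pos) h3
  rw [K₀Expr, ← wint]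
  rw [e2] at h2
  linarith

end Solved

/-! ### Solvability, necessity of K < 0, and the two thresholds -/

namespace Admissible

theorem solved {D : SwitchData} (H : D.Admissible) (hK : D.K < 0) {K₁ δ ζ α : ℝ} (hK₁ : 0 < K₁)
    (F : D.FreeBoundary K₁ δ ζ α) : D.Solved K₁ δ ζ α := by
  obtain ⟨hδ, hd, T⟩ := (H.freeBoundary_iff K₁ δ ζ α).1 F
  exact ⟨H, hK, hK₁, H.fbSetup hK hδ hd, T⟩

theorem exists_freeBoundary {D : SwitchData} (H : D.Admissible) (hK : D.K < 0) {δ : ℝ}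
    (hδ : 0 < δ) (hd : D.DeltaEq δ) {K₁ : ℝ} (hK₁ : 0 < K₁) :
    ∃ ζ α, D.FreeBoundary K₁ δ ζ α := by
  obtain ⟨ζ, α, T⟩ := (H.fbSetup hK hδ hd).exists_sol (mul_pos H.r_pos hK₁)
  exact ⟨ζ, α, (H.freeBoundary_iff _ _ _ _).2 ⟨hδ, hd, T⟩⟩

theorem freeBoundary_unique {D : SwitchData} (H : D.Admissible) (hK : D.K < 0) {δ ζ α δ' ζ' α' : ℝ}
    {K₁ : ℝ} (hK₁ : 0 < K₁) (F : D.FreeBoundary K₁ δ ζ α) (F' : D.FreeBoundary K₁ δ' ζ' α') :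
    δ = δ' ∧ ζ = ζ' ∧ α = α' := by
  obtain ⟨hδ, hd, T⟩ := (H.freeBoundary_iff _ _ _ _).1 F
  obtain ⟨hδ', hd', T'⟩ := (H.freeBoundary_iff _ _ _ _).1 F'
  obtain rfl := H.deltaEq_unique hδ hδ' hd hd'
  exact ⟨rfl, (H.fbSetup hK hδ hd).sol_unique (mul_pos H.r_pos hK₁) T T'⟩

theorem existsUnique_freeBoundary {D : SwitchData} (H : D.Admissible) (hK : D.K < 0) {δ : ℝ}
    (hδ : 0 < δ) (hd : D.DeltaEq δ) {K₁ : ℝ} (hK₁ : 0 < K₁) :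
    ∃! p : ℝ × ℝ × ℝ, D.FreeBoundary K₁ p.1 p.2.1 p.2.2 := by
  obtain ⟨ζ, α, F⟩ := H.exists_freeBoundary hK hδ hd hK₁
  refine ⟨(δ, ζ, α), F, fun p hp => ?_⟩
  obtain ⟨h1, h2, h3⟩ := H.freeBoundary_unique hK hK₁ hp F
  exact Prod.ext h1 (Prod.ext h2 h3)

/-- The necessity of `K < 0`. -/
theorem K_neg_of_hjb {D : SwitchData} (H : D.Admissible) {K₁ K₀ : ℝ}
    (hu : ∃! p : ℝ × ℝ × ℝ, D.FreeBoundary K₁ p.1 p.2.1 p.2.2)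
    (hJ : ∀ δ ζ α, D.FreeBoundary K₁ δ ζ α →
      D.SatisfiesHJB K₁ K₀ (D.w₁ δ) (D.w₀ K₁ δ ζ α)) : D.K < 0 := by
  obtain ⟨⟨δ, ζ, α⟩, F, huniq⟩ := hu
  have F : D.FreeBoundary K₁ δ ζ α := F
  have hζ : 0 < ζ := F.pos.trans_le (min_le_right _ _)
  by_contra! hK
  rcases hK.eq_or_lt with hK | hK
  -- For K = 0 the terms with ζ vanish, so halving ζ gives a second solution.
  · have F' : D.FreeBoundary K₁ δ (ζ / 2) α := by
      refine ⟨lt_min (F.pos.trans_le (min_le_left _ _)) (by linarith),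
        max_lt ((le_max_left _ _).trans_lt F.lt)
          (lt_of_le_of_lt (by linarith) ((le_max_right δ ζ).trans_lt F.lt)), F.eq_delta, ?_, ?_⟩
      · have := F.eq₁
        simpa [G₁, ← hK] using this
      · have := F.eq₂
        simpa [G₂, ← hK] using this
    have h1 := huniq (δ, ζ / 2, α) F'
    have h2 : ζ / 2 = ζ := congrArg (fun p : ℝ × ℝ × ℝ => p.2.1) h1
    linarith
  -- For K > 0, w₀ = -K on ]0, ζ[ makes the closed-mode differential expression rK > 0.
  · obtain ⟨-, -, E, hE⟩ := hJ δ ζ α F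
    obtain ⟨y, hy, hyE, hyc⟩ := H.inc.exists_continuousAt E le_rfl hζ
    have h1 := (hE y hy.1 hyE hyc).2.2.2
    have hev : D.w₀ K₁ δ ζ α =ᶠ[𝓝 y] fun _ => -D.K := by
      filter_upwards [Iio_mem_nhds hy.2] with z hz using if_pos (le_of_lt hz)
    have hd1 : deriv (D.w₀ K₁ δ ζ α) y = 0 := by rw [hev.deriv_eq]; simp
    have hd2 : deriv (deriv (D.w₀ K₁ δ ζ α)) y = 0 := by rw [hev.deriv.deriv_eq]; simp
    rw [hd1, hd2, hev.eq_of_nhds] at h1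
    have h2 : D.σ ^ 2 * y ^ 2 * 0 + D.b * y * 0 - D.r * -D.K ≤ 0 := by
      conv_rhs => rw [← h1]
      exact le_max_left _ _
    have h3 := mul_pos H.r_pos hK
    linarith

theorem h0_lt_of_deltaEq {D : SwitchData} (H : D.Admissible) {δ : ℝ} (hδ : 0 < δ)
    (hd : D.DeltaEq δ) : D.h0 < ((-(D.r * D.K) : ℝ) : EReal) :=
  (H.h0_lt_iff _).2 ⟨δ, hδ, H.lt_of_deltaEq hδ hd⟩

/-- The constants `A`, `Δ₁`, `Δ₂`. -/
theorem constants {D : SwitchData} (H : D.Admissible) {K₁ δ ζ α : ℝ} (X : D.Solved K₁ δ ζ α) :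
    0 < D.A δ ∧ 0 < D.Δ₁ K₁ δ α ∧ 0 < D.Δ₂ K₁ α ∧
      D.Δ₁ K₁ δ α = D.r * D.K * ζ ^ (-D.m) / (D.σ ^ 2 * D.m * (D.n - D.m)) ∧
      D.Δ₂ K₁ α = -(D.r * D.K * ζ ^ (-D.n) / (D.σ ^ 2 * D.n * (D.n - D.m))) := by
  have hm := H.m_neg
  have hn := H.n_pos
  have hd : D.n - D.m ≠ 0 := by linarith
  have hσ := H.σ_ne
  refine ⟨X.A_pos, ?_, ?_, ?_, ?_⟩
  · rw [X.Δ₁_eq, neg_pos]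
    refine mul_neg_of_pos_of_neg H.C_pos (mul_neg_of_neg_of_pos
      (mul_neg_of_pos_of_neg X.S.hk (one_div_neg.2 hm)) (Real.rpow_pos_of_pos X.T.hζ _))
  · rw [X.Δ₂_eq]
    exact mul_pos H.C_pos (mul_pos (mul_pos X.S.hk (one_div_pos.2 hn))
      (Real.rpow_pos_of_pos X.T.hζ _))
  · rw [X.Δ₁_eq, C, k]
    have := hm.ne
    field_simp
  · rw [X.Δ₂_eq, C, k]
    field_simp

/-- The threshold `K₁^†`, with the point `α` that belongs to it. -/
theorem exists_critical {D : SwitchData} (H : D.Admissible) (hK : D.K < 0) {δ : ℝ} (hδ : 0 < δ)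
    (hd : D.DeltaEq δ) (hneg : D.h δ < 0) :
    ∃ K₁ α, 0 < K₁ ∧ D.Solved K₁ δ δ α := by
  have S := H.fbSetup hK hδ hd
  obtain ⟨c, α, hc, T⟩ := S.exists_sol_eq hneg
  have hr := H.r_pos
  refine ⟨c / D.r, α, div_pos hc hr, H, hK, div_pos hc hr, S, ?_⟩
  rwa [mul_div_cancel₀ _ hr.ne']

theorem isK₁Dagger {D : SwitchData} (H : D.Admissible) (hK : D.K < 0) {δ K₁d αd : ℝ}
    (X : D.Solved K₁d δ δ αd) : D.IsK₁Dagger δ K₁d := by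
  refine ⟨X.K₁_pos, fun K₁ ζ α hK₁ F => ⟨fun hlt => ?_, fun hlt => ?_⟩⟩
  · have Y := H.solved hK hK₁ F
    exact (X.S.sol_mono Y.c_pos (mul_lt_mul_of_pos_left hlt H.r_pos) Y.T X.T).1
  · have Y := H.solved hK hK₁ F
    exact (X.S.sol_mono X.c_pos (mul_lt_mul_of_pos_left hlt H.r_pos) X.T Y.T).1

/-- A switching cost strictly between two thresholds would order ζ and δ both ways. -/
theorem isK₁Dagger_unique {D : SwitchData} (H : D.Admissible) (hK : D.K < 0) {δ : ℝ} (hδ : 0 < δ)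
    (hd : D.DeltaEq δ) {k₁ k₂ : ℝ} (hk₁ : D.IsK₁Dagger δ k₁) (hk₂ : D.IsK₁Dagger δ k₂) :
    k₁ = k₂ := by
  have key : ∀ k₁ k₂, D.IsK₁Dagger δ k₁ → D.IsK₁Dagger δ k₂ → ¬ k₁ < k₂ := by
    intro k₁ k₂ hk₁ hk₂ hlt
    obtain ⟨K₁, h1, h2⟩ := exists_between hlt
    have hK₁ := hk₁.1.trans h1
    obtain ⟨ζ, α, F⟩ := H.exists_freeBoundary hK hδ hd hK₁
    exact lt_asymm ((hk₁.2 K₁ ζ α hK₁ F).2 h1) ((hk₂.2 K₁ ζ α hK₁ F).1 h2)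
  exact le_antisymm (not_lt.1 (key _ _ hk₂ hk₁)) (not_lt.1 (key _ _ hk₁ hk₂))

/-- The threshold `K₀^†(K₁)` is the maximum of `w₀ - w₁`. -/
theorem exists_K₀Dagger {D : SwitchData} (H : D.Admissible) (hK : D.K < 0) {δ K₁d αd : ℝ}
    (hδ : 0 < δ) (hd : D.DeltaEq δ) (X' : D.Solved K₁d δ δ αd) {K₁ : ℝ} (hK₁ : 0 < K₁)
    (hlt : K₁ < K₁d) :
    ∃ v, 0 < v ∧ ∀ ζ α, D.FreeBoundary K₁ δ ζ α →
      (∃ y, D.IsXHat K₁ δ ζ α y ∧ (∀ y', D.IsXHat K₁ δ ζ α y' → y' = y) ∧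
        v = D.K₀Expr K₁ α y ∧ v = D.w₀ K₁ δ ζ α y - D.w₁ δ y) ∧
      (∀ x, 0 < x → D.w₀ K₁ δ ζ α x - D.w₁ δ x ≤ v) ∧
      v ≤ D.C * (D.k * (αd ^ D.n * ((ζ ^ (-D.n) - δ ^ (-D.n)) / D.n))) := by
  obtain ⟨ζ, α, F⟩ := H.exists_freeBoundary hK hδ hd hK₁
  have X := H.solved hK hK₁ F
  have hζδ : ζ < δ := ((H.isK₁Dagger hK X').2 K₁ ζ α hK₁ F).1 hlt
  obtain ⟨y, hy, h0, hneg, hpos⟩ := X.exists_turning hζδ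
  have hX := X.isXHat hζδ hy hneg hpos
  refine ⟨D.w₀ K₁ δ ζ α y - D.w₁ δ y, X.turning_pos hζδ hy hneg, fun ζ' α' F' => ?_⟩
  obtain ⟨-, rfl, rfl⟩ := H.freeBoundary_unique hK hK₁ F F'
  exact ⟨⟨y, hX, fun y' hy' => hy'.unique hζδ hX, (X.K₀Expr_eq hζδ hy h0).symm, rfl⟩,
    fun x hx => X.sub_le_turning hζδ hy h0 hneg hpos hx, X.turning_le X' hlt hζδ hy⟩

theorem tendsto_K₀Dagger {D : SwitchData} (H : D.Admissible) {δ K₁d αd : ℝ}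
    (hδ : 0 < δ) (hd : D.DeltaEq δ) (X' : D.Solved K₁d δ δ αd) {v : ℝ → ℝ}
    (hpos : ∀ K₁, 0 < K₁ → K₁ < K₁d → 0 < v K₁)
    (hle : ∀ K₁, 0 < K₁ → K₁ < K₁d → ∀ ζ α, D.FreeBoundary K₁ δ ζ α →
      v K₁ ≤ D.C * (D.k * (αd ^ D.n * ((ζ ^ (-D.n) - δ ^ (-D.n)) / D.n)))) :
    Tendsto v (𝓝[<] K₁d) (𝓝 0) := by
  have hr := H.r_pos
  have hex : ∀ c, ∃ p : ℝ × ℝ, 0 < c → FBSol D.h D.m D.n D.k δ c p.1 p.2 := fun c => by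
    by_cases hc : 0 < c
    · obtain ⟨ζ, α, T⟩ := X'.S.exists_sol hc
      exact ⟨(ζ, α), fun _ => T⟩
    · exact ⟨(0, 0), fun h => absurd h hc⟩
  choose p hp using hex
  have hlim := X'.S.tendsto_sol X'.c_pos X'.T (z := fun c => (p c).1) (a := fun c => (p c).2)
    fun c hc => hp c hc.1
  have hmul : Tendsto (fun K₁ => D.r * K₁) (𝓝[<] K₁d) (𝓝[<] (D.r * K₁d)) := by
    refine tendsto_nhdsWithin_iff.2 ⟨?_, ?_⟩
    · exact ((continuous_const_mul D.r).tendsto K₁d).mono_left nhdsWithin_le_nhds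
    · filter_upwards [self_mem_nhdsWithin] with x hx using mul_lt_mul_of_pos_left hx hr
  have hlim2 : Tendsto (fun K₁ => D.C * (D.k * (αd ^ D.n *
      (((p (D.r * K₁)).1 ^ (-D.n) - δ ^ (-D.n)) / D.n)))) (𝓝[<] K₁d) (𝓝 0) := by
    have := ((((hlim.comp hmul).sub_const (δ ^ (-D.n))).div_const D.n).const_mul
      (αd ^ D.n)).const_mul D.k |>.const_mul D.C
    simpa using this
  have hmem : ∀ᶠ K₁ in 𝓝[<] K₁d, K₁ ∈ Ioo 0 K₁d := Ioo_mem_nhdsLT X'.K₁_pos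
  refine tendsto_of_tendsto_of_tendsto_of_le_of_le' tendsto_const_nhds hlim2 ?_ ?_
  · filter_upwards [hmem] with K₁ h using (hpos K₁ h.1 h.2).le
  · filter_upwards [hmem] with K₁ h
    exact hle K₁ h.1 h.2 _ _ ((H.freeBoundary_iff _ _ _ _).2
      ⟨hδ, hd, hp _ (mul_pos hr h.1)⟩)

end Admissible

end SwitchData

end

/-! ### Assembly of the cases -/

theorem mainTheorem8 {Ω : Type*} [MeasurableSpace Ω] (P : Measure Ω) [IsProbabilityMeasure P]
    (W : ℝ≥0 → Ω → ℝ) (hW : IsBrownianReal W P)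
    (D : SwitchData) (hr : 0 < D.r) (hσ : D.σ ≠ 0) (hh : D.PayoffAssumption P W) :
    ∃ (δd K₁d : ℝ) (K₀d : ℝ → ℝ),
      -- `δd` is the unique positive solution of its equation
      (D.h0 < ((-(D.r * D.K) : ℝ) : EReal) →
        0 < δd ∧ D.DeltaEq δd ∧ ∀ δ, 0 < δ → D.DeltaEq δ → δ = δd) ∧
      -- the characterisation of the case
      (∀ K₁ K₀ : ℝ, 0 < K₁ → 0 < K₀ →
        (((∃! p : ℝ × ℝ × ℝ, D.FreeBoundary K₁ p.1 p.2.1 p.2.2) ∧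
            ∀ δ ζ α, D.FreeBoundary K₁ δ ζ α →
              MonotoneOn (D.w₁ δ) (Ioi 0) ∧ MonotoneOn (D.w₀ K₁ δ ζ α) (Ioi 0) ∧
              D.SatisfiesHJB K₁ K₀ (D.w₁ δ) (D.w₀ K₁ δ ζ α)) ↔
          (D.K < 0 ∧ D.h0 < ((-(D.r * D.K) : ℝ) : EReal) ∧
            (((-(D.r * K₀) : ℝ) : EReal) ≤ D.h0 ∨
              (D.h0 < ((-(D.r * K₀) : ℝ) : EReal) ∧ 0 ≤ D.h δd) ∨
              (D.h0 < ((-(D.r * K₀) : ℝ) : EReal) ∧ D.h δd < 0 ∧ K₁d ≤ K₁) ∨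
              (D.h0 < ((-(D.r * K₀) : ℝ) : EReal) ∧ D.h δd < 0 ∧ K₁ < K₁d ∧ K₀d K₁ ≤ K₀))))) ∧
      (D.K < 0 → D.h0 < ((-(D.r * D.K) : ℝ) : EReal) →
        -- solvability of the system, and the constants `A`, `Δ₁`, `Δ₂`
        (∀ K₁ : ℝ, 0 < K₁ →
          (∃! p : ℝ × ℝ × ℝ, D.FreeBoundary K₁ p.1 p.2.1 p.2.2) ∧
          ∀ δ ζ α, D.FreeBoundary K₁ δ ζ α →
            δ = δd ∧ 0 < D.A δ ∧ 0 < D.Δ₁ K₁ δ α ∧ 0 < D.Δ₂ K₁ α ∧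
            D.Δ₁ K₁ δ α = D.r * D.K * ζ ^ (-D.m) / (D.σ ^ 2 * D.m * (D.n - D.m)) ∧
            D.Δ₂ K₁ α = -(D.r * D.K * ζ ^ (-D.n) / (D.σ ^ 2 * D.n * (D.n - D.m)))) ∧
        -- the thresholds
        (D.h δd < 0 →
          D.IsK₁Dagger δd K₁d ∧ (∀ k, D.IsK₁Dagger δd k → k = K₁d) ∧
          (∀ K₁ ∈ Ioo 0 K₁d, 0 < K₀d K₁ ∧
            ∀ ζ α, D.FreeBoundary K₁ δd ζ α →
              ∃ y, D.IsXHat K₁ δd ζ α y ∧ (∀ y', D.IsXHat K₁ δd ζ α y' → y' = y) ∧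
                K₀d K₁ = D.K₀Expr K₁ α y) ∧
          Tendsto K₀d (𝓝[<] K₁d) (𝓝 0)) ∧
        -- the ordering of `ζ` and `δ`
        (∀ K₁ ζ α : ℝ, 0 < K₁ → D.FreeBoundary K₁ δd ζ α →
          (D.h δd < 0 ∧ K₁ < K₁d → 0 < ζ ∧ ζ < δd) ∧
          (D.h δd < 0 ∧ K₁ = K₁d → 0 < ζ ∧ ζ = δd) ∧
          (0 ≤ D.h δd ∨ (D.h δd < 0 ∧ K₁d < K₁) → 0 < δd ∧ δd < ζ))) := by
  have H := hh.admissible hW hr hσ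
  have part : ∀ K₁ δ ζ α, D.FreeBoundary K₁ δ ζ α → 0 < δ ∧ D.DeltaEq δ := fun K₁ δ ζ α F =>
    ⟨F.pos.trans_le (min_le_left _ _), F.eq_delta⟩
  by_cases h0 : D.h0 < ((-(D.r * D.K) : ℝ) : EReal)
  swap
  -- The witnesses are arbitrary here: any solution δ of (1) would give h(0) < -rK, so both sides of
  -- the equivalence fail.
  · refine ⟨0, 0, fun _ => 0, fun h => absurd h h0, fun K₁ K₀ hK₁ hK₀ => ?_,
      fun _ h => absurd h h0⟩
    refine ⟨fun h => ?_, fun h => absurd h.2.1 h0⟩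
    obtain ⟨⟨p, F, -⟩, -⟩ := h
    obtain ⟨hδ, hd⟩ := part _ _ _ _ F
    exact absurd (H.h0_lt_of_deltaEq hδ hd) h0
  obtain ⟨x₁, hx₁, hlt⟩ := (H.h0_lt_iff _).1 h0
  obtain ⟨δd, hδ, hd⟩ := H.exists_deltaEq hx₁ hlt
  have huniq : ∀ δ, 0 < δ → D.DeltaEq δ → δ = δd := fun δ h1 h2 =>
    H.deltaEq_unique h1 hδ h2 hd
  by_cases hK : D.K < 0
  swap
  · refine ⟨δd, 0, fun _ => 0, fun _ => ⟨hδ, hd, huniq⟩, fun K₁ K₀ hK₁ hK₀ => ?_,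
      fun h => absurd h hK⟩
    exact ⟨fun h => absurd (H.K_neg_of_hjb h.1 fun δ ζ α F => (h.2 δ ζ α F).2.2) hK,
      fun h => absurd h.1 hK⟩
  have hsolv : ∀ K₁ : ℝ, 0 < K₁ →
      (∃! p : ℝ × ℝ × ℝ, D.FreeBoundary K₁ p.1 p.2.1 p.2.2) ∧
      ∀ δ ζ α, D.FreeBoundary K₁ δ ζ α →
        δ = δd ∧ 0 < D.A δ ∧ 0 < D.Δ₁ K₁ δ α ∧ 0 < D.Δ₂ K₁ α ∧
        D.Δ₁ K₁ δ α = D.r * D.K * ζ ^ (-D.m) / (D.σ ^ 2 * D.m * (D.n - D.m)) ∧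
        D.Δ₂ K₁ α = -(D.r * D.K * ζ ^ (-D.n) / (D.σ ^ 2 * D.n * (D.n - D.m))) :=
    fun K₁ hK₁ => ⟨H.existsUnique_freeBoundary hK hδ hd hK₁, fun δ ζ α F =>
      ⟨huniq δ (part _ _ _ _ F).1 (part _ _ _ _ F).2, H.constants (H.solved hK hK₁ F)⟩⟩
  -- the HJB equation reduces to a bound on `w₀ - w₁`
  have hiff : ∀ K₁ K₀ : ℝ, 0 < K₁ →
      (((∃! p : ℝ × ℝ × ℝ, D.FreeBoundary K₁ p.1 p.2.1 p.2.2) ∧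
        ∀ δ ζ α, D.FreeBoundary K₁ δ ζ α →
          MonotoneOn (D.w₁ δ) (Ioi 0) ∧ MonotoneOn (D.w₀ K₁ δ ζ α) (Ioi 0) ∧
          D.SatisfiesHJB K₁ K₀ (D.w₁ δ) (D.w₀ K₁ δ ζ α)) ↔
      ∀ ζ α, D.FreeBoundary K₁ δd ζ α →
        ∀ x, 0 < x → D.w₀ K₁ δd ζ α x - D.w₁ δd x ≤ K₀) := by
    intro K₁ K₀ hK₁
    refine ⟨fun h ζ α F x hx => (H.solved hK hK₁ F).sub_le_of_satisfiesHJB (h.2 _ _ _ F).2.2 hx,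
      fun h => ⟨(hsolv K₁ hK₁).1, fun δ ζ α F => ?_⟩⟩
    obtain rfl := ((hsolv K₁ hK₁).2 δ ζ α F).1
    have X := H.solved hK hK₁ F
    exact ⟨X.monotoneOn_w₁, X.monotoneOn_w₀, X.satisfiesHJB (h ζ α F)⟩
  rcases le_or_gt 0 (D.h δd) with hpos | hneg
  · have hord : ∀ K₁ ζ α, 0 < K₁ → D.FreeBoundary K₁ δd ζ α → δd < ζ := fun K₁ ζ α hK₁ F => by
      have X := H.solved hK hK₁ F
      exact X.S.lt_of_nonneg X.c_pos hpos X.T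
    -- With h(δ) ≥ 0 the thresholds play no role and 0 stands in for them.
    refine ⟨δd, 0, fun _ => 0, fun _ => ⟨hδ, hd, huniq⟩, fun K₁ K₀ hK₁ hK₀ => ?_, fun _ _ =>
      ⟨hsolv, fun h => absurd h (not_lt.2 hpos), fun K₁ ζ α hK₁ F => ?_⟩⟩
    · rw [hiff K₁ K₀ hK₁]
      refine ⟨fun _ => ⟨hK, h0, ?_⟩, fun _ ζ α F x hx => ?_⟩
      · rcases le_or_gt ((-(D.r * K₀) : ℝ) : EReal) D.h0 with h | h
        · exact Or.inl h
        · exact Or.inr (Or.inl ⟨h, hpos⟩)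
      · exact ((H.solved hK hK₁ F).sub_nonpos (hord K₁ ζ α hK₁ F).le hx).trans hK₀.le
    · exact ⟨fun h => absurd h.1 (not_lt.2 hpos), fun h => absurd h.1 (not_lt.2 hpos),
        fun _ => ⟨hδ, hord K₁ ζ α hK₁ F⟩⟩
  obtain ⟨K₁d, αd, hK₁d, X'⟩ := H.exists_critical hK hδ hd hneg
  have hdag := H.isK₁Dagger hK X'
  have hcrit : ∀ ζ α, D.FreeBoundary K₁d δd ζ α → ζ = δd := fun ζ α F =>
    (X'.S.sol_unique X'.c_pos (H.solved hK hK₁d F).T X'.T).1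
  -- The threshold is made a total function of K₁, with the value 0 outside ]0, K₁†[.
  have hex : ∀ K₁, ∃ v, 0 < K₁ → K₁ < K₁d → 0 < v ∧ ∀ ζ α, D.FreeBoundary K₁ δd ζ α →
      (∃ y, D.IsXHat K₁ δd ζ α y ∧ (∀ y', D.IsXHat K₁ δd ζ α y' → y' = y) ∧
        v = D.K₀Expr K₁ α y ∧ v = D.w₀ K₁ δd ζ α y - D.w₁ δd y) ∧
      (∀ x, 0 < x → D.w₀ K₁ δd ζ α x - D.w₁ δd x ≤ v) ∧
      v ≤ D.C * (D.k * (αd ^ D.n * ((ζ ^ (-D.n) - δd ^ (-D.n)) / D.n))) := fun K₁ => by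
    by_cases h : 0 < K₁ ∧ K₁ < K₁d
    · obtain ⟨v, hv⟩ := H.exists_K₀Dagger hK hδ hd X' h.1 h.2
      exact ⟨v, fun _ _ => hv⟩
    · exact ⟨0, fun h1 h2 => absurd ⟨h1, h2⟩ h⟩
  choose K₀d hK₀d using hex
  refine ⟨δd, K₁d, K₀d, fun _ => ⟨hδ, hd, huniq⟩, fun K₁ K₀ hK₁ hK₀ => ?_, fun _ _ =>
    ⟨hsolv, fun _ => ⟨hdag, fun k h => H.isK₁Dagger_unique hK hδ hd h hdag, fun K₁ h => ?_, ?_⟩,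
      fun K₁ ζ α hK₁ F => ?_⟩⟩
  · rw [hiff K₁ K₀ hK₁]
    constructor
    · intro hle
      refine ⟨hK, h0, ?_⟩
      rcases le_or_gt ((-(D.r * K₀) : ℝ) : EReal) D.h0 with h | h
      · exact Or.inl h
      rcases le_or_gt K₁d K₁ with h1 | h1
      · exact Or.inr (Or.inr (Or.inl ⟨h, hneg, h1⟩))
      · refine Or.inr (Or.inr (Or.inr ⟨h, hneg, h1, ?_⟩))
        -- Evaluating the bound on w₀ - w₁ at x̂ gives K₀† ≤ K₀.
        obtain ⟨ζ, α, F⟩ := H.exists_freeBoundary hK hδ hd hK₁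
        obtain ⟨⟨y, hy, -, -, e⟩, -, -⟩ := (hK₀d K₁ hK₁ h1).2 ζ α F
        rw [e]
        exact hle ζ α F y (hδ.trans hy.1.1)
    · rintro ⟨-, -, hcase⟩ ζ α F x hx
      have X := H.solved hK hK₁ F
      rcases le_or_gt K₁d K₁ with h1 | h1
      · have hδζ : δd ≤ ζ := by
          rcases h1.eq_or_lt with rfl | h1
          · exact (hcrit ζ α F).ge
          · exact ((hdag.2 K₁ ζ α hK₁ F).2 h1).le
        exact (X.sub_nonpos hδζ hx).trans hK₀.le
      obtain ⟨⟨y, hy, -, e, -⟩, hmax, -⟩ := (hK₀d K₁ hK₁ h1).2 ζ α F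
      refine (hmax x hx).trans ?_
      rcases hcase with h | ⟨-, h⟩ | ⟨-, -, h⟩ | ⟨-, -, -, h⟩
      -- Here h ≥ -rK₀ on all of ]0, ∞[, and the explicit expression yields the bound.
      · rw [e]
        refine X.K₀Expr_le hK₀ hy.1 fun s hs => ?_
        by_contra! hcon
        exact not_lt.2 h ((H.h0_lt_iff _).2 ⟨s, hs, hcon⟩)
      · exact absurd hneg (not_lt.2 h)
      · exact absurd h1 (not_lt.2 h)
      · exact h
  · refine ⟨(hK₀d K₁ h.1 h.2).1, fun ζ α F => ?_⟩
    obtain ⟨⟨y, hy, hy', e, -⟩, -, -⟩ := (hK₀d K₁ h.1 h.2).2 ζ α F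
    exact ⟨y, hy, hy', e⟩
  · exact H.tendsto_K₀Dagger hδ hd X' (fun K₁ h1 h2 => (hK₀d K₁ h1 h2).1)
      fun K₁ h1 h2 ζ α F => ((hK₀d K₁ h1 h2).2 ζ α F).2.2
  · have X := H.solved hK hK₁ F
    refine ⟨fun h => ⟨X.T.hζ, (hdag.2 K₁ ζ α hK₁ F).1 h.2⟩, fun h => ⟨X.T.hζ, ?_⟩, fun h => ?_⟩
    · obtain ⟨-, rfl⟩ := h
      exact hcrit ζ α F
    · rcases h with h | h
      · exact absurd hneg (not_lt.2 h)
      · exact ⟨hδ, (hdag.2 K₁ ζ α hK₁ F).2 h.2⟩
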